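/- Fix $\alpha\in\mathbb R$ and let $\omega(\xi,\mu)=\xi^5-\alpha\xi^3+\mu^2/\xi$ be the dispersive function of the fifth order KP-I equation. Let $\hat{\ }$ and ${}^\vee$ denote the Fourier transform on $\mathbb R^3$ and its inverse, $\hat f(\xi,\mu,\tau)=(2\pi)^{-3/2}\iiint f(x,y,t)e^{-i(x\xi+y\mu+t\tau)}\,dx\,dy\,dt$ (extended to $L^2$ and to tempered distributions). For $j\ge 0$ let $\chi_0(\sigma)=\mathbf 1_{[0,1]}(|\sigma|)$ and $\chi_j(\sigma)=\mathbf 1_{[2^{j-1},2^j]}(|\sigma|)$ for $j\ge1$, and for $f\in L^2(\mathbb R^3)$ (complex valued) put $$f_j=\big(\chi_j(\tau-\omega(\xi,\mu))\,|\hat f|(\xi,\mu,\tau)\big)^\vee\in L^2(\mathbb R^3).$$ For $s\ge0$ let $|D_x|^sf_j$ be the tempered distribution whose Fourier transform is $|\xi|^s\widehat{f_j}$. For $T>0$ put $\|u\|_{L^q_T(L^r_{(x,y)})}=\Big(\int_{-T}^T\big(\iint|u(x,y,t)|^r\,dx\,dy\big)^{q/r}dt\Big)^{1/q}$, with the usual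 modification (essential supremum over $|t|\le T$) if $q=\infty$. Let $2\le r<\infty$, $\delta(r)=2\big(\tfrac12-\tfrac1r\big)$ and $\tfrac2q=\delta(r)$ (so $q=\infty$ if $r=2$). Then $|D_x|^{\delta(r)/2}f_j$ is a function, and there is a constant $C$, depending only on $\alpha$ and $r$, such that for all $f\in L^2(\mathbb R^3)$, all $j\ge0$ and all $0<T<1$ $$\big\||D_x|^{\frac{\delta(r)}2}f_j\big\|_{L^q_T(L^r_{(x,y)})}\le C\,2^{j/2}\|f_j\|_{L^2(\mathbb R^3)}.$$ In particular, with the same uniformity in $f$, $j$ and $T$ (the constants depending only on $\alpha$, and on $\delta$ in the last two estimates), $$\|f_j\|_{L^\infty_T(L^2_{(x,y)})}\lesssim2^{j/2}\|f_j\|_{L^2},\qquad \||D_x|^{1/4}f_j\|_{L^4_T(L^4_{(x,y)})}\lesssim2^{j/2}\|f_j\|_{L^2},$$ and, for $0<\delta<\tfrac12$, $$\||D_x|^{\delta}f_j\|_{L^{1/\delta}_T(L^{2/(1-2\delta)}_{(x,y)})}\lesssim2^{j/2}\|f_j\|_{L^2},\qquad \||D_x|^{\frac12-\delta}f_j\|_{L^{2/(1-2\delta)}_T(L^{1/\delta}_{(x,y)})}\lesssim2^{j/2}\|f_j\|_{L^2}.$$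 -/

import Mathlib

open MeasureTheory FourierTransform SchwartzMap
open scoped ENNReal

noncomputable section

/-- Space-time `ℝ³`. In physical space the coordinates `0, 1, 2` are `x, y, t`; in frequency space
they are the dual variables `ξ, μ, τ`. -/
abbrev SpaceTime : Type := EuclideanSpace ℝ (Fin 3)

/-- The dispersive function `ω(ξ, μ) = ξ⁵ - α ξ³ + μ² / ξ` of the fifth order KP-I equation. The
value on the null set `ξ = 0` plays no role. -/
def omega (α ξ μ : ℝ) : ℝ := ξ ^ 5 - α * ξ ^ 3 + μ ^ 2 / ξ

/-- The dyadic cut-offs in the modulation variable: `chi 0` is the indicator function of `|σ| ≤ 1`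
and, for `j ≥ 1`, `chi j` is the indicator function of `2 ^ (j - 1) ≤ |σ| ≤ 2 ^ j`. -/
def chi : ℕ → ℝ → ℝ
  | 0, σ => (Set.Icc (0 : ℝ) 1).indicator 1 |σ|
  | j + 1, σ => (Set.Icc ((2 : ℝ) ^ j) (2 ^ (j + 1))).indicator 1 |σ|

/-- The symbol `χ_j(τ - ω(ξ, μ))`. -/
def chiSymbol (α : ℝ) (j : ℕ) (ζ : SpaceTime) : ℝ := chi j (ζ 2 - omega α (ζ 0) (ζ 1))

/-- Mathlib's Fourier transform `𝓕` has the kernel `exp (-2πi ⟨z, η⟩)`, whereas the frequency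
variables `ζ = (ξ, μ, τ)` above belong to the kernel `exp (-i ⟨z, ζ⟩)`. Hence `ζ = 2π η` and
`f̂ ζ = (2π)^(-3/2) 𝓕 f (ζ / 2π)`, and the function `χ_j |f̂|` becomes the following function of the
variable `η` (the normalising factor cancels against that of the inverse transform). -/
def pieceFourier (α : ℝ) (j : ℕ) (f : Lp ℂ 2 (volume : Measure SpaceTime)) (η : SpaceTime) : ℂ :=
  ((chiSymbol α j ((2 * Real.pi) • η) * ‖𝓕 f η‖ : ℝ) : ℂ)

theorem measurable_chi (j : ℕ) : Measurable (chi j) := by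
  cases j with
  | zero =>
    exact (measurable_one.indicator measurableSet_Icc).comp continuous_abs.measurable
  | succ j =>
    exact (measurable_one.indicator measurableSet_Icc).comp continuous_abs.measurable

theorem abs_chi_le_one (j : ℕ) (σ : ℝ) : |chi j σ| ≤ 1 := by
  cases j <;> simp only [chi, Set.indicator_apply] <;> split_ifs <;> simp

theorem measurable_chiSymbol (α : ℝ) (j : ℕ) : Measurable (chiSymbol α j) := by
  apply (measurable_chi j).comp
  unfold omega
  fun_prop

theorem memLp_pieceFourier (α : ℝ) (j : ℕ) (f : Lp ℂ 2 (volume : Measure SpaceTime)) :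
    MemLp (pieceFourier α j f) 2 volume := by
  refine (Lp.memLp (𝓕 f)).of_le ?_ (Filter.Eventually.of_forall fun η => ?_)
  · have h1 : Measurable fun η : SpaceTime => chiSymbol α j ((2 * Real.pi) • η) :=
      (measurable_chiSymbol α j).comp (measurable_const_smul _)
    exact Complex.continuous_ofReal.comp_aestronglyMeasurable
      (h1.aestronglyMeasurable.mul (Lp.aestronglyMeasurable (𝓕 f)).norm)
  · simp only [pieceFourier, Complex.norm_real, norm_mul, Real.norm_eq_abs, abs_norm]
    exact mul_le_of_le_one_left (norm_nonneg _) (abs_chi_le_one _ _)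

/-- The dyadic piece `f_j = (χ_j(τ - ω(ξ, μ)) |f̂|)^∨` of `f ∈ L²(ℝ³)`. -/
def dyadicPiece (α : ℝ) (j : ℕ) (f : Lp ℂ 2 (volume : Measure SpaceTime)) :
    Lp ℂ 2 (volume : Measure SpaceTime) :=
  𝓕⁻ ((memLp_pieceFourier α j f).toLp (pieceFourier α j f))

/-- The functions `u` and `G` define tempered distributions, and `𝓕 u = G` as tempered
distributions. -/
def IsFourierPair (u G : SpaceTime → ℂ) : Prop :=
  AEStronglyMeasurable u volume ∧ AEStronglyMeasurable G volume ∧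
    ∀ φ : 𝓢(SpaceTime, ℂ),
      Integrable (fun z => u z * φ z) volume ∧ Integrable (fun η => G η * φ η) volume ∧
        ∫ z, u z * 𝓕 φ z = ∫ η, G η * φ η

/-- The tempered distribution `|D_x|^s g`, that is, the inverse Fourier transform of `|ξ|^s ĝ`, is
(given by) the function `u`. Here `|ξ| = |2π η₀|` in Mathlib's normalisation. Such a `u` is unique
up to null sets. -/
def IsAbsDx (s : ℝ) (g : Lp ℂ 2 (volume : Measure SpaceTime)) (u : SpaceTime → ℂ) : Prop :=
  IsFourierPair u fun η => ((|2 * Real.pi * η 0| ^ s : ℝ) : ℂ) * 𝓕 g η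

/-- The mixed norm `‖u‖_{L^q_T(L^r_{(x,y)})}`, with `t` ranging over `[-T, T]` and `(x, y)` over
`ℝ²`, as an extended nonnegative real number. -/
def mixedNorm (T : ℝ) (q r : ℝ≥0∞) (u : SpaceTime → ℂ) : ℝ≥0∞ :=
  eLpNorm (fun t : ℝ => eLpNorm (fun p : ℝ × ℝ => u !₂[p.1, p.2, t]) r volume) q
    (volume.restrict (Set.Icc (-T) T))

/-- `δ(r) = 2 (1/2 - 1/r)`. -/
def delta (r : ℝ) : ℝ := 2 * (1 / 2 - 1 / r)

/-- The estimate `‖|D_x|^s f_j‖_{L^q_T(L^r_{(x,y)})} ≤ C 2^(j/2) ‖f_j‖_{L²}` for all `f ∈ L²(ℝ³)`,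
all `j ≥ 0` and all `0 < T < 1`, with a constant `C` that does not depend on `f`, `j`, `T`. It
includes that the tempered distribution `|D_x|^s f_j` is a function. -/
def DyadicEstimate (α s : ℝ) (q r : ℝ≥0∞) : Prop :=
  ∃ C : ℝ, 0 < C ∧ ∀ (f : Lp ℂ 2 (volume : Measure SpaceTime)) (j : ℕ),
    ∃ u : SpaceTime → ℂ, IsAbsDx s (dyadicPiece α j f) u ∧
      ∀ T : ℝ, 0 < T → T < 1 →
        mixedNorm T q r u ≤ ENNReal.ofReal (C * (2 : ℝ) ^ ((j : ℝ) / 2) * ‖dyadicPiece α j f‖)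

end

/-! The amplitude `χ_j |f̂|` enters only as an `L²` function carried by the set `|τ - ω(ξ, μ)| ≤
2^j`. That set is a union of vertical translates of the characteristic surface `τ = ω`. Each
translate obeys a Strichartz estimate for the group `exp (i t ω(D))` with a gain of `θ / 2`
derivatives in `x`, where `θ = δ(r)`, and Cauchy–Schwarz over heights filling an interval of length
about `2^j` gives the factor `2^(j/2)`.

The heart is a dispersive bound: the kernel of `|D_x|^(1 + iβ) exp (i t ω(D))` is `O((1 + |β|) /
|t|)` for `0 < |t| ≤ 2`. The integral over `μ` is Gaussian. It produces `|t|^(-1/2) |ξ|^(1/2)` and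
replaces `x` by `x - y² / (4t)`. What remains is the integral of `ξ^(3/2 + iβ) exp (i (xξ + t (ξ⁵ -
αξ³)))`. At high frequency the second derivative of this phase is comparable to `t ξ³`, so the
weight `ξ^(3/2)` is exactly what a van der Corput argument can afford, with gain `|t|^(-1/2)`. Low
frequencies are bounded trivially, and this is what confines the estimate to bounded times. See
`norm_integral_oscIntegrand_le` and `norm_integral_groupSymbol_le`.

Stein interpolation with the `L²` bound on the line `Re w = 0` gives decay `|t|^(-θ)` for `|D_x|^θ
exp (i t ω(D))` from `L^(2/(1+θ))` to its dual (`norm_planeForm_groupSymbol_le`). For `0 < θ < 1`,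
the `TT*` identity and the Hardy–Littlewood–Sobolev inequality in time (`lintegral_fractional_le`)
turn this into a weighted `L²` bound, on the surface, for the Fourier transform of a test function
living in `|t| ≤ 1` (`lintegral_surfaceTransform_le`). Integrating over the translates
(`setLIntegral_spaceTransform_le`) and using duality of the mixed norm
(`lintegral_mixed_le_of_test`) gives the estimate. For `θ = 0` it is the energy estimate, that is,
Plancherel in `(x, y)`.

All of this is done for bounded, compactly supported amplitudes away from `ξ = 0`, with constants
independent of the cut-offs. To remove the cut-offs, note that the estimate holds with one constant
on every time interval of length `2`, and therefore controls a weighted `L¹` norm on all of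
space-time. The truncated solutions then converge in that weighted space. Their limit is a genuine
function, represents `|D_x|^(θ/2) f_j`, and inherits the estimate by Fatou (`exists_strichartz`). -/

noncomputable section

/-! ### One-dimensional oscillatory integrals with weight `ξ^(3/2)` -/

/-- Integration by parts away from the stationary points: if `φ' = ω h`, the factor
`m² / (h² + m²)` localises to the region `|h| ≲ m`, where no oscillation is used. -/
theorem norm_integral_mul_cexp_le {A B m : ℝ} (hAB : A ≤ B) (hm : 0 < m)
    {φ h h' ω : ℝ → ℝ} {g g' : ℝ → ℂ}
    (hφ : ∀ ξ ∈ Set.Icc A B, HasDerivAt φ (ω ξ * h ξ) ξ)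
    (hh : ∀ ξ ∈ Set.Icc A B, HasDerivAt h (h' ξ) ξ)
    (hg : ∀ ξ ∈ Set.Icc A B, HasDerivAt g (g' ξ) ξ)
    (ch' : ContinuousOn h' (Set.Icc A B)) (cg' : ContinuousOn g' (Set.Icc A B))
    (cω : ContinuousOn ω (Set.Icc A B)) (ω0 : ∀ ξ ∈ Set.Icc A B, 0 ≤ ω ξ)
    (g1 : ∀ ξ ∈ Set.Icc A B, ‖g ξ‖ ≤ 1) :
    ‖∫ ξ in A..B, (ω ξ : ℂ) * g ξ * Complex.exp (φ ξ * Complex.I)‖ ≤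
      (∫ ξ in A..B, ω ξ * m ^ 2 / (h ξ ^ 2 + m ^ 2)) + 1 / m +
      (∫ ξ in A..B, ‖g' ξ‖ * (|h ξ| / (h ξ ^ 2 + m ^ 2))) +
      ∫ ξ in A..B, |h' ξ| / (h ξ ^ 2 + m ^ 2) := by
  have ch : ContinuousOn h (Set.Icc A B) := fun ξ hξ => (hh ξ hξ).continuousAt.continuousWithinAt
  have cg : ContinuousOn g (Set.Icc A B) := fun ξ hξ => (hg ξ hξ).continuousAt.continuousWithinAt
  have cφ : ContinuousOn φ (Set.Icc A B) := fun ξ hξ => (hφ ξ hξ).continuousAt.continuousWithinAt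
  have hD : ∀ ξ, 0 < h ξ ^ 2 + m ^ 2 := fun ξ => by positivity
  have hD' : ∀ ξ, h ξ ^ 2 + m ^ 2 ≠ 0 := fun ξ => (hD ξ).ne'
  have cE : ContinuousOn (fun ξ => Complex.exp (φ ξ * Complex.I)) (Set.Icc A B) := by
    fun_prop
  set k : ℝ → ℝ := fun ξ => h ξ / (h ξ ^ 2 + m ^ 2) with hk
  set k' : ℝ → ℝ := fun ξ => h' ξ * (m ^ 2 - h ξ ^ 2) / (h ξ ^ 2 + m ^ 2) ^ 2 with hk'
  have dk : ∀ ξ ∈ Set.Icc A B, HasDerivAt k (k' ξ) ξ := by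
    intro ξ hξ
    refine HasDerivAt.congr_deriv (f := k)
      ((hh ξ hξ).div (((hh ξ hξ).pow 2).add_const (m ^ 2)) (hD' ξ)) ?_
    simp only [hk', Nat.cast_ofNat]
    congr 1
    ring
  have ck : ContinuousOn k (Set.Icc A B) := fun ξ hξ => (dk ξ hξ).continuousAt.continuousWithinAt
  have ck' : ContinuousOn k' (Set.Icc A B) := by
    apply ContinuousOn.div
    · fun_prop
    · fun_prop
    · intro ξ _; exact pow_ne_zero _ (hD' ξ)
  have ckm : ∀ ξ, |k ξ| ≤ 1 / (2 * m) := by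
    intro ξ
    rw [hk]; simp only
    rw [abs_div, abs_of_pos (hD ξ), div_le_div_iff₀ (hD ξ) (by positivity)]
    nlinarith [sq_nonneg (|h ξ| - m), sq_abs (h ξ)]
  have ckm' : ∀ ξ, |k' ξ| ≤ |h' ξ| / (h ξ ^ 2 + m ^ 2) := by
    intro ξ
    simp only [hk', abs_div, abs_mul, abs_pow, abs_of_pos (hD ξ)]
    rw [div_le_div_iff₀ (by have := hD ξ; positivity) (hD ξ)]
    have : |m ^ 2 - h ξ ^ 2| ≤ h ξ ^ 2 + m ^ 2 := by
      rw [abs_le]; constructor <;> nlinarith [sq_nonneg (h ξ), sq_nonneg m]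
    calc |h' ξ| * |m ^ 2 - h ξ ^ 2| * (h ξ ^ 2 + m ^ 2)
        ≤ |h' ξ| * (h ξ ^ 2 + m ^ 2) * (h ξ ^ 2 + m ^ 2) := by gcongr
      _ = _ := by ring
  have huI : Set.uIcc A B = Set.Icc A B := Set.uIcc_of_le hAB
  -- Write `1 = m² / (h² + m²) + h² / (h² + m²)`. In the second part one factor `h` combines with
  -- `ω` to form `φ'`, so `φ' exp (iφ)` can be integrated. The other factor stays in `k = h / (h² +
  -- m²)`, which is bounded by `1 / (2m)`; the two boundary terms thus cost `1 / m`.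
  have split : (∫ ξ in A..B, (ω ξ : ℂ) * g ξ * Complex.exp (φ ξ * Complex.I)) =
      (∫ ξ in A..B, ((ω ξ * m ^ 2 / (h ξ ^ 2 + m ^ 2) : ℝ) : ℂ) * g ξ
        * Complex.exp (φ ξ * Complex.I)) +
      ∫ ξ in A..B, (g ξ * (k ξ : ℂ)) * (((ω ξ * h ξ : ℝ) : ℂ) * Complex.exp (φ ξ * Complex.I)) := by
    rw [← intervalIntegral.integral_add]
    · apply intervalIntegral.integral_congr
      intro ξ _
      have h2 : ((h ξ : ℂ) ^ 2 + (m : ℂ) ^ 2) ≠ 0 := by exact_mod_cast hD' ξ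
      simp only [hk]
      push_cast
      field_simp
      ring
    · apply ContinuousOn.intervalIntegrable
      rw [huI]
      have : ContinuousOn (fun ξ => ω ξ * m ^ 2 / (h ξ ^ 2 + m ^ 2)) (Set.Icc A B) :=
        ContinuousOn.div (by fun_prop) (by fun_prop) (fun ξ _ => hD' ξ)
      fun_prop
    · apply ContinuousOn.intervalIntegrable
      rw [huI]
      fun_prop
  have ibp := intervalIntegral.integral_mul_deriv_eq_deriv_mul (a := A) (b := B)
    (u := fun ξ => g ξ * (k ξ : ℂ)) (u' := fun ξ => g' ξ * (k ξ : ℂ) + g ξ * (k' ξ : ℂ))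
    (v := fun ξ => -Complex.I * Complex.exp (φ ξ * Complex.I))
    (v' := fun ξ => ((ω ξ * h ξ : ℝ) : ℂ) * Complex.exp (φ ξ * Complex.I))
    (by
      intro ξ hξ
      rw [huI] at hξ
      exact (hg ξ hξ).mul (dk ξ hξ).ofReal_comp)
    (by
      intro ξ hξ
      rw [huI] at hξ
      have := (((hφ ξ hξ).ofReal_comp.mul_const Complex.I).cexp).const_mul (-Complex.I)
      convert this using 1
      have : Complex.I * Complex.I = -1 := Complex.I_mul_I
      linear_combination ((((ω ξ * h ξ : ℝ) : ℂ) * Complex.exp (φ ξ * Complex.I))) * this)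
    (by
      apply ContinuousOn.intervalIntegrable
      rw [huI]
      fun_prop)
    (by
      apply ContinuousOn.intervalIntegrable
      rw [huI]
      fun_prop)
  have nE : ∀ ξ, ‖Complex.exp (φ ξ * Complex.I)‖ = 1 := fun ξ => Complex.norm_exp_ofReal_mul_I _
  have bd : ∀ ξ ∈ Set.Icc A B,
      ‖g ξ * (k ξ : ℂ) * (-Complex.I * Complex.exp (φ ξ * Complex.I))‖ ≤ 1 / (2 * m) := by
    intro ξ hξ
    rw [norm_mul, norm_mul, norm_mul, nE, norm_neg, Complex.norm_I, Complex.norm_real,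
      Real.norm_eq_abs, mul_one, mul_one]
    calc ‖g ξ‖ * |k ξ| ≤ 1 * (1 / (2 * m)) := by
          gcongr
          · exact g1 ξ hξ
          · exact ckm ξ
      _ = _ := one_mul _
  have e1 : ‖∫ ξ in A..B, ((ω ξ * m ^ 2 / (h ξ ^ 2 + m ^ 2) : ℝ) : ℂ) * g ξ
        * Complex.exp (φ ξ * Complex.I)‖ ≤ ∫ ξ in A..B, ω ξ * m ^ 2 / (h ξ ^ 2 + m ^ 2) := by
    apply intervalIntegral.norm_integral_le_of_norm_le hAB
    · refine Filter.Eventually.of_forall fun ξ hξ => ?_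
      have hξ' : ξ ∈ Set.Icc A B := Set.Ioc_subset_Icc_self hξ
      have : 0 ≤ ω ξ * m ^ 2 / (h ξ ^ 2 + m ^ 2) :=
        div_nonneg (mul_nonneg (ω0 ξ hξ') (sq_nonneg m)) (hD ξ).le
      rw [norm_mul, norm_mul, nE, Complex.norm_real, Real.norm_eq_abs, abs_of_nonneg this, mul_one]
      exact mul_le_of_le_one_right this (g1 ξ hξ')
    · apply ContinuousOn.intervalIntegrable
      rw [huI]
      exact ContinuousOn.div (by fun_prop) (by fun_prop) (fun ξ _ => hD' ξ)
  have e2 : ‖∫ ξ in A..B, (g' ξ * (k ξ : ℂ) + g ξ * (k' ξ : ℂ)) *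
      (-Complex.I * Complex.exp (φ ξ * Complex.I))‖ ≤
      ∫ ξ in A..B, (‖g' ξ‖ * (|h ξ| / (h ξ ^ 2 + m ^ 2)) + |h' ξ| / (h ξ ^ 2 + m ^ 2)) := by
    apply intervalIntegral.norm_integral_le_of_norm_le hAB
    · refine Filter.Eventually.of_forall fun ξ hξ => ?_
      have hξ' : ξ ∈ Set.Icc A B := Set.Ioc_subset_Icc_self hξ
      rw [norm_mul, norm_mul, nE, norm_neg, Complex.norm_I, mul_one, mul_one]
      refine (norm_add_le _ _).trans ?_
      rw [norm_mul, norm_mul, Complex.norm_real, Complex.norm_real, Real.norm_eq_abs,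
        Real.norm_eq_abs]
      have : |k ξ| = |h ξ| / (h ξ ^ 2 + m ^ 2) := by
        simp only [hk, abs_div, abs_of_pos (hD ξ)]
      rw [this]
      gcongr
      calc ‖g ξ‖ * |k' ξ| ≤ 1 * (|h' ξ| / (h ξ ^ 2 + m ^ 2)) := by
            gcongr
            · exact g1 ξ hξ'
            · exact ckm' ξ
        _ = _ := one_mul _
    · apply ContinuousOn.intervalIntegrable
      rw [huI]
      exact (ContinuousOn.mul (by fun_prop) (ContinuousOn.div (by fun_prop) (by fun_prop)
        (fun ξ _ => hD' ξ))).add (ContinuousOn.div (by fun_prop) (by fun_prop)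
        (fun ξ _ => hD' ξ))
  rw [intervalIntegral.integral_add] at e2
  · rw [split, ibp]
    have b1 := bd B (Set.right_mem_Icc.2 hAB)
    have b2 := bd A (Set.left_mem_Icc.2 hAB)
    have : (1 : ℝ) / m = 1 / (2 * m) + 1 / (2 * m) := by field_simp; norm_num
    rw [this]
    refine (norm_add_le _ _).trans ?_
    refine (add_le_add le_rfl ((norm_sub_le _ _).trans (add_le_add (norm_sub_le _ _) le_rfl))).trans ?_
    linarith
  · apply ContinuousOn.intervalIntegrable
    rw [huI]
    exact ContinuousOn.mul (by fun_prop) (ContinuousOn.div (by fun_prop) (by fun_prop)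
        (fun ξ _ => hD' ξ))
  · apply ContinuousOn.intervalIntegrable
    rw [huI]
    exact ContinuousOn.div (by fun_prop) (by fun_prop) (fun ξ _ => hD' ξ)

/-- The derivative of the phase `x ξ + t (ξ⁵ - α ξ³)` divided by `ξ ^ (3/2)`. -/
def phaseRatio (α t x ξ : ℝ) : ℝ :=
  x * ξ ^ (-(3 / 2) : ℝ) + t * (5 * ξ ^ (5 / 2 : ℝ) - 3 * α * ξ ^ (1 / 2 : ℝ))

/-- The derivative of `phaseRatio`. -/
def phaseRatioDeriv (α t x ξ : ℝ) : ℝ :=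
  x * (-(3 / 2) * ξ ^ (-(5 / 2) : ℝ)) +
    t * (25 / 2 * ξ ^ (3 / 2 : ℝ) - 3 / 2 * α * ξ ^ (-(1 / 2) : ℝ))

theorem hasDerivAt_phaseRatio (α t x : ℝ) {ξ : ℝ} (hξ : 0 < ξ) :
    HasDerivAt (phaseRatio α t x) (phaseRatioDeriv α t x ξ) ξ := by
  have h (p : ℝ) := Real.hasDerivAt_rpow_const (x := ξ) (p := p) (Or.inl hξ.ne')
  have := ((h (-(3 / 2))).const_mul x).add
    ((((h (5 / 2)).const_mul 5).sub ((h (1 / 2)).const_mul (3 * α))).const_mul t)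
  refine HasDerivAt.congr_deriv this ?_
  simp only [phaseRatioDeriv]
  norm_num
  ring_nf
  simp

/-- With `r = √ξ` every half-integer power becomes an integer power, on which algebraic
normalisation works. -/
theorem exists_sqrt_rpow {ξ : ℝ} (hξ : 0 < ξ) : ∃ r : ℝ, 0 < r ∧ ξ = r ^ 2 ∧
    ξ ^ (1 / 2 : ℝ) = r ∧ ξ ^ (3 / 2 : ℝ) = r ^ 3 ∧ ξ ^ (5 / 2 : ℝ) = r ^ 5 ∧
    ξ ^ (-(1 / 2) : ℝ) = (r)⁻¹ ∧ ξ ^ (-(3 / 2) : ℝ) = (r ^ 3)⁻¹ ∧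
    ξ ^ (-(5 / 2) : ℝ) = (r ^ 5)⁻¹ ∧ ξ ^ (-(7 / 2) : ℝ) = (r ^ 7)⁻¹ := by
  have key (n : ℕ) : ξ ^ ((n : ℝ) / 2) = (ξ ^ (1 / 2 : ℝ)) ^ n := by
    rw [← Real.rpow_natCast, ← Real.rpow_mul hξ.le]; congr 1; ring
  have k2 := key 2; have k3 := key 3; have k5 := key 5; have k7 := key 7
  norm_num at k2 k3 k5 k7
  refine ⟨ξ ^ (1 / 2 : ℝ), Real.rpow_pos_of_pos hξ _, k2, rfl, k3, k5, ?_, ?_, ?_, ?_⟩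
  · rw [Real.rpow_neg hξ.le]
  · rw [Real.rpow_neg hξ.le, k3]
  · rw [Real.rpow_neg hξ.le, k5]
  · rw [Real.rpow_neg hξ.le, k7]

theorem rpow_mul_phaseRatio (α t x : ℝ) {ξ : ℝ} (hξ : 0 < ξ) :
    ξ ^ (3 / 2 : ℝ) * phaseRatio α t x ξ = x + t * (5 * ξ ^ 4 - 3 * α * ξ ^ 2) := by
  obtain ⟨r, hr, h0, h1, h3, h5, h1', h3', h5', h7'⟩ := exists_sqrt_rpow hξ
  rw [phaseRatio, h3, h3', h5, h1, h0]
  field_simp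

theorem hasDerivAt_phase (α t x : ℝ) {ξ : ℝ} (hξ : 0 < ξ) :
    HasDerivAt (fun ξ => x * ξ + t * (ξ ^ 5 - α * ξ ^ 3))
      (ξ ^ (3 / 2 : ℝ) * phaseRatio α t x ξ) ξ := by
  rw [rpow_mul_phaseRatio α t x hξ]
  have := ((hasDerivAt_id ξ).const_mul x).add
    (((hasDerivAt_pow 5 ξ).sub ((hasDerivAt_pow 3 ξ).const_mul α)).const_mul t)
  refine HasDerivAt.congr_deriv this ?_
  norm_num
  ring_nf
  simp

/-- The integral is at most `(2/5) t⁻¹ A^(-5/2)`, and `1 ≤ t A⁵` means `A^(-5/2) ≤ √t`. -/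
theorem integral_rpow_tail_le {A B t : ℝ} (hA : 0 < A) (hAB : A ≤ B) (ht : 0 < t)
    (htA : 1 ≤ t * A ^ 5) :
    ∫ ξ in A..B, t⁻¹ * ξ ^ (-(7 / 2) : ℝ) ≤ 1 / √t := by
  have hB : 0 < B := hA.trans_le hAB
  rw [intervalIntegral.integral_const_mul, integral_rpow]
  · norm_num
    obtain ⟨r, hr, h0, h1, h3, h5, h1', h3', h5', h7'⟩ := exists_sqrt_rpow hA
    have hBp : 0 ≤ B ^ (-(5 / 2) : ℝ) := (Real.rpow_pos_of_pos hB _).le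
    rw [h5']
    have hs : 0 < √t := Real.sqrt_pos.2 ht
    have hs2 : √t ^ 2 = t := Real.sq_sqrt ht.le
    have : 1 ≤ √t * r ^ 5 := by
      rw [h0, ← hs2] at htA
      by_contra hc
      push Not at hc
      have : (√t * r ^ 5) ^ 2 < 1 := by
        apply pow_lt_one₀ (by positivity) hc (by norm_num)
      nlinarith
    have h2 : (r ^ 5)⁻¹ ≤ √t := by
      rw [inv_le_iff_one_le_mul₀ (by positivity)]; linarith
    have h3 : t⁻¹ * √t = (√t)⁻¹ := by
      rw [inv_mul_eq_div, Real.sqrt_div_self', one_div]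
    rw [← h3]
    gcongr
    linarith
  · right
    constructor
    · norm_num
    · rw [Set.uIcc_of_le hAB]
      intro h; exact absurd h.1 (not_le.2 hA)

/-- For `x ≤ 0` the phase may be stationary, but the ratio is then increasing: the `x` term of its
derivative is nonnegative, and `α ≤ ξ²` lets the quintic term absorb the cubic one. -/
theorem phaseRatioDeriv_lower {α t x ξ : ℝ} (ht : 0 < t) (hx : x ≤ 0) (hξ : 1 + |α| ≤ ξ) :
    t * ξ ^ (3 / 2 : ℝ) ≤ phaseRatioDeriv α t x ξ := by
  have hξ1 : 1 ≤ ξ := by linarith [abs_nonneg α]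
  have hξ0 : 0 < ξ := by linarith
  have hα : α ≤ ξ ^ 2 := by nlinarith [le_abs_self α]
  obtain ⟨r, hr, h0, h1, h3, h5, h1', h3', h5', h7'⟩ := exists_sqrt_rpow hξ0
  rw [phaseRatioDeriv, h3, h5', h1']
  have e1 : 0 ≤ x * (-(3 / 2) * (r ^ 5)⁻¹) := by
    have : 0 < (r ^ 5)⁻¹ := by positivity
    nlinarith
  have e2 : α * r⁻¹ ≤ r ^ 3 := by
    rw [h0] at hα
    calc α * r⁻¹ ≤ (r ^ 2) ^ 2 * r⁻¹ := by gcongr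
      _ = r ^ 3 := by field_simp
  have e3 : t * r ^ 3 ≤ t * (25 / 2 * r ^ 3 - 3 / 2 * α * r⁻¹) := by
    have : 0 < r ^ 3 := by positivity
    gcongr
    nlinarith
  linarith

/-- For `x ≥ 0` there is no stationary point above `1 + |α|`: the `x` term only helps and the
quintic term dominates the cubic one. Differentiation costs a factor `1 / ξ`, since the ratio is a
combination of powers of `ξ` whose total is comparable to its leading parts. -/
theorem phaseRatio_lower {α t x ξ : ℝ} (ht : 0 < t) (hx : 0 ≤ x) (hξ : 1 + |α| ≤ ξ) :
    t * ξ ^ (5 / 2 : ℝ) ≤ phaseRatio α t x ξ ∧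
      |phaseRatioDeriv α t x ξ| ≤ 28 * phaseRatio α t x ξ / ξ := by
  have hξ1 : 1 ≤ ξ := by linarith [abs_nonneg α]
  have hξ0 : 0 < ξ := by linarith
  have hα : |α| ≤ ξ ^ 2 := by nlinarith [abs_nonneg α]
  obtain ⟨r, hr, h0, h1, h3, h5, h1', h3', h5', h7'⟩ := exists_sqrt_rpow hξ0
  rw [h0] at hα
  have hα' := abs_le.1 hα
  have e1 : 0 ≤ x * (r ^ 3)⁻¹ := by positivity
  have e2 : α * r ≤ r ^ 5 := by
    calc α * r ≤ (r ^ 2) ^ 2 * r := by gcongr; exact hα'.2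
      _ = r ^ 5 := by ring
  have e2' : -(r ^ 5) ≤ α * r := by
    calc -(r ^ 5) = (-(r ^ 2) ^ 2) * r := by ring
      _ ≤ α * r := by gcongr; exact hα'.1
  have e4 : t * r ^ 5 ≤ t * (5 * r ^ 5 - 3 * α * r) := by
    have : 0 < r ^ 5 := by positivity
    gcongr
    nlinarith
  have hlow : t * r ^ 5 ≤ x * (r ^ 3)⁻¹ + t * (5 * r ^ 5 - 3 * α * r) := by linarith
  constructor
  · rw [phaseRatio, h5, h3', h1]
    exact hlow
  · rw [le_div_iff₀ hξ0, phaseRatioDeriv, phaseRatio, h3, h5', h1', h5, h3', h1, h0]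
    rw [← abs_of_pos (show 0 < r ^ 2 by positivity), ← abs_mul]
    have : (x * (-(3 / 2) * (r ^ 5)⁻¹) + t * (25 / 2 * r ^ 3 - 3 / 2 * α * r⁻¹)) * r ^ 2
        = -(3 / 2) * (x * (r ^ 3)⁻¹) + t * (25 / 2 * r ^ 5 - 3 / 2 * α * r) := by
      field_simp
    rw [this]
    have f1 : t * (α * r) ≤ t * r ^ 5 := by gcongr
    have f2 : -(t * r ^ 5) ≤ t * (α * r) := by rw [← mul_neg]; gcongr
    have f0 : 0 < t * r ^ 5 := by positivity
    rw [abs_le]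
    constructor <;> nlinarith

/-- The integrand is the derivative of `m⁻¹ arctan (h / m)`, whose values lie in an interval of
length `π / m`. -/
theorem integral_deriv_div_sq_add_sq_le {A B m : ℝ} (hAB : A ≤ B) (hm : 0 < m) {h h' : ℝ → ℝ}
    (hh : ∀ ξ ∈ Set.Icc A B, HasDerivAt h (h' ξ) ξ) (ch' : ContinuousOn h' (Set.Icc A B)) :
    ∫ ξ in A..B, h' ξ / (h ξ ^ 2 + m ^ 2) ≤ 4 / m := by
  have huI : Set.uIcc A B = Set.Icc A B := Set.uIcc_of_le hAB
  have ch : ContinuousOn h (Set.Icc A B) := fun ξ hξ => (hh ξ hξ).continuousAt.continuousWithinAt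
  rw [intervalIntegral.integral_eq_sub_of_hasDerivAt (f := fun ξ => m⁻¹ * Real.arctan (h ξ / m))]
  · have h1 := Real.arctan_lt_pi_div_two (h B / m)
    have h2 := Real.neg_pi_div_two_lt_arctan (h A / m)
    have h3 := Real.pi_lt_four
    rw [← mul_sub, div_eq_inv_mul 4 m]
    gcongr
    linarith
  · intro ξ hξ
    rw [huI] at hξ
    refine HasDerivAt.congr_deriv ((((hh ξ hξ).div_const m).arctan).const_mul m⁻¹) ?_
    have : h ξ ^ 2 + m ^ 2 ≠ 0 := by positivity
    field_simp
    ring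
  · apply ContinuousOn.intervalIntegrable
    rw [huI]
    exact ContinuousOn.div (by fun_prop) (by fun_prop) (fun ξ _ => by positivity)

theorem continuousOn_phaseRatioDeriv (α t x : ℝ) {A B : ℝ} (hA : 0 < A) :
    ContinuousOn (phaseRatioDeriv α t x) (Set.Icc A B) := by
  have h (p : ℝ) : ContinuousOn (fun ξ : ℝ => ξ ^ p) (Set.Icc A B) := fun ξ hξ =>
    (Real.continuousAt_rpow_const ξ p (Or.inl (hA.trans_le hξ.1).ne')).continuousWithinAt
  have h1 := h (-(5 / 2)); have h2 := h (3 / 2); have h3 := h (-(1 / 2))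
  unfold phaseRatioDeriv
  fun_prop

/-- The two integrals that control the oscillatory integral on high frequencies. -/
theorem integral_phaseRatio_le {α t x A B : ℝ} (ht : 0 < t) (hA : 1 + |α| ≤ A) (hAB : A ≤ B)
    (htA : 1 ≤ t * A ^ 5) :
    (∫ ξ in A..B, ξ ^ (3 / 2 : ℝ) * √t ^ 2 / (phaseRatio α t x ξ ^ 2 + √t ^ 2)) ≤ 28 / √t ∧
    (∫ ξ in A..B, |phaseRatioDeriv α t x ξ| / (phaseRatio α t x ξ ^ 2 + √t ^ 2)) ≤ 28 / √t := by
  have hs : 0 < √t := Real.sqrt_pos.2 ht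
  have hs2 : √t ^ 2 = t := Real.sq_sqrt ht.le
  have hA0 : 0 < A := by linarith [abs_nonneg α]
  have huI : Set.uIcc A B = Set.Icc A B := Set.uIcc_of_le hAB
  have hh : ∀ ξ ∈ Set.Icc A B, HasDerivAt (phaseRatio α t x) (phaseRatioDeriv α t x ξ) ξ :=
    fun ξ hξ => hasDerivAt_phaseRatio α t x (hA0.trans_le hξ.1)
  have ch : ContinuousOn (phaseRatio α t x) (Set.Icc A B) :=
    fun ξ hξ => (hh ξ hξ).continuousAt.continuousWithinAt
  have ch' := continuousOn_phaseRatioDeriv α t x hA0 (B := B)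
  have cp (p : ℝ) : ContinuousOn (fun ξ : ℝ => ξ ^ p) (Set.Icc A B) := fun ξ hξ =>
    (Real.continuousAt_rpow_const ξ p (Or.inl (hA0.trans_le hξ.1).ne')).continuousWithinAt
  have cp3 := cp (3 / 2); have cp7 := cp (-(7 / 2))
  have hD : ∀ ξ, 0 < phaseRatio α t x ξ ^ 2 + √t ^ 2 := fun ξ => by positivity
  have i1 : IntervalIntegrable (fun ξ => ξ ^ (3 / 2 : ℝ) * √t ^ 2 /
      (phaseRatio α t x ξ ^ 2 + √t ^ 2)) volume A B := by
    apply ContinuousOn.intervalIntegrable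
    rw [huI]
    exact ContinuousOn.div (by fun_prop) (by fun_prop) (fun ξ _ => (hD ξ).ne')
  have i2 : IntervalIntegrable (fun ξ => |phaseRatioDeriv α t x ξ| /
      (phaseRatio α t x ξ ^ 2 + √t ^ 2)) volume A B := by
    apply ContinuousOn.intervalIntegrable
    rw [huI]
    exact ContinuousOn.div (by fun_prop) (by fun_prop) (fun ξ _ => (hD ξ).ne')
  -- For `x ≤ 0` both integrands are at most `h' / (h² + t)`, an arctangent derivative. For `x ≥ 0`
  -- both are at most `28 h / (ξ (h² + t))`, hence at most `28 t⁻¹ ξ^(-7/2)`, whose tail integral is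
  -- under control.
  rcases le_total x 0 with hx | hx
  · have key := integral_deriv_div_sq_add_sq_le hAB hs hh ch'
    have i3 : IntervalIntegrable (fun ξ => phaseRatioDeriv α t x ξ /
        (phaseRatio α t x ξ ^ 2 + √t ^ 2)) volume A B := by
      apply ContinuousOn.intervalIntegrable
      rw [huI]
      exact ContinuousOn.div (by fun_prop) (by fun_prop) (fun ξ _ => (hD ξ).ne')
    have low : ∀ ξ ∈ Set.Icc A B, t * ξ ^ (3 / 2 : ℝ) ≤ phaseRatioDeriv α t x ξ :=
      fun ξ hξ => phaseRatioDeriv_lower ht hx (hA.trans hξ.1)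
    have h28 : 4 / √t ≤ 28 / √t := by gcongr; norm_num
    constructor
    · refine (intervalIntegral.integral_mono_on hAB i1 i3 fun ξ hξ => ?_).trans (key.trans h28)
      rw [hs2, mul_comm]
      have := low ξ hξ
      gcongr
    · refine (intervalIntegral.integral_mono_on hAB i2 i3 fun ξ hξ => ?_).trans (key.trans h28)
      have h0 : 0 ≤ phaseRatioDeriv α t x ξ :=
        le_trans (mul_nonneg ht.le (Real.rpow_nonneg (hA0.trans_le hξ.1).le _)) (low ξ hξ)
      rw [abs_of_nonneg h0]
  · have key := integral_rpow_tail_le hA0 hAB ht htA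
    have i3 : IntervalIntegrable (fun ξ => t⁻¹ * ξ ^ (-(7 / 2) : ℝ)) volume A B := by
      apply ContinuousOn.intervalIntegrable
      rw [huI]
      fun_prop
    have low := fun ξ (hξ : ξ ∈ Set.Icc A B) => phaseRatio_lower (α := α) ht hx (hA.trans hξ.1)
    have hsq : ∀ ξ ∈ Set.Icc A B, 28 * phaseRatio α t x ξ / ξ /
        (phaseRatio α t x ξ ^ 2 + √t ^ 2) ≤ 28 * (t⁻¹ * ξ ^ (-(7 / 2) : ℝ)) := by
      intro ξ hξ
      have hξ0 : 0 < ξ := hA0.trans_le hξ.1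
      have hl := (low ξ hξ).1
      obtain ⟨r, hr, h0, h1, h3, h5, h1', h3', h5', h7'⟩ := exists_sqrt_rpow hξ0
      rw [h5] at hl
      rw [h7']
      set H := phaseRatio α t x ξ
      have hp : 0 < t * r ^ 5 := by positivity
      have hH : 0 < H := hp.trans_le hl
      calc 28 * H / ξ / (H ^ 2 + √t ^ 2) ≤ 28 * H / ξ / H ^ 2 := by
            gcongr; nlinarith
        _ = 28 * (1 / (r ^ 2 * H)) := by rw [h0]; field_simp
        _ ≤ 28 * (1 / (r ^ 2 * (t * r ^ 5))) := by gcongr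
        _ = _ := by field_simp
    have tot : ∫ ξ in A..B, 28 * (t⁻¹ * ξ ^ (-(7 / 2) : ℝ)) ≤ 28 / √t := by
      rw [intervalIntegral.integral_const_mul]
      calc _ ≤ 28 * (1 / √t) := by gcongr
        _ = _ := by ring
    constructor
    · refine (intervalIntegral.integral_mono_on hAB i1 (i3.const_mul 28) fun ξ hξ => ?_).trans tot
      refine le_trans ?_ (hsq ξ hξ)
      have hξ0 : 0 < ξ := hA0.trans_le hξ.1
      have hl := (low ξ hξ).1
      gcongr ?_ / _
      rw [hs2, le_div_iff₀ hξ0]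
      have e : ξ ^ (3 / 2 : ℝ) * ξ = ξ ^ (5 / 2 : ℝ) := by
        rw [← Real.rpow_add_one hξ0.ne']; norm_num
      have : 0 ≤ t * ξ ^ (5 / 2 : ℝ) := by positivity
      calc ξ ^ (3 / 2 : ℝ) * t * ξ = t * ξ ^ (5 / 2 : ℝ) := by rw [← e]; ring
        _ ≤ 28 * phaseRatio α t x ξ := by linarith
    · refine (intervalIntegral.integral_mono_on hAB i2 (i3.const_mul 28) fun ξ hξ => ?_).trans tot
      refine le_trans ?_ (hsq ξ hξ)
      have := (low ξ hξ).2
      gcongr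

/-- The amplitude `ξ ^ (i β) e ^ (-b ξ)`. -/
def amplitude (β b ξ : ℝ) : ℂ := Complex.exp (((-(b * ξ) : ℝ) : ℂ) + ((β * Real.log ξ : ℝ) : ℂ) * Complex.I)

theorem norm_amplitude (β b ξ : ℝ) : ‖amplitude β b ξ‖ = Real.exp (-(b * ξ)) := by
  rw [amplitude, Complex.norm_exp]
  simp

theorem hasDerivAt_amplitude (β b : ℝ) {ξ : ℝ} (hξ : 0 < ξ) :
    HasDerivAt (amplitude β b)
      (amplitude β b ξ * (((-b : ℝ) : ℂ) + ((β * ξ⁻¹ : ℝ) : ℂ) * Complex.I)) ξ := by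
  have h1 := (((hasDerivAt_id ξ).const_mul b).neg).ofReal_comp
  have h2 := (((Real.hasDerivAt_log hξ.ne').const_mul β).ofReal_comp).mul_const Complex.I
  refine HasDerivAt.congr_deriv (h1.add h2).cexp ?_
  simp [amplitude]

/-- Integration by parts with `m = √t`. The derivative of the amplitude has a part `b exp (-bξ)`, of
total mass at most `1` whatever `b` is, and a part of size `|β| / ξ`, which causes the linear growth
in `β`. -/
theorem norm_oscillatory_high_le {α t x b β A B : ℝ} (ht : 0 < t) (hb : 0 ≤ b)
    (hA : 1 + |α| ≤ A) (hAB : A ≤ B) (htA : 1 ≤ t * A ^ 5) :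
    ‖∫ ξ in A..B, ((ξ ^ (3 / 2 : ℝ) : ℝ) : ℂ) * amplitude β b ξ *
      Complex.exp (((x * ξ + t * (ξ ^ 5 - α * ξ ^ 3) : ℝ) : ℂ) * Complex.I)‖ ≤
      60 * (1 + |β|) / √t := by
  have hs : 0 < √t := Real.sqrt_pos.2 ht
  have hs2 : √t ^ 2 = t := Real.sq_sqrt ht.le
  have hA0 : 0 < A := by linarith [abs_nonneg α]
  have huI : Set.uIcc A B = Set.Icc A B := Set.uIcc_of_le hAB
  have hh : ∀ ξ ∈ Set.Icc A B, HasDerivAt (phaseRatio α t x) (phaseRatioDeriv α t x ξ) ξ :=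
    fun ξ hξ => hasDerivAt_phaseRatio α t x (hA0.trans_le hξ.1)
  have ch : ContinuousOn (phaseRatio α t x) (Set.Icc A B) :=
    fun ξ hξ => (hh ξ hξ).continuousAt.continuousWithinAt
  have ch' := continuousOn_phaseRatioDeriv α t x hA0 (B := B)
  have cp (p : ℝ) : ContinuousOn (fun ξ : ℝ => ξ ^ p) (Set.Icc A B) := fun ξ hξ =>
    (Real.continuousAt_rpow_const ξ p (Or.inl (hA0.trans_le hξ.1).ne')).continuousWithinAt
  have cp3 := cp (3 / 2); have cp7 := cp (-(7 / 2))
  have hD : ∀ ξ, 0 < phaseRatio α t x ξ ^ 2 + √t ^ 2 := fun ξ => by positivity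
  have ca : ContinuousOn (amplitude β b) (Set.Icc A B) := fun ξ hξ =>
    (hasDerivAt_amplitude β b (hA0.trans_le hξ.1)).continuousAt.continuousWithinAt
  have cinv : ContinuousOn (fun ξ : ℝ => ξ⁻¹) (Set.Icc A B) :=
    continuousOn_id.inv₀ fun ξ hξ => (hA0.trans_le hξ.1).ne'
  have cg' : ContinuousOn (fun ξ => amplitude β b ξ *
      (((-b : ℝ) : ℂ) + ((β * ξ⁻¹ : ℝ) : ℂ) * Complex.I)) (Set.Icc A B) := by
    fun_prop
  have main := norm_integral_mul_cexp_le hAB hs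
    (φ := fun ξ => x * ξ + t * (ξ ^ 5 - α * ξ ^ 3)) (ω := fun ξ => ξ ^ (3 / 2 : ℝ))
    (fun ξ hξ => hasDerivAt_phase α t x (hA0.trans_le hξ.1)) hh
    (fun ξ hξ => hasDerivAt_amplitude β b (hA0.trans_le hξ.1)) ch' cg' cp3
    (fun ξ hξ => Real.rpow_nonneg (hA0.trans_le hξ.1).le _)
    (fun ξ hξ => by
      rw [norm_amplitude, Real.exp_le_one_iff]
      have := mul_nonneg hb (hA0.trans_le hξ.1).le
      linarith)
  obtain ⟨J1, J2⟩ := integral_phaseRatio_le (x := x) ht hA hAB htA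
  have J3 := integral_rpow_tail_le hA0 hAB ht htA
  have i1 : IntervalIntegrable (fun ξ => ξ ^ (3 / 2 : ℝ) * √t ^ 2 /
      (phaseRatio α t x ξ ^ 2 + √t ^ 2)) volume A B := by
    apply ContinuousOn.intervalIntegrable
    rw [huI]
    exact ContinuousOn.div (by fun_prop) (by fun_prop) (fun ξ _ => (hD ξ).ne')
  have i3 : IntervalIntegrable (fun ξ => t⁻¹ * ξ ^ (-(7 / 2) : ℝ)) volume A B := by
    apply ContinuousOn.intervalIntegrable
    rw [huI]
    fun_prop
  have i4 : IntervalIntegrable (fun ξ => b * Real.exp (-(b * ξ))) volume A B := by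
    apply Continuous.intervalIntegrable
    fun_prop
  have J4 : ∫ ξ in A..B, b * Real.exp (-(b * ξ)) ≤ 1 := by
    rw [intervalIntegral.integral_eq_sub_of_hasDerivAt (f := fun ξ => -Real.exp (-(b * ξ))) _ i4]
    · have h1 : Real.exp (-(b * A)) ≤ 1 := by
        rw [Real.exp_le_one_iff]; have := mul_nonneg hb hA0.le; linarith
      have h2 := Real.exp_pos (-(b * B))
      linarith
    · intro ξ _
      refine HasDerivAt.congr_deriv (((hasDerivAt_id ξ).const_mul b).neg.exp.neg) ?_
      simp; ring
  have J5 : (∫ ξ in A..B, ‖amplitude β b ξ * (((-b : ℝ) : ℂ) + ((β * ξ⁻¹ : ℝ) : ℂ) * Complex.I)‖ *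
      (|phaseRatio α t x ξ| / (phaseRatio α t x ξ ^ 2 + √t ^ 2))) ≤
      ∫ ξ in A..B, ((1 / (2 * √t)) * (b * Real.exp (-(b * ξ))) +
        |β| / 2 * (ξ ^ (3 / 2 : ℝ) * √t ^ 2 / (phaseRatio α t x ξ ^ 2 + √t ^ 2) +
          t⁻¹ * ξ ^ (-(7 / 2) : ℝ))) := by
    apply intervalIntegral.integral_mono_on hAB
    · apply ContinuousOn.intervalIntegrable
      rw [huI]
      exact ContinuousOn.mul (by fun_prop) (ContinuousOn.div (by fun_prop) (by fun_prop)
        (fun ξ _ => (hD ξ).ne'))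
    · exact (i4.const_mul _).add ((i1.add i3).const_mul _)
    · intro ξ hξ
      have hξ0 : 0 < ξ := hA0.trans_le hξ.1
      have n1 : ‖amplitude β b ξ * (((-b : ℝ) : ℂ) + ((β * ξ⁻¹ : ℝ) : ℂ) * Complex.I)‖ ≤
          b * Real.exp (-(b * ξ)) + |β| * ξ⁻¹ := by
        rw [norm_mul, norm_amplitude]
        have e1 : Real.exp (-(b * ξ)) ≤ 1 := by
          rw [Real.exp_le_one_iff]; have := mul_nonneg hb hξ0.le; linarith
        have e2 : ‖((-b : ℝ) : ℂ) + ((β * ξ⁻¹ : ℝ) : ℂ) * Complex.I‖ ≤ b + |β| * ξ⁻¹ := by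
          refine (norm_add_le _ _).trans ?_
          rw [norm_mul, Complex.norm_I, Complex.norm_real, Complex.norm_real, Real.norm_eq_abs,
            Real.norm_eq_abs, abs_neg, abs_of_nonneg hb, abs_mul, abs_of_pos (inv_pos.2 hξ0), mul_one]
        have e3 : 0 ≤ |β| * ξ⁻¹ := by positivity
        calc _ ≤ Real.exp (-(b * ξ)) * (b + |β| * ξ⁻¹) := by gcongr
          _ ≤ b * Real.exp (-(b * ξ)) + 1 * (|β| * ξ⁻¹) := by rw [mul_add, mul_comm]; gcongr
          _ = _ := by ring
      set H := phaseRatio α t x ξ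
      have hDξ := hD ξ
      have n2 : |H| / (H ^ 2 + √t ^ 2) ≤ 1 / (2 * √t) := by
        rw [div_le_div_iff₀ hDξ (by positivity)]
        nlinarith [sq_nonneg (|H| - √t), sq_abs H]
      -- Completing the square: the difference of the two sides is a sum of squares over a positive
      -- denominator. The `|β| / ξ` part is thereby reduced to two integrals that are already
      -- estimated.
      have n3 : ξ⁻¹ * (|H| / (H ^ 2 + √t ^ 2)) ≤ 1 / 2 *
          (ξ ^ (3 / 2 : ℝ) * √t ^ 2 / (H ^ 2 + √t ^ 2) + t⁻¹ * ξ ^ (-(7 / 2) : ℝ)) := by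
        obtain ⟨r, hr, h0, h1, h3, h5, h1', h3', h5', h7'⟩ := exists_sqrt_rpow hξ0
        have hti : t⁻¹ = (√t ^ 2)⁻¹ := by rw [hs2]
        rw [h3, h7', h0, hti]
        set s := √t
        rw [← sub_nonneg]
        have : 1 / 2 * (r ^ 3 * s ^ 2 / (H ^ 2 + s ^ 2) + (s ^ 2)⁻¹ * (r ^ 7)⁻¹) -
            (r ^ 2)⁻¹ * (|H| / (H ^ 2 + s ^ 2)) =
            1 / 2 * ((r ^ 5 * s ^ 2 - |H|) ^ 2 + s ^ 2) / ((H ^ 2 + s ^ 2) * s ^ 2 * r ^ 7) := by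
          rw [← sq_abs H]
          field_simp
          ring
        rw [this]
        positivity
      have p1 : 0 ≤ b * Real.exp (-(b * ξ)) := by positivity
      calc _ ≤ (b * Real.exp (-(b * ξ)) + |β| * ξ⁻¹) * (|H| / (H ^ 2 + √t ^ 2)) := by gcongr
        _ = (b * Real.exp (-(b * ξ))) * (|H| / (H ^ 2 + √t ^ 2)) +
            |β| * (ξ⁻¹ * (|H| / (H ^ 2 + √t ^ 2))) := by ring
        _ ≤ (b * Real.exp (-(b * ξ))) * (1 / (2 * √t)) + |β| * (1 / 2 *
          (ξ ^ (3 / 2 : ℝ) * √t ^ 2 / (H ^ 2 + √t ^ 2) + t⁻¹ * ξ ^ (-(7 / 2) : ℝ))) := by gcongr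
        _ = _ := by ring
  rw [intervalIntegral.integral_add (i4.const_mul _) ((i1.add i3).const_mul _),
    intervalIntegral.integral_const_mul (1 / (2 * √t)),
    intervalIntegral.integral_const_mul (|β| / 2), intervalIntegral.integral_add i1 i3] at J5
  refine main.trans ?_
  have q1 : 1 / (2 * √t) * ∫ ξ in A..B, b * Real.exp (-(b * ξ)) ≤ 1 / (2 * √t) * 1 := by gcongr
  have q2 : |β| / 2 * ((∫ ξ in A..B, ξ ^ (3 / 2 : ℝ) * √t ^ 2 /
      (phaseRatio α t x ξ ^ 2 + √t ^ 2)) + ∫ ξ in A..B, t⁻¹ * ξ ^ (-(7 / 2) : ℝ)) ≤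
      |β| / 2 * (28 / √t + 1 / √t) := by gcongr
  -- The four contributions add up to `(115/2 + (29/2) |β|) / √t`; the last bracket is the slack.
  have : 60 * (1 + |β|) / √t = 28 / √t + 1 / √t + (1 / (2 * √t) * 1 + |β| / 2 * (28 / √t + 1 / √t))
      + 28 / √t + (5 / 2 * (1 / √t) + (91 / 2) * |β| * (1 / √t)) := by field_simp; ring
  have hp : 0 ≤ 5 / 2 * (1 / √t) + (91 / 2) * |β| * (1 / √t) := by positivity
  rw [this]
  linarith

/-- The integrand of the one-dimensional oscillatory integral. -/
def oscIntegrand (α t x b β ξ : ℝ) : ℂ :=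
  ((ξ ^ (3 / 2 : ℝ) : ℝ) : ℂ) * amplitude β b ξ *
    Complex.exp (((x * ξ + t * (ξ ^ 5 - α * ξ ^ 3) : ℝ) : ℂ) * Complex.I)

theorem norm_oscIntegrand_le {α t x b β ξ : ℝ} (hb : 0 ≤ b) (hξ : 0 ≤ ξ) :
    ‖oscIntegrand α t x b β ξ‖ ≤ ξ ^ (3 / 2 : ℝ) := by
  rw [oscIntegrand, norm_mul, norm_mul, Complex.norm_exp_ofReal_mul_I, norm_amplitude, mul_one,
    Complex.norm_real, Real.norm_of_nonneg (Real.rpow_nonneg hξ _)]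
  apply mul_le_of_le_one_right (Real.rpow_nonneg hξ _)
  rw [Real.exp_le_one_iff]
  have := mul_nonneg hb hξ
  linarith

theorem continuousOn_oscIntegrand (α t x b β : ℝ) :
    ContinuousOn (oscIntegrand α t x b β) (Set.Ioi 0) := by
  have cp3 : ContinuousOn (fun ξ : ℝ => ξ ^ (3 / 2 : ℝ)) (Set.Ioi 0) := fun ξ _ =>
    (Real.continuousAt_rpow_const ξ _ (Or.inr (by norm_num))).continuousWithinAt
  have ca : ContinuousOn (amplitude β b) (Set.Ioi 0) := fun ξ hξ =>
    (hasDerivAt_amplitude β b hξ).continuousAt.continuousWithinAt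
  unfold oscIntegrand
  fun_prop

theorem intervalIntegrable_oscIntegrand (α t x b β : ℝ) {A B : ℝ} (hA : 0 < A) (hB : 0 < B) :
    IntervalIntegrable (oscIntegrand α t x b β) volume A B :=
  ((continuousOn_oscIntegrand α t x b β).mono fun _ hξ =>
    (lt_min hA hB).trans_le hξ.1).intervalIntegrable

theorem norm_integral_oscIntegrand_low_le {α t x b β A B D : ℝ} (hb : 0 ≤ b) (hA : 0 < A)
    (hAB : A ≤ B) (hBD : B ≤ D) :
    ‖∫ ξ in A..B, oscIntegrand α t x b β ξ‖ ≤ D ^ (5 / 2 : ℝ) := by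
  have hD : 0 < D := by linarith
  have := intervalIntegral.norm_integral_le_of_norm_le_const (a := A) (b := B)
    (f := oscIntegrand α t x b β) (C := D ^ (3 / 2 : ℝ)) (by
      intro ξ hξ
      rw [Set.uIoc_of_le hAB] at hξ
      have hξ0 : 0 ≤ ξ := hA.le.trans hξ.1.le
      refine (norm_oscIntegrand_le hb hξ0).trans ?_
      exact Real.rpow_le_rpow hξ0 (hξ.2.trans hBD) (by norm_num))
  refine this.trans ?_
  have e : D ^ (5 / 2 : ℝ) = D ^ (3 / 2 : ℝ) * D := by
    rw [← Real.rpow_add_one hD.ne']; norm_num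
  rw [e, abs_of_nonneg (by linarith)]
  gcongr
  linarith

/-- The frequencies are split at `D = max (1 + |α|) (t^(-1/5))`. Above `D` there is oscillation,
since `1 ≤ t D⁵`. Below `D` the trivial bound `D^(5/2)` is already `O(t^(-1/2))`; for the part of
`D` coming from `1 + |α|` this needs `t` to be bounded. -/
theorem norm_integral_oscIntegrand_le_of_pos {α t x b β A B : ℝ} (ht : 0 < t) (ht2 : t ≤ 2)
    (hb : 0 ≤ b) (hA : 0 < A) (hAB : A ≤ B) :
    ‖∫ ξ in A..B, oscIntegrand α t x b β ξ‖ ≤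
      (61 + 2 * (1 + |α|) ^ (5 / 2 : ℝ)) * (1 + |β|) / √t := by
  have hs : 0 < √t := Real.sqrt_pos.2 ht
  have hs2 : √t ^ 2 = t := Real.sq_sqrt ht.le
  have hst : √t ≤ 2 := by nlinarith
  set M := 1 + |α| with hM
  have hM0 : 0 < M := by positivity
  set D := max M (t ^ (-(1 / 5) : ℝ)) with hD
  have htp : 0 < t ^ (-(1 / 5) : ℝ) := Real.rpow_pos_of_pos ht _
  have hD0 : 0 < D := lt_max_of_lt_left hM0
  have htD : 1 ≤ t * D ^ 5 := by
    have : (t ^ (-(1 / 5) : ℝ)) ^ 5 = t⁻¹ := by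
      rw [← Real.rpow_natCast, ← Real.rpow_mul ht.le, ← Real.rpow_neg_one]; norm_num
    calc 1 = t * (t ^ (-(1 / 5) : ℝ)) ^ 5 := by rw [this, mul_inv_cancel₀ ht.ne']
      _ ≤ t * D ^ 5 := by gcongr; exact le_max_right _ _
  have hβ : 0 ≤ |β| := abs_nonneg β
  have hDp : D ^ (5 / 2 : ℝ) ≤ (1 + 2 * M ^ (5 / 2 : ℝ)) / √t := by
    have e1 : M ^ (5 / 2 : ℝ) ≤ 2 * M ^ (5 / 2 : ℝ) / √t := by
      rw [le_div_iff₀ hs, mul_comm 2]; gcongr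
    have e2 : (t ^ (-(1 / 5) : ℝ)) ^ (5 / 2 : ℝ) = 1 / √t := by
      rw [← Real.rpow_mul ht.le, Real.sqrt_eq_rpow, one_div (t ^ _), ← Real.rpow_neg ht.le]; norm_num
    have e3 : 0 ≤ M ^ (5 / 2 : ℝ) := by positivity
    rw [add_div]
    rcases max_choice M (t ^ (-(1 / 5) : ℝ)) with h | h
    · rw [hD, h]
      have : 0 ≤ 1 / √t := by positivity
      linarith
    · rw [hD, h, e2]
      have : 0 ≤ 2 * M ^ (5 / 2 : ℝ) / √t := by positivity
      linarith
  have low : ∀ B', A ≤ B' → B' ≤ D → ‖∫ ξ in A..B', oscIntegrand α t x b β ξ‖ ≤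
      (1 + 2 * M ^ (5 / 2 : ℝ)) * (1 + |β|) / √t := by
    intro B' h1 h2
    refine (norm_integral_oscIntegrand_low_le hb hA h1 h2).trans (hDp.trans ?_)
    gcongr
    have : 0 ≤ 1 + 2 * M ^ (5 / 2 : ℝ) := by positivity
    nlinarith
  have high : ∀ A', D ≤ A' → A' ≤ B → ‖∫ ξ in A'..B, oscIntegrand α t x b β ξ‖ ≤
      60 * (1 + |β|) / √t := by
    intro A' h1 h2
    exact norm_oscillatory_high_le ht hb ((le_max_left _ _).trans h1) h2
      (htD.trans (by gcongr))
  have tot : (61 + 2 * M ^ (5 / 2 : ℝ)) * (1 + |β|) / √t =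
      (1 + 2 * M ^ (5 / 2 : ℝ)) * (1 + |β|) / √t + 60 * (1 + |β|) / √t := by ring
  have p1 : 0 ≤ (1 + 2 * M ^ (5 / 2 : ℝ)) * (1 + |β|) / √t := by positivity
  have p2 : 0 ≤ 60 * (1 + |β|) / √t := by positivity
  rw [tot]
  rcases le_total B D with h | h
  · linarith [low B hAB h]
  rcases le_total D A with h' | h'
  · linarith [high A h' hAB]
  rw [← intervalIntegral.integral_add_adjacent_intervals
    (intervalIntegrable_oscIntegrand α t x b β hA hD0)
    (intervalIntegrable_oscIntegrand α t x b β hD0 (hD0.trans_le h))]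
  exact (norm_add_le _ _).trans (add_le_add (low D h' le_rfl) (high D le_rfl h))

/-- This reduces negative times to positive ones. -/
theorem conj_oscIntegrand (α t x b β ξ : ℝ) :
    (starRingEnd ℂ) (oscIntegrand α t x b β ξ) = oscIntegrand α (-t) (-x) b (-β) ξ := by
  simp only [oscIntegrand, amplitude, map_mul, ← Complex.exp_conj, map_add, Complex.conj_ofReal,
    Complex.conj_I]
  congr 2
  · congr 2
    push_cast; ring
  · push_cast; ring

/-- The oscillatory integral estimate behind the dispersive decay. -/
theorem norm_integral_oscIntegrand_le {α t x b β A B : ℝ} (ht : t ≠ 0) (ht2 : |t| ≤ 2)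
    (hb : 0 ≤ b) (hA : 0 < A) (hAB : A ≤ B) :
    ‖∫ ξ in A..B, oscIntegrand α t x b β ξ‖ ≤
      (61 + 2 * (1 + |α|) ^ (5 / 2 : ℝ)) * (1 + |β|) / √|t| := by
  rcases lt_or_gt_of_ne ht with h | h
  · have key := norm_integral_oscIntegrand_le_of_pos (α := α) (x := -x) (β := -β)
      (neg_pos.2 h) (by rwa [abs_of_neg h] at ht2) hb hA hAB
    rw [abs_neg β] at key
    rw [abs_of_neg h]
    refine le_trans (le_of_eq ?_) key
    rw [← RCLike.norm_conj, intervalIntegral.integral_of_le hAB, intervalIntegral.integral_of_le hAB,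
      ← integral_conj]
    simp_rw [conj_oscIntegrand]
  · rw [abs_of_pos h] at *
    exact norm_integral_oscIntegrand_le_of_pos h ht2 hb hA hAB

/-! ### The kernel of the cut-off propagator -/

/-- The character `exp (2 π i ⟨z, p⟩)` of the plane. -/
def planeWave (z p : ℝ × ℝ) : ℂ :=
  Complex.exp (((2 * Real.pi * (z.1 * p.1 + z.2 * p.2) : ℝ) : ℂ) * Complex.I)

/-- A sharp frequency cut-off in the first variable and a Gaussian cut-off in the second one. -/
def freqCutoff (N ε : ℝ) (p : ℝ × ℝ) : ℝ :=
  if N⁻¹ ≤ |2 * Real.pi * p.1| ∧ |2 * Real.pi * p.1| ≤ N then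
    Real.exp (-(ε * (2 * Real.pi * p.2) ^ 2 / |2 * Real.pi * p.1|)) else 0

/-- The symbol of `|D_x|^w exp (i t ω(D))`, cut off. -/
def groupSymbol (α N ε : ℝ) (w : ℂ) (t : ℝ) (p : ℝ × ℝ) : ℂ :=
  Complex.exp (w * Real.log |2 * Real.pi * p.1|) * freqCutoff N ε p *
    Complex.exp (((t * omega α (2 * Real.pi * p.1) (2 * Real.pi * p.2) : ℝ) : ℂ) * Complex.I)

theorem norm_planeWave (z p : ℝ × ℝ) : ‖planeWave z p‖ = 1 := Complex.norm_exp_ofReal_mul_I _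

theorem continuous_planeWave : Continuous fun q : (ℝ × ℝ) × (ℝ × ℝ) => planeWave q.1 q.2 := by
  unfold planeWave
  fun_prop

theorem freqCutoff_nonneg (N ε : ℝ) (p : ℝ × ℝ) : 0 ≤ freqCutoff N ε p := by
  unfold freqCutoff; split_ifs <;> positivity

theorem freqCutoff_le_one {N ε : ℝ} (hε : 0 ≤ ε) (p : ℝ × ℝ) : freqCutoff N ε p ≤ 1 := by
  unfold freqCutoff
  split_ifs
  · rw [Real.exp_le_one_iff, neg_nonpos]; positivity
  · norm_num

theorem measurable_freqCutoff (N ε : ℝ) : Measurable (freqCutoff N ε) := by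
  unfold freqCutoff
  apply Measurable.ite
  · have h : Measurable fun p : ℝ × ℝ => |2 * Real.pi * p.1| := by fun_prop
    exact (measurableSet_le measurable_const h).inter (measurableSet_le h measurable_const)
  · fun_prop
  · fun_prop

theorem measurable_omega (α : ℝ) : Measurable fun p : ℝ × ℝ => omega α p.1 p.2 := by
  unfold omega; fun_prop

theorem measurable_groupSymbol (α N ε : ℝ) (w : ℂ) (t : ℝ) :
    Measurable (groupSymbol α N ε w t) := by
  have h1 := measurable_freqCutoff N ε
  have h2 : Measurable fun p : ℝ × ℝ => omega α (2 * Real.pi * p.1) (2 * Real.pi * p.2) :=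
    (measurable_omega α).comp (f := fun p : ℝ × ℝ => (2 * Real.pi * p.1, 2 * Real.pi * p.2))
      (by fun_prop)
  unfold groupSymbol
  fun_prop

/-- On the support `|ξ| ≤ N`, so the Gaussian is dominated by `exp (-ε μ² / N)`, which no longer
depends on `ξ`. -/
theorem integrable_freqCutoff {N ε : ℝ} (hN : 0 < N) (hε : 0 < ε) :
    Integrable (freqCutoff N ε) := by
  have hI : Integrable ((Set.Icc (-N) N).indicator (fun _ : ℝ => (1 : ℝ))) :=
    (integrable_indicator_iff measurableSet_Icc).2 (by simp)
  have hG : Integrable fun x : ℝ => Real.exp (-(ε / N * (2 * Real.pi) ^ 2) * x ^ 2) :=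
    integrable_exp_neg_mul_sq (by positivity)
  refine (hI.mul_prod hG).mono' (measurable_freqCutoff N ε).aestronglyMeasurable
    (Filter.Eventually.of_forall fun p => ?_)
  rw [Real.norm_of_nonneg (freqCutoff_nonneg N ε p)]
  unfold freqCutoff
  split_ifs with h
  · have h1 : p.1 ∈ Set.Icc (-N) N := by
      rw [Set.mem_Icc, ← abs_le]
      rw [abs_mul, abs_of_pos (by positivity)] at h
      have := h.2
      have := Real.pi_gt_three
      nlinarith [abs_nonneg p.1]
    rw [Set.indicator_of_mem h1, one_mul, Real.exp_le_exp]
    have hp : 0 < |2 * Real.pi * p.1| := lt_of_lt_of_le (by positivity) h.1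
    have : ε * (2 * Real.pi * p.2) ^ 2 / N ≤ ε * (2 * Real.pi * p.2) ^ 2 / |2 * Real.pi * p.1| := by
      gcongr; exact h.2
    calc -(ε * (2 * Real.pi * p.2) ^ 2 / |2 * Real.pi * p.1|)
        ≤ -(ε * (2 * Real.pi * p.2) ^ 2 / N) := neg_le_neg this
      _ = _ := by ring
  · apply mul_nonneg _ (Real.exp_pos _).le
    exact Set.indicator_nonneg (fun _ _ => zero_le_one) _

theorem abs_log_le_of_mem {N x : ℝ} (hN : 1 ≤ N) (h1 : N⁻¹ ≤ |x|) (h2 : |x| ≤ N) :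
    |(Real.log |x|)| ≤ Real.log N := by
  have h0 : 0 < |x| := lt_of_lt_of_le (by positivity) h1
  rw [abs_le, ← Real.log_inv]
  exact ⟨Real.log_le_log (by positivity) h1, Real.log_le_log h0 h2⟩

theorem norm_groupSymbol (α N ε : ℝ) (w : ℂ) (t : ℝ) (p : ℝ × ℝ) :
    ‖groupSymbol α N ε w t p‖ =
      Real.exp (w.re * Real.log |2 * Real.pi * p.1|) * freqCutoff N ε p := by
  rw [groupSymbol, norm_mul, norm_mul, Complex.norm_exp_ofReal_mul_I, mul_one, Complex.norm_exp,
    Complex.norm_real, Real.norm_of_nonneg (freqCutoff_nonneg N ε p)]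
  simp

theorem integrable_groupSymbol {N ε : ℝ} (hN : 1 ≤ N) (hε : 0 < ε) (α : ℝ) (w : ℂ) (t : ℝ) :
    Integrable (groupSymbol α N ε w t) := by
  refine ((integrable_freqCutoff (N := N) (by linarith) hε).const_mul
    (Real.exp (|w.re| * Real.log N))).mono' (measurable_groupSymbol α N ε w t).aestronglyMeasurable
    (Filter.Eventually.of_forall fun p => ?_)
  rw [norm_groupSymbol]
  by_cases h : N⁻¹ ≤ |2 * Real.pi * p.1| ∧ |2 * Real.pi * p.1| ≤ N
  · refine mul_le_mul_of_nonneg_right (Real.exp_le_exp.2 ?_) (freqCutoff_nonneg N ε p)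
    · have := abs_log_le_of_mem hN h.1 h.2
      calc _ ≤ |(w.re * Real.log |2 * Real.pi * p.1|)| := le_abs_self _
        _ = |w.re| * |(Real.log |2 * Real.pi * p.1|)| := abs_mul _ _
        _ ≤ _ := by gcongr
  · simp only [freqCutoff, if_neg h, mul_zero, le_refl]

theorem integrable_groupSymbol_mul_planeWave {N ε : ℝ} (hN : 1 ≤ N) (hε : 0 < ε) (α : ℝ) (w : ℂ)
    (t : ℝ) (z : ℝ × ℝ) : Integrable fun p => groupSymbol α N ε w t p * planeWave z p := by
  refine (integrable_groupSymbol hN hε α w t).norm.mono' ?_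
    (Filter.Eventually.of_forall fun p => ?_)
  · apply AEStronglyMeasurable.mul (measurable_groupSymbol α N ε w t).aestronglyMeasurable
    exact (continuous_planeWave.comp (by fun_prop : Continuous fun p => (z, p))).aestronglyMeasurable
  · rw [norm_mul, norm_planeWave, mul_one]

/-- The Gaussian integral in the second frequency variable. -/
theorem integral_gaussian_inner {X ε t y : ℝ} (hX : 0 < X) (hε : 0 < ε) :
    ∫ v : ℝ, (Real.exp (-(ε * (2 * Real.pi * v) ^ 2 / X)) : ℂ) *
      (Complex.exp (((t * ((2 * Real.pi * v) ^ 2 / X) : ℝ) : ℂ) * Complex.I) *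
      Complex.exp (((2 * Real.pi * (y * v) : ℝ) : ℂ) * Complex.I)) =
    ((2 * Real.pi)⁻¹ * √X : ℝ) * ((Real.pi / (ε - t * Complex.I)) ^ (1 / 2 : ℂ) *
      Complex.exp (((-(y ^ 2 * ε / (4 * (ε ^ 2 + t ^ 2)) * X) : ℝ) : ℂ) +
        ((-(y ^ 2 * t / (4 * (ε ^ 2 + t ^ 2)) * X) : ℝ) : ℂ) * Complex.I)) := by
  -- The Gaussian cut-off is scaled by `1 / X`, like the oscillation `t μ² / X`, so both merge into
  -- `exp (-c μ² / X)`. The transform is then `√X` times a constant times `exp (-y² X / (4c))`, with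
  -- an exponent linear in `X`: its real part is a damping factor `exp (-bX)` and its imaginary part
  -- a shift of `x`.
  set c : ℂ := ε - t * Complex.I with hc
  set b : ℂ := c / X with hb
  have hXc : (X : ℂ) ≠ 0 := by exact_mod_cast hX.ne'
  have hbre : 0 < b.re := by
    rw [hb, Complex.div_ofReal_re, hc]; simp; positivity
  have hb0 : b ≠ 0 := fun h => by rw [h] at hbre; simp at hbre
  have hc0 : c ≠ 0 := fun h => hb0 (by rw [hb, h, zero_div])
  have e1 : ∀ v : ℝ, (Real.exp (-(ε * (2 * Real.pi * v) ^ 2 / X)) : ℂ) *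
      (Complex.exp (((t * ((2 * Real.pi * v) ^ 2 / X) : ℝ) : ℂ) * Complex.I) *
      Complex.exp (((2 * Real.pi * (y * v) : ℝ) : ℂ) * Complex.I)) =
      (fun x : ℝ => Complex.exp (Complex.I * y * x) * Complex.exp (-b * x ^ 2)) (2 * Real.pi * v) := by
    intro v
    push_cast
    rw [← Complex.exp_add, ← Complex.exp_add, ← Complex.exp_add]
    congr 1
    rw [hb, hc]
    field_simp
    ring
  simp_rw [e1]
  rw [Measure.integral_comp_mul_left
    (fun x : ℝ => Complex.exp (Complex.I * y * x) * Complex.exp (-b * x ^ 2)),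
    fourierIntegral_gaussian hbre]
  have e2 : (Real.pi / b : ℂ) = (X : ℂ) * (Real.pi / c) := by
    rw [hb]; field_simp
  have e3 : (Real.pi / b : ℂ) ^ (1 / 2 : ℂ) = (√X : ℂ) * (Real.pi / c) ^ (1 / 2 : ℂ) := by
    have hpc : (Real.pi / c : ℂ) ≠ 0 := div_ne_zero (by exact_mod_cast Real.pi_ne_zero) hc0
    rw [e2, Complex.cpow_def_of_ne_zero (mul_ne_zero hXc hpc), Complex.cpow_def_of_ne_zero hpc,
      Complex.log_ofReal_mul hX hpc, add_mul, Complex.exp_add, Real.sqrt_eq_rpow,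
      Real.rpow_def_of_pos hX]
    push_cast
    rfl
  have hd : ((ε : ℂ) ^ 2 + (t : ℂ) ^ 2) ≠ 0 := by
    have : ε ^ 2 + t ^ 2 ≠ 0 := by positivity
    exact_mod_cast this
  have e4 : -(y : ℂ) ^ 2 / (4 * b) = (((-(y ^ 2 * ε / (4 * (ε ^ 2 + t ^ 2)) * X) : ℝ) : ℂ) +
        ((-(y ^ 2 * t / (4 * (ε ^ 2 + t ^ 2)) * X) : ℝ) : ℂ) * Complex.I) := by
    have hcc : (ε : ℂ) ^ 2 + (t : ℂ) ^ 2 = c * (ε + t * Complex.I) := by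
      rw [hc]; linear_combination ((t : ℂ) ^ 2) * Complex.I_sq
    push_cast
    rw [hcc] at hd ⊢
    have hc' : (ε + t * Complex.I : ℂ) ≠ 0 := right_ne_zero_of_mul hd
    rw [hb]
    field_simp
    ring
  rw [e3, e4, abs_of_pos (by positivity), Complex.real_smul]
  push_cast
  ring

theorem omega_neg_left (α ξ μ : ℝ) : omega α (-ξ) μ = -omega α ξ μ := by
  unfold omega; rw [div_neg]; ring

/-- Since `ω` is odd in `ξ`, reflecting `ξ` reverses time. The half `ξ < 0` of the kernel is
therefore the half `ξ > 0` at `-t` and `-x`. -/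
theorem groupSymbol_neg_fst (α N ε : ℝ) (w : ℂ) (t u v : ℝ) :
    groupSymbol α N ε w t (-u, v) = groupSymbol α N ε w (-t) (u, v) := by
  have h : 2 * Real.pi * -u = -(2 * Real.pi * u) := by ring
  simp only [groupSymbol, freqCutoff, h, abs_neg, omega_neg_left]
  congr 3
  ring_nf

theorem planeWave_neg_fst (x y u v : ℝ) : planeWave (x, y) (-u, v) = planeWave (-x, y) (u, v) := by
  simp only [planeWave]; ring_nf

/-- The contribution of one value of the first frequency variable to the kernel. -/
theorem integral_groupSymbol_inner {α N ε t x y β u : ℝ} (hε : 0 < ε) (hu : 0 < u)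
    (h1 : N⁻¹ ≤ 2 * Real.pi * u) (h2 : 2 * Real.pi * u ≤ N) :
    ∫ v : ℝ, groupSymbol α N ε (1 + β * Complex.I) t (u, v) * planeWave (x, y) (u, v) =
      ((2 * Real.pi)⁻¹ : ℝ) * (Real.pi / (ε - t * Complex.I)) ^ (1 / 2 : ℂ) *
        oscIntegrand α t (x - y ^ 2 * t / (4 * (ε ^ 2 + t ^ 2)))
          (y ^ 2 * ε / (4 * (ε ^ 2 + t ^ 2))) β (2 * Real.pi * u) := by
  have hX : 0 < 2 * Real.pi * u := by positivity
  have e0 : ∀ v : ℝ, groupSymbol α N ε (1 + β * Complex.I) t (u, v) * planeWave (x, y) (u, v) =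
      (Complex.exp ((1 + β * Complex.I) * Real.log (2 * Real.pi * u)) *
        Complex.exp (((x * (2 * Real.pi * u) + t * ((2 * Real.pi * u) ^ 5 -
          α * (2 * Real.pi * u) ^ 3) : ℝ) : ℂ) * Complex.I)) *
      ((Real.exp (-(ε * (2 * Real.pi * v) ^ 2 / (2 * Real.pi * u))) : ℂ) *
      (Complex.exp (((t * ((2 * Real.pi * v) ^ 2 / (2 * Real.pi * u)) : ℝ) : ℂ) * Complex.I) *
      Complex.exp (((2 * Real.pi * (y * v) : ℝ) : ℂ) * Complex.I))) := by
    intro v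
    have a1 : freqCutoff N ε (u, v) =
        Real.exp (-(ε * (2 * Real.pi * v) ^ 2 / (2 * Real.pi * u))) := by
      simp only [freqCutoff, abs_of_pos hX]
      rw [if_pos ⟨h1, h2⟩]
    have a2 : Complex.exp (((t * omega α (2 * Real.pi * u) (2 * Real.pi * v) : ℝ) : ℂ) *
        Complex.I) * planeWave (x, y) (u, v) = Complex.exp (((x * (2 * Real.pi * u) +
        t * ((2 * Real.pi * u) ^ 5 - α * (2 * Real.pi * u) ^ 3) : ℝ) : ℂ) * Complex.I) *
      (Complex.exp (((t * ((2 * Real.pi * v) ^ 2 / (2 * Real.pi * u)) : ℝ) : ℂ) * Complex.I) *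
      Complex.exp (((2 * Real.pi * (y * v) : ℝ) : ℂ) * Complex.I)) := by
      simp only [planeWave, omega, ← Complex.exp_add]
      congr 1
      push_cast
      ring
    simp only [groupSymbol, a1, abs_of_pos hX]
    rw [mul_assoc _ _ (planeWave _ _), a2]
    ring
  simp_rw [e0]
  rw [integral_const_mul, integral_gaussian_inner hX hε]
  set X := 2 * Real.pi * u
  have hX3 : X ^ (3 / 2 : ℝ) = X * √X := by
    rw [Real.sqrt_eq_rpow, ← Real.rpow_one_add' hX.le (by norm_num)]; norm_num
  have e1 : Complex.exp ((1 + β * Complex.I) * Real.log X) =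
      X * Complex.exp (((β * Real.log X : ℝ) : ℂ) * Complex.I) := by
    rw [add_mul, Complex.exp_add, one_mul, ← Complex.ofReal_exp, Real.exp_log hX]
    push_cast; ring_nf
  rw [e1, oscIntegrand, hX3, amplitude, Complex.exp_add, Complex.exp_add]
  have e2 : Complex.exp ((((x - y ^ 2 * t / (4 * (ε ^ 2 + t ^ 2))) * X + t * (X ^ 5 - α * X ^ 3) :
      ℝ) : ℂ) * Complex.I) = Complex.exp (((x * X + t * (X ^ 5 - α * X ^ 3) : ℝ) : ℂ) *
      Complex.I) * Complex.exp (((-(y ^ 2 * t / (4 * (ε ^ 2 + t ^ 2)) * X) : ℝ) : ℂ) *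
      Complex.I) := by
    rw [← Complex.exp_add]
    congr 1
    push_cast
    ring
  rw [e2]
  push_cast
  ring

/-- From `|ε - it| ≥ |t|` and `π < 4`. The bound is uniform in the cut-off parameter `ε`. -/
theorem norm_sqrt_div_le {ε t : ℝ} (ht : t ≠ 0) :
    ‖((Real.pi : ℂ) / (ε - t * Complex.I)) ^ (1 / 2 : ℂ)‖ ≤ 2 / √|t| := by
  have hc : |t| ≤ ‖(ε - t * Complex.I : ℂ)‖ := by
    have := Complex.abs_im_le_norm (ε - t * Complex.I : ℂ)
    simpa using this
  have ht' : 0 < |t| := abs_pos.2 ht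
  have hc0 : (ε - t * Complex.I : ℂ) ≠ 0 := norm_pos_iff.1 (ht'.trans_le hc)
  have hpc : (Real.pi / (ε - t * Complex.I) : ℂ) ≠ 0 :=
    div_ne_zero (by exact_mod_cast Real.pi_ne_zero) hc0
  have : (1 / 2 : ℂ) = ((1 / 2 : ℝ) : ℂ) := by push_cast; rfl
  rw [this, Complex.norm_cpow_real, ← Real.sqrt_eq_rpow, norm_div, Complex.norm_real,
    Real.norm_of_nonneg Real.pi_pos.le]
  have h4 : (2 : ℝ) = √4 := by
    rw [show (4 : ℝ) = 2 ^ 2 by norm_num, Real.sqrt_sq (by norm_num)]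
  rw [h4, ← Real.sqrt_div (by norm_num)]
  apply Real.sqrt_le_sqrt
  gcongr
  exact Real.pi_lt_four.le

/-- One factor `|t|^(-1/2)` comes from the Gaussian integral in `μ`, the other from the oscillatory
integral in `ξ`, whose weight is `ξ` from `|D_x|` times `ξ^(1/2)` from the Gaussian. Neither depends
on `N` or `ε`. -/
theorem norm_integral_groupSymbol_half_le {α N ε t x y β : ℝ} (hN : 1 ≤ N) (hε : 0 < ε)
    (ht : t ≠ 0) (ht2 : |t| ≤ 2) :
    ‖∫ u in Set.Ioi (0 : ℝ), ∫ v : ℝ,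
      groupSymbol α N ε (1 + β * Complex.I) t (u, v) * planeWave (x, y) (u, v)‖ ≤
      (61 + 2 * (1 + |α|) ^ (5 / 2 : ℝ)) * (1 + |β|) / |t| := by
  have hN0 : 0 < N := by linarith
  have hNi : N⁻¹ ≤ N := (inv_le_one_of_one_le₀ hN).trans hN
  have h2π : 0 < 2 * Real.pi := by positivity
  set A := N⁻¹ / (2 * Real.pi) with hA
  set B := N / (2 * Real.pi) with hB
  have hA0 : 0 < A := by positivity
  have hAB : A ≤ B := by rw [hA, hB]; gcongr
  set c : ℂ := ((2 * Real.pi)⁻¹ : ℝ) * (Real.pi / (ε - t * Complex.I)) ^ (1 / 2 : ℂ) with hc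
  set F : ℝ → ℂ := oscIntegrand α t (x - y ^ 2 * t / (4 * (ε ^ 2 + t ^ 2)))
          (y ^ 2 * ε / (4 * (ε ^ 2 + t ^ 2))) β with hF
  have e0 : ∫ u in Set.Ioi (0 : ℝ), ∫ v : ℝ,
      groupSymbol α N ε (1 + β * Complex.I) t (u, v) * planeWave (x, y) (u, v) =
      ∫ u in Set.Ioi (0 : ℝ), (Set.Icc A B).indicator (fun u => c * F (2 * Real.pi * u)) u := by
    apply setIntegral_congr_fun measurableSet_Ioi
    intro u hu
    have hu : 0 < u := hu
    have hX : 0 < 2 * Real.pi * u := by positivity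
    simp only
    by_cases h : u ∈ Set.Icc A B
    · rw [Set.indicator_of_mem h]
      have h1 := h.1; have h2 := h.2
      rw [hA, div_le_iff₀ h2π, mul_comm] at h1
      rw [hB, le_div_iff₀ h2π, mul_comm] at h2
      rw [integral_groupSymbol_inner hε hu h1 h2]
    · rw [Set.indicator_of_notMem h]
      have : ∀ v, freqCutoff N ε (u, v) = 0 := by
        intro v
        simp only [freqCutoff, abs_of_pos hX]
        rw [if_neg]
        rintro ⟨h1, h2⟩
        apply h
        rw [Set.mem_Icc, hA, hB, div_le_iff₀ h2π, le_div_iff₀ h2π, mul_comm u]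
        exact ⟨h1, h2⟩
      simp [groupSymbol, this]
  rw [e0, setIntegral_indicator measurableSet_Icc,
    Set.inter_eq_self_of_subset_right
      (show Set.Icc A B ⊆ Set.Ioi 0 from fun u hu => hA0.trans_le hu.1), integral_Icc_eq_integral_Ioc,
    ← intervalIntegral.integral_of_le hAB, intervalIntegral.integral_const_mul,
    intervalIntegral.integral_comp_mul_left _ h2π.ne', norm_mul, norm_smul]
  have hA' : 2 * Real.pi * A = N⁻¹ := by rw [hA]; field_simp
  have hB' : 2 * Real.pi * B = N := by rw [hB]; field_simp
  rw [hA', hB']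
  have key := norm_integral_oscIntegrand_le (α := α) (b := y ^ 2 * ε / (4 * (ε ^ 2 + t ^ 2)))
    (x := x - y ^ 2 * t / (4 * (ε ^ 2 + t ^ 2))) (β := β) ht ht2
    (by positivity) (inv_pos.2 hN0) hNi
  have hcn : ‖c‖ ≤ 1 * (2 / √|t|) := by
    rw [hc, norm_mul, Complex.norm_real, Real.norm_of_nonneg (by positivity)]
    gcongr
    · apply inv_le_one_of_one_le₀
      have := Real.pi_gt_three; linarith
    · exact norm_sqrt_div_le ht
  have h3 : ‖(2 * Real.pi)⁻¹‖ ≤ 1 / 2 := by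
    rw [Real.norm_of_nonneg (by positivity), one_div]
    apply inv_anti₀ (by norm_num)
    have := Real.pi_gt_three; linarith
  set Cα := (61 + 2 * (1 + |α|) ^ (5 / 2 : ℝ))
  have ht' : 0 < |t| := abs_pos.2 ht
  have hs : √|t| * √|t| = |t| := Real.mul_self_sqrt ht'.le
  calc ‖c‖ * (‖(2 * Real.pi)⁻¹‖ * ‖∫ ξ in N⁻¹..N, F ξ‖)
      ≤ (1 * (2 / √|t|)) * (1 / 2 * (Cα * (1 + |β|) / √|t|)) := by gcongr
    _ = Cα * (1 + |β|) / (√|t| * √|t|) := by field_simp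
    _ = _ := by rw [hs]

/-- The dispersive estimate for the kernel on the line `Re w = 1`. -/
theorem norm_integral_groupSymbol_le {α N ε t β : ℝ} (hN : 1 ≤ N) (hε : 0 < ε)
    (ht : t ≠ 0) (ht2 : |t| ≤ 2) (z : ℝ × ℝ) :
    ‖∫ p, groupSymbol α N ε (1 + β * Complex.I) t p * planeWave z p‖ ≤
      2 * (61 + 2 * (1 + |α|) ^ (5 / 2 : ℝ)) * (1 + |β|) / |t| := by
  obtain ⟨x, y⟩ := z
  have hI := integrable_groupSymbol_mul_planeWave hN hε α (1 + β * Complex.I) t (x, y)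
  rw [Measure.volume_eq_prod] at hI
  rw [Measure.volume_eq_prod, integral_prod _ hI]
  have hI' := hI.integral_prod_left
  rw [← intervalIntegral.integral_Iic_add_Ioi (b := 0) hI'.integrableOn hI'.integrableOn,
    ← neg_zero, ← integral_comp_neg_Ioi, neg_zero]
  simp_rw [groupSymbol_neg_fst, planeWave_neg_fst]
  refine (norm_add_le _ _).trans ?_
  have h1 := norm_integral_groupSymbol_half_le (α := α) (x := x) (y := y) (β := β) hN hε ht ht2
  have h2 := norm_integral_groupSymbol_half_le (α := α) (x := -x) (y := y) (β := β) hN hε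
    (neg_ne_zero.2 ht) (by rwa [abs_neg])
  rw [abs_neg] at h2
  calc _ ≤ _ := add_le_add h2 h1
    _ = _ := by ring

/-! ### Plancherel's identity and bilinear forms of Fourier multipliers -/

section Plancherel

variable {E : Type*} [NormedAddCommGroup E] [InnerProductSpace ℝ E] [FiniteDimensional ℝ E]
  [MeasurableSpace E] [BorelSpace E]

theorem integral_fourier_mul_eq {f g : E → ℂ} (hf : Integrable f) (hg : Integrable g) :
    ∫ ξ, 𝓕 f ξ * g ξ = ∫ x, f x * 𝓕 g x := by
  have := VectorFourier.integral_fourierIntegral_smul_eq_flip (μ := (volume : Measure E))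
    (ν := (volume : Measure E)) (L := innerₗ E) Real.continuous_fourierChar
    continuous_inner hf hg
  rw [flip_innerₗ] at this
  exact this

theorem ae_eq_of_integral_mul_schwartz_eq {u v : E → ℂ} (hu : LocallyIntegrable u)
    (hv : LocallyIntegrable v) (h : ∀ φ : 𝓢(E, ℂ), ∫ x, u x * φ x = ∫ x, v x * φ x) :
    u =ᵐ[volume] v := by
  apply ae_eq_of_integral_contDiff_smul_eq hu hv
  intro g g_smooth g_cpt
  have hg₁ : HasCompactSupport (Complex.ofRealCLM ∘ g) := g_cpt.comp_left rfl
  have hg₂ : ContDiff ℝ (⊤ : ℕ∞) (Complex.ofRealCLM ∘ g) := by fun_prop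
  have := h (hg₁.toSchwartzMap hg₂)
  simpa [mul_comm] using this

theorem continuous_fourier_of_integrable {f : E → ℂ} (hf : Integrable f) : Continuous (𝓕 f) :=
  VectorFourier.fourierIntegral_continuous Real.continuous_fourierChar
    (by exact continuous_inner) hf

/-- The `L²` transform and the Fourier integral are compared as tempered distributions: paired with
`φ`, both give `∫ f 𝓕φ`. -/
theorem fourier_toLp_ae_eq {f : E → ℂ} (h1 : Integrable f) (h2 : MemLp f 2) :
    (𝓕 (h2.toLp f) : Lp ℂ 2 (volume : Measure E)) =ᵐ[volume] 𝓕 f := by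
  apply ae_eq_of_integral_mul_schwartz_eq
  · exact (Lp.memLp _).locallyIntegrable one_le_two
  · exact (continuous_fourier_of_integrable h1).locallyIntegrable
  · intro φ
    have := congrArg (fun T => T φ) (Lp.fourier_toTemperedDistribution_eq (h2.toLp f))
    simp only [TemperedDistribution.fourier_apply, Lp.toTemperedDistribution_apply,
      smul_eq_mul] at this
    simp_rw [mul_comm _ (φ _)]
    rw [← this]
    have e : ∫ x, 𝓕 φ x * (h2.toLp f) x = ∫ x, f x * 𝓕 (φ : E → ℂ) x := by
      apply integral_congr_ae
      filter_upwards [h2.coeFn_toLp] with x hx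
      rw [hx, mul_comm, SchwartzMap.fourier_coe]
    rw [e, ← integral_fourier_mul_eq h1 φ.integrable]
    simp_rw [mul_comm]

theorem eLpNorm_fourier_eq {f : E → ℂ} (h1 : Integrable f) (h2 : MemLp f 2) :
    eLpNorm (𝓕 f) 2 volume = eLpNorm f 2 volume := by
  rw [← eLpNorm_congr_ae (fourier_toLp_ae_eq h1 h2), ← eLpNorm_congr_ae h2.coeFn_toLp,
    ← Lp.enorm_def, ← Lp.enorm_def, ← ofReal_norm, ← ofReal_norm, Lp.norm_fourier_eq]

end Plancherel

/-- The inverse Fourier transform on the plane, written with `planeWave`. -/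
def planeTransform (a : ℝ × ℝ → ℂ) (p : ℝ × ℝ) : ℂ := ∫ z, a z * planeWave z p

theorem planeWave_neg_right (z p : ℝ × ℝ) : planeWave z (-p) = (starRingEnd ℂ) (planeWave z p) := by
  simp only [planeWave, ← Complex.exp_conj, map_mul, Complex.conj_ofReal, Complex.conj_I]
  congr 1
  simp only [Prod.fst_neg, Prod.snd_neg]
  push_cast
  ring

/-- The product `ℝ × ℝ` carries the sup norm, so Fourier theory is imported from its Euclidean
version. The reflection accounts for the positive sign in `planeWave`. -/
theorem planeTransform_neg (a : ℝ × ℝ → ℂ) (p : ℝ × ℝ) :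
    planeTransform a p = 𝓕 (fun x : WithLp 2 (ℝ × ℝ) => a (WithLp.ofLp x)) (WithLp.toLp 2 (-p)) := by
  rw [Real.fourier_eq, planeTransform,
    ← (WithLp.volume_preserving_ofLp ℝ ℝ).integral_comp
      (MeasurableEquiv.toLp 2 (ℝ × ℝ)).symm.measurableEmbedding]
  congr 1
  ext x
  rw [Circle.smul_def, smul_eq_mul, mul_comm, Real.fourierChar_apply, planeWave]
  congr 3
  simp [WithLp.prod_inner_apply]
  ring

theorem eLpNorm_planeTransform {a : ℝ × ℝ → ℂ} (h1 : Integrable a) (h2 : MemLp a 2) :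
    eLpNorm (planeTransform a) 2 volume = eLpNorm a 2 volume := by
  have mp := WithLp.volume_preserving_ofLp ℝ ℝ
  have mt := WithLp.volume_preserving_toLp ℝ ℝ
  have mn : MeasurePreserving (fun p : ℝ × ℝ => WithLp.toLp 2 (-p)) :=
    mt.comp (Measure.measurePreserving_neg volume)
  have i1 : Integrable (fun x : WithLp 2 (ℝ × ℝ) => a (WithLp.ofLp x)) :=
    mp.integrable_comp_of_integrable h1
  have i2 : MemLp (fun x : WithLp 2 (ℝ × ℝ) => a (WithLp.ofLp x)) 2 :=
    h2.comp_measurePreserving mp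
  have e : planeTransform a = (𝓕 (fun x : WithLp 2 (ℝ × ℝ) => a (WithLp.ofLp x))) ∘
      fun p : ℝ × ℝ => WithLp.toLp 2 (-p) := funext fun p => planeTransform_neg a p
  rw [e, eLpNorm_comp_measurePreserving (continuous_fourier_of_integrable i1).aestronglyMeasurable mn,
    eLpNorm_fourier_eq i1 i2]
  exact eLpNorm_comp_measurePreserving h2.1 mp

theorem continuous_planeTransform {a : ℝ × ℝ → ℂ} (h1 : Integrable a) :
    Continuous (planeTransform a) := by
  have mp := WithLp.volume_preserving_ofLp ℝ ℝ
  have i1 : Integrable (fun x : WithLp 2 (ℝ × ℝ) => a (WithLp.ofLp x)) :=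
    mp.integrable_comp_of_integrable h1
  have e : planeTransform a = (𝓕 (fun x : WithLp 2 (ℝ × ℝ) => a (WithLp.ofLp x))) ∘
      fun p : ℝ × ℝ => WithLp.toLp 2 (-p) := funext fun p => planeTransform_neg a p
  rw [e]
  exact (continuous_fourier_of_integrable i1).comp (by fun_prop)

/-- The form `⟨m(D) a, b⟩`, bilinear in `a` and `b`. -/
def planeForm (m a b : ℝ × ℝ → ℂ) : ℂ := ∫ p, m p * (planeTransform a p * planeTransform b (-p))

/-- The integrand of `planeForm` before integrating in the space variables. -/
def planeFormKernel (m a b : ℝ × ℝ → ℂ) (q : ((ℝ × ℝ) × (ℝ × ℝ)) × (ℝ × ℝ)) : ℂ :=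
  a q.1.1 * b q.1.2 * m q.2 * planeWave (q.1.1 - q.1.2) q.2

theorem integrable_planeFormKernel {m a b : ℝ × ℝ → ℂ} (hm : Integrable m) (ha : Integrable a)
    (hb : Integrable b) : Integrable (planeFormKernel m a b) := by
  have h := (ha.mul_prod hb).mul_prod hm
  refine h.norm.mono' (h.aestronglyMeasurable.mul ?_) (Filter.Eventually.of_forall fun q => ?_)
  · exact (continuous_planeWave.comp (by fun_prop :
      Continuous fun q : ((ℝ × ℝ) × (ℝ × ℝ)) × (ℝ × ℝ) =>
        (q.1.1 - q.1.2, q.2))).aestronglyMeasurable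
  · rw [planeFormKernel, norm_mul _ (planeWave _ _), norm_planeWave, mul_one]

theorem planeWave_sub (z z' p : ℝ × ℝ) :
    planeWave (z - z') p = planeWave z p * planeWave z' (-p) := by
  simp only [planeWave, ← Complex.exp_add]
  congr 1
  simp only [Prod.fst_sub, Prod.snd_sub, Prod.fst_neg, Prod.snd_neg]
  push_cast
  ring

theorem planeForm_eq_integral {m a b : ℝ × ℝ → ℂ} (hm : Integrable m) (ha : Integrable a)
    (hb : Integrable b) : planeForm m a b = ∫ q, planeFormKernel m a b q := by
  have h := integrable_planeFormKernel hm ha hb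
  rw [Measure.volume_eq_prod] at h
  rw [Measure.volume_eq_prod, integral_prod_symm _ h, planeForm]
  congr 1
  ext p
  rw [planeTransform, planeTransform, ← integral_prod_mul, ← integral_const_mul]
  congr 1
  ext z
  simp only [planeFormKernel, planeWave_sub]
  ring

/-- The `L¹` endpoint: by Fubini the form pairs `a ⊗ b` with the convolution kernel of the
multiplier at `z - z'`. -/
theorem norm_planeForm_le_of_kernel {m a b : ℝ × ℝ → ℂ} {K : ℝ} (hm : Integrable m)
    (ha : Integrable a) (hb : Integrable b) (hK : ∀ z, ‖∫ p, m p * planeWave z p‖ ≤ K) :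
    ‖planeForm m a b‖ ≤ K * ((∫ z, ‖a z‖) * ∫ z, ‖b z‖) := by
  have h := integrable_planeFormKernel hm ha hb
  rw [Measure.volume_eq_prod] at h
  rw [planeForm_eq_integral hm ha hb, Measure.volume_eq_prod, integral_prod _ h,
    ← integral_prod_mul, ← integral_const_mul]
  refine norm_integral_le_of_norm_le ((ha.norm.mul_prod hb.norm).const_mul K)
    (Filter.Eventually.of_forall fun z => ?_)
  have : ∫ p, planeFormKernel m a b (z, p) = a z.1 * b z.2 * ∫ p, m p * planeWave (z.1 - z.2) p := by
    rw [← integral_const_mul]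
    simp only [planeFormKernel, mul_assoc]
  rw [this, norm_mul, norm_mul, mul_comm]
  gcongr
  exact hK _

/-- The `L²` endpoint: Cauchy–Schwarz on the frequency side, then Plancherel. -/
theorem enorm_planeForm_le {m a b : ℝ × ℝ → ℂ} (hm : ∀ p, ‖m p‖ ≤ 1) (ha : Integrable a)
    (ha2 : MemLp a 2) (hb : Integrable b) (hb2 : MemLp b 2) :
    ‖planeForm m a b‖ₑ ≤ eLpNorm a 2 volume * eLpNorm b 2 volume := by
  rw [← eLpNorm_planeTransform ha ha2, ← eLpNorm_planeTransform hb hb2]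
  have hn : eLpNorm (planeTransform b) 2 volume =
      eLpNorm (fun p => planeTransform b (-p)) 2 volume :=
    (eLpNorm_comp_measurePreserving (continuous_planeTransform hb).aestronglyMeasurable
      (Measure.measurePreserving_neg (volume : Measure (ℝ × ℝ)))).symm
  rw [hn, eLpNorm_eq_lintegral_rpow_enorm_toReal two_ne_zero ENNReal.ofNat_ne_top,
    eLpNorm_eq_lintegral_rpow_enorm_toReal two_ne_zero ENNReal.ofNat_ne_top]
  refine (enorm_integral_le_lintegral_enorm _).trans ?_
  refine le_trans (lintegral_mono (g := (fun p => ‖planeTransform a p‖ₑ) *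
    fun p => ‖planeTransform b (-p)‖ₑ) fun p => ?_) ?_
  · rw [enorm_mul, enorm_mul, Pi.mul_apply]
    apply mul_le_of_le_one_left zero_le
    rw [← ofReal_norm]
    exact ENNReal.ofReal_le_one.2 (hm p)
  · have c1 := (continuous_planeTransform ha)
    have c2 := (continuous_planeTransform hb).comp (continuous_neg (G := ℝ × ℝ))
    exact ENNReal.lintegral_mul_le_Lp_mul_Lq volume
      (p := (2 : ℝ≥0∞).toReal) (q := (2 : ℝ≥0∞).toReal)
      (by norm_num; exact Real.HolderConjugate.two_two)
      c1.enorm.measurable.aemeasurable c2.enorm.measurable.aemeasurable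

/-! ### Stein interpolation of the dispersive estimate -/

/-- Differentiation under the integral sign. Where `A` does not vanish `L` is bounded, so on a unit
ball of parameters the exponential is bounded uniformly in `x`. -/
theorem differentiable_integral_mul_exp {X : Type*} [MeasurableSpace X] {μ : Measure X}
    {A : X → ℂ} {L : X → ℝ} {l : ℝ} (hA : Integrable A μ) (hL : AEStronglyMeasurable L μ)
    (hl : ∀ x, A x ≠ 0 → |L x| ≤ l) :
    Differentiable ℂ fun w : ℂ => ∫ x, A x * Complex.exp (w * L x) ∂μ := by
  intro w₀
  have hm : ∀ w : ℂ, AEStronglyMeasurable (fun x => A x * Complex.exp (w * L x)) μ := fun w =>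
    hA.1.mul (Complex.continuous_exp.comp_aestronglyMeasurable
      ((Complex.continuous_ofReal.comp_aestronglyMeasurable hL).const_mul w))
  have hbd : ∀ w ∈ Metric.ball w₀ 1, ∀ x, ‖A x * Complex.exp (w * L x)‖ ≤
      Real.exp ((‖w₀‖ + 1) * l) * ‖A x‖ := by
    intro w hw x
    by_cases h0 : A x = 0
    · simp [h0]
    rw [norm_mul, mul_comm]
    gcongr
    rw [Complex.norm_exp]
    apply Real.exp_le_exp.2
    have h1 : ‖w‖ ≤ ‖w₀‖ + 1 := by
      have := norm_le_norm_add_norm_sub' w w₀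
      rw [mem_ball_iff_norm] at hw
      linarith
    calc (w * L x).re = w.re * L x := by simp
      _ ≤ |w.re * L x| := le_abs_self _
      _ = |w.re| * |L x| := abs_mul _ _
      _ ≤ ‖w‖ * |L x| := by gcongr; exact Complex.abs_re_le_norm w
      _ ≤ (‖w₀‖ + 1) * l := by gcongr; exact hl x h0
  have := hasDerivAt_integral_of_dominated_loc_of_deriv_le (μ := μ) (𝕜 := ℂ)
    (F := fun w x => A x * Complex.exp (w * L x)) (x₀ := w₀)
    (F' := fun w x => A x * Complex.exp (w * L x) * L x)
    (bound := fun x => Real.exp ((‖w₀‖ + 1) * l) * ‖A x‖ * |l|)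
    (Metric.ball_mem_nhds w₀ one_pos) (Filter.Eventually.of_forall hm)
    ((hA.norm.const_mul _).mono' (hm w₀) (Filter.Eventually.of_forall
      (hbd w₀ (Metric.mem_ball_self one_pos))))
    ((hm w₀).mul (Complex.continuous_ofReal.comp_aestronglyMeasurable hL))
    (Filter.Eventually.of_forall fun x w hw => by
      by_cases h0 : A x = 0
      · simp [h0]
      rw [norm_mul, Complex.norm_real, Real.norm_eq_abs]
      exact mul_le_mul (hbd w hw x) ((hl x h0).trans (le_abs_self l)) (abs_nonneg _)
        (by positivity))
    ((hA.norm.const_mul _).mul_const _)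
    (Filter.Eventually.of_forall fun x w _ => by
      have := (((hasDerivAt_id w).mul_const (L x : ℂ)).cexp).const_mul (A x)
      refine HasDerivAt.congr_deriv this ?_
      simp only [id, one_mul]
      ring)
  exact this.2.differentiableAt

/-- Bounded measurable functions of bounded support that stay away from `0` on their support. -/
structure IsTame (a : ℝ × ℝ → ℂ) : Prop where
  measurable : Measurable a
  bounded_support : ∃ R : ℝ, ∀ z, a z ≠ 0 → ‖z‖ ≤ R
  norm_mem : ∃ l : ℝ, ∀ z, a z ≠ 0 → |Real.log ‖a z‖| ≤ l

/-- The analytic family through `a` in the proof of Stein interpolation. -/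
def steinFamily (θ : ℝ) (a : ℝ × ℝ → ℂ) (w : ℂ) (z : ℝ × ℝ) : ℂ :=
  a z / ‖a z‖ * Complex.exp ((1 + w) * ((Real.log ‖a z‖ / (1 + θ) : ℝ) : ℂ))

theorem measurable_steinFamily {θ : ℝ} {a : ℝ × ℝ → ℂ} (ha : Measurable a) (w : ℂ) :
    Measurable (steinFamily θ a w) := by
  unfold steinFamily
  fun_prop

theorem steinFamily_eq_zero {θ : ℝ} {a : ℝ × ℝ → ℂ} {w : ℂ} {z : ℝ × ℝ} (h : a z = 0) :
    steinFamily θ a w z = 0 := by simp [steinFamily, h]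

theorem norm_steinFamily {θ : ℝ} {a : ℝ × ℝ → ℂ} {w : ℂ} {z : ℝ × ℝ} (h : a z ≠ 0) :
    ‖steinFamily θ a w z‖ = ‖a z‖ ^ ((1 + w.re) / (1 + θ)) := by
  have hn : 0 < ‖a z‖ := norm_pos_iff.2 h
  rw [steinFamily, norm_mul, norm_div, Complex.norm_real, norm_norm, div_self hn.ne', one_mul,
    Complex.norm_exp, Real.rpow_def_of_pos hn]
  congr 1
  rw [Complex.mul_re, Complex.ofReal_re, Complex.ofReal_im, Complex.add_re, Complex.one_re]
  ring

theorem steinFamily_self {θ : ℝ} (hθ : 0 < 1 + θ) (a : ℝ × ℝ → ℂ) : steinFamily θ a θ = a := by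
  ext z
  by_cases h : a z = 0
  · rw [steinFamily_eq_zero h, h]
  have hn : 0 < ‖a z‖ := norm_pos_iff.2 h
  have hn' : (‖a z‖ : ℂ) ≠ 0 := by exact_mod_cast hn.ne'
  have : (1 + (θ : ℂ)) * ((Real.log ‖a z‖ / (1 + θ) : ℝ) : ℂ) = ((Real.log ‖a z‖ : ℝ) : ℂ) := by
    have h1 : (1 + (θ : ℂ)) ≠ 0 := by exact_mod_cast hθ.ne'
    push_cast
    field_simp
  rw [steinFamily, this, ← Complex.ofReal_exp, Real.exp_log hn]
  field_simp

theorem steinFamily_eq_mul_exp (θ : ℝ) (a : ℝ × ℝ → ℂ) (w : ℂ) (z : ℝ × ℝ) :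
    steinFamily θ a w z = steinFamily θ a 0 z *
      Complex.exp (w * ((Real.log ‖a z‖ / (1 + θ) : ℝ) : ℂ)) := by
  rw [steinFamily, steinFamily, mul_assoc, ← Complex.exp_add]
  ring_nf

theorem IsTame.steinFamily_memLp {a : ℝ × ℝ → ℂ} (ha : IsTame a) (θ : ℝ) (w : ℂ) (p : ℝ≥0∞) :
    MemLp (steinFamily θ a w) p volume := by
  obtain ⟨R, hR⟩ := ha.bounded_support
  obtain ⟨l, hl⟩ := ha.norm_mem
  set B := Real.exp (|(1 + w.re) / (1 + θ)| * l)
  have hc : MemLp ((Metric.closedBall (0 : ℝ × ℝ) R).indicator fun _ => (B : ℂ)) p volume :=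
    memLp_indicator_const p measurableSet_closedBall _
      (Or.inr (isCompact_closedBall _ _).measure_lt_top.ne)
  refine hc.mono (measurable_steinFamily ha.measurable w).aestronglyMeasurable
    (Filter.Eventually.of_forall fun z => ?_)
  by_cases h : a z = 0
  · rw [steinFamily_eq_zero h]; simp
  have hz : z ∈ Metric.closedBall (0 : ℝ × ℝ) R := by simpa using hR z h
  rw [Set.indicator_of_mem hz, norm_steinFamily h, Complex.norm_real, Real.norm_of_nonneg
    (Real.exp_pos _).le, Real.rpow_def_of_pos (norm_pos_iff.2 h)]
  apply Real.exp_le_exp.2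
  calc _ ≤ |(Real.log ‖a z‖ * ((1 + w.re) / (1 + θ)))| := le_abs_self _
    _ = |(1 + w.re) / (1 + θ)| * |(Real.log ‖a z‖)| := by rw [abs_mul, mul_comm]
    _ ≤ _ := by gcongr; exact hl z h

/-- The family has modulus `‖a‖ ^ ((1 + Re w) / (1 + θ))`. The exponent is chosen so that the
squared `L²` norm on `Re w = 0` and the `L¹` norm on `Re w = 1` are the same integral. -/
theorem eLpNorm_two_steinFamily {θ : ℝ} (hθ : 0 < 1 + θ) {a : ℝ × ℝ → ℂ} (ha : IsTame a) {w : ℂ}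
    (hw : w.re = 0) : eLpNorm (steinFamily θ a w) 2 volume =
      ENNReal.ofReal ((∫ z, ‖a z‖ ^ (2 / (1 + θ))) ^ (1 / 2 : ℝ)) := by
  rw [(ha.steinFamily_memLp θ w 2).eLpNorm_eq_integral_rpow_norm two_ne_zero
    ENNReal.ofNat_ne_top]
  congr 1
  have : ∀ z, ‖steinFamily θ a w z‖ ^ (2 : ℝ≥0∞).toReal = ‖a z‖ ^ (2 / (1 + θ)) := by
    intro z
    by_cases h : a z = 0
    · rw [steinFamily_eq_zero h, h]
      simp [Real.zero_rpow (div_pos two_pos hθ).ne']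
    · rw [norm_steinFamily h, hw, ← Real.rpow_mul (norm_nonneg _)]
      congr 1
      simp
      ring
  simp_rw [this]
  norm_num

theorem integral_norm_steinFamily {θ : ℝ} (hθ : 0 < 1 + θ) {a : ℝ × ℝ → ℂ} {w : ℂ}
    (hw : w.re = 1) : ∫ z, ‖steinFamily θ a w z‖ = ∫ z, ‖a z‖ ^ (2 / (1 + θ)) := by
  congr 1
  ext z
  by_cases h : a z = 0
  · rw [steinFamily_eq_zero h, h]
    simp [Real.zero_rpow (div_pos two_pos hθ).ne']
  · rw [norm_steinFamily h, hw]
    norm_num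

theorem groupSymbol_eq_mul_exp (α N ε : ℝ) (w : ℂ) (t : ℝ) (p : ℝ × ℝ) :
    groupSymbol α N ε w t p = groupSymbol α N ε 0 t p *
      Complex.exp (w * Real.log |2 * Real.pi * p.1|) := by
  simp only [groupSymbol, zero_mul, Complex.exp_zero, one_mul]
  ring

theorem norm_groupSymbol_le_one {α N ε : ℝ} (hε : 0 ≤ ε) {w : ℂ} (hw : w.re = 0) (t : ℝ)
    (p : ℝ × ℝ) : ‖groupSymbol α N ε w t p‖ ≤ 1 := by
  rw [norm_groupSymbol, hw, zero_mul, Real.exp_zero, one_mul]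
  exact freqCutoff_le_one hε p

/-- The entire function to which the three lines theorem is applied. -/
theorem exists_entire_planeForm {N ε θ : ℝ} (hN : 1 ≤ N) (hε : 0 < ε) (α t : ℝ)
    {a b : ℝ × ℝ → ℂ} (ha : IsTame a) (hb : IsTame b) :
    Differentiable ℂ (fun w => planeForm (groupSymbol α N ε w t) (steinFamily θ a w)
      (steinFamily θ b w)) ∧
    ∃ B : ℝ, ∀ w : ℂ, |w.re| ≤ 1 → ‖planeForm (groupSymbol α N ε w t) (steinFamily θ a w)
      (steinFamily θ b w)‖ ≤ B := by
  obtain ⟨la, hla⟩ := ha.norm_mem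
  obtain ⟨lb, hlb⟩ := hb.norm_mem
  have ia := fun w => memLp_one_iff_integrable.1 (ha.steinFamily_memLp θ w 1)
  have ib := fun w => memLp_one_iff_integrable.1 (hb.steinFamily_memLp θ w 1)
  have im := fun w => integrable_groupSymbol hN hε α w t
  set A := planeFormKernel (groupSymbol α N ε 0 t) (steinFamily θ a 0) (steinFamily θ b 0)
  set L : ((ℝ × ℝ) × (ℝ × ℝ)) × (ℝ × ℝ) → ℝ := fun q =>
    Real.log ‖a q.1.1‖ / (1 + θ) + Real.log ‖b q.1.2‖ / (1 + θ) + Real.log |2 * Real.pi * q.2.1|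
    with hL
  have hA : Integrable A := integrable_planeFormKernel (im 0) (ia 0) (ib 0)
  have hLm : Measurable L := by
    have h1 := ha.measurable
    have h2 := hb.measurable
    have : Measurable fun x : ℝ => |x| := measurable_norm
    fun_prop
  -- Because the form involves no conjugation, the whole dependence on `w` sits in one factor `exp
  -- (w L)` with `L` real. Tameness and the cut-off in `ξ` bound `L` wherever the integrand is
  -- nonzero.
  have hrep : ∀ w : ℂ, planeForm (groupSymbol α N ε w t) (steinFamily θ a w) (steinFamily θ b w) =
      ∫ q, A q * Complex.exp (w * L q) := by
    intro w
    rw [planeForm_eq_integral (im w) (ia w) (ib w)]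
    congr 1
    ext q
    simp only [A, planeFormKernel, hL]
    rw [groupSymbol_eq_mul_exp, steinFamily_eq_mul_exp θ a w, steinFamily_eq_mul_exp θ b w]
    push_cast
    rw [mul_add, mul_add, Complex.exp_add, Complex.exp_add]
    ring
  have hl : ∀ q, A q ≠ 0 → |L q| ≤ la / |1 + θ| + lb / |1 + θ| + Real.log N := by
    intro q hq
    have h1 : a q.1.1 ≠ 0 := fun h => hq (by simp [A, planeFormKernel, steinFamily_eq_zero h])
    have h2 : b q.1.2 ≠ 0 := fun h => hq (by simp [A, planeFormKernel, steinFamily_eq_zero h])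
    have h3 : N⁻¹ ≤ |2 * Real.pi * q.2.1| ∧ |2 * Real.pi * q.2.1| ≤ N := by
      by_contra h
      exact hq (by simp only [A, planeFormKernel, groupSymbol, freqCutoff, if_neg h]; simp)
    refine (abs_add_le _ _).trans (add_le_add ((abs_add_le _ _).trans (add_le_add ?_ ?_)) ?_)
    · rw [abs_div]; gcongr; exact hla _ h1
    · rw [abs_div]; gcongr; exact hlb _ h2
    · exact abs_log_le_of_mem hN h3.1 h3.2
  constructor
  · simp_rw [hrep]
    exact differentiable_integral_mul_exp hA hLm.aestronglyMeasurable hl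
  · set l := la / |1 + θ| + lb / |1 + θ| + Real.log N
    refine ⟨∫ q, Real.exp |l| * ‖A q‖, fun w hw => ?_⟩
    rw [hrep]
    refine norm_integral_le_of_norm_le (hA.norm.const_mul _)
      (Filter.Eventually.of_forall fun q => ?_)
    by_cases h0 : A q = 0
    · simp [h0]
    rw [norm_mul, mul_comm]
    gcongr
    rw [Complex.norm_exp]
    apply Real.exp_le_exp.2
    calc (w * L q).re = w.re * L q := by simp
      _ ≤ |(w.re * L q)| := le_abs_self _
      _ = |w.re| * |L q| := abs_mul _ _
      _ ≤ 1 * |l| := mul_le_mul hw ((hl q h0).trans (le_abs_self _)) (abs_nonneg _) zero_le_one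
      _ = _ := one_mul _

/-- The factor `exp (w²)` decays like a Gaussian along vertical lines and absorbs the growth `1 +
|β|` of the kernel bound. -/
theorem norm_exp_sq_mul_le {w : ℂ} (hw : w.re = 1) :
    (1 + |w.im|) * ‖Complex.exp (w ^ 2)‖ ≤ 6 := by
  rw [Complex.norm_exp]
  have h : (w ^ 2).re = 1 - |w.im| ^ 2 := by
    rw [sq_abs, sq, Complex.mul_re, hw]; ring
  rw [h, Real.exp_sub]
  have h1 : |w.im| ^ 2 + 1 ≤ Real.exp (|w.im| ^ 2) := Real.add_one_le_exp _
  have h2 := Real.exp_one_lt_d9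
  have h3 : 0 < Real.exp (|w.im| ^ 2) := Real.exp_pos _
  rw [← mul_div_assoc, div_le_iff₀ h3]
  nlinarith [sq_nonneg (|w.im| - 1 / 2), abs_nonneg w.im, Real.exp_pos 1]

/-- The constant of the dispersive estimate. -/
def dispersiveConst (α : ℝ) : ℝ := 12 * (61 + 2 * (1 + |α|) ^ (5 / 2 : ℝ))

theorem one_le_dispersiveConst (α : ℝ) : 1 ≤ dispersiveConst α := by
  have : 0 ≤ (1 + |α|) ^ (5 / 2 : ℝ) := by positivity
  unfold dispersiveConst
  linarith

/-- The dispersive estimate, by Stein interpolation between `L²` and `L¹`. -/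
theorem norm_planeForm_groupSymbol_le {α N ε θ t : ℝ} (hN : 1 ≤ N) (hε : 0 < ε) (hθ0 : 0 ≤ θ)
    (hθ1 : θ ≤ 1) (ht : t ≠ 0) (ht2 : |t| ≤ 2) {a b : ℝ × ℝ → ℂ} (ha : IsTame a) (hb : IsTame b) :
    ‖planeForm (groupSymbol α N ε θ t) a b‖ ≤ dispersiveConst α * |t| ^ (-θ) *
      ((∫ z, ‖a z‖ ^ (2 / (1 + θ))) ^ ((1 + θ) / 2) *
        (∫ z, ‖b z‖ ^ (2 / (1 + θ))) ^ ((1 + θ) / 2)) := by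
  have h1θ : 0 < 1 + θ := by linarith
  have ht0 : 0 < |t| := abs_pos.2 ht
  set K := dispersiveConst α with hK
  have hK1 : 1 ≤ K := one_le_dispersiveConst α
  set Sa := ∫ z, ‖a z‖ ^ (2 / (1 + θ))
  set Sb := ∫ z, ‖b z‖ ^ (2 / (1 + θ))
  have hSa : 0 ≤ Sa := integral_nonneg fun z => Real.rpow_nonneg (norm_nonneg _) _
  have hSb : 0 ≤ Sb := integral_nonneg fun z => Real.rpow_nonneg (norm_nonneg _) _
  have ia := fun w => memLp_one_iff_integrable.1 (ha.steinFamily_memLp θ w 1)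
  have ib := fun w => memLp_one_iff_integrable.1 (hb.steinFamily_memLp θ w 1)
  obtain ⟨hd, B, hB⟩ := exists_entire_planeForm (θ := θ) hN hε α t ha hb
  set F := fun w => planeForm (groupSymbol α N ε w t) (steinFamily θ a w) (steinFamily θ b w)
  -- The factor `exp (w²)` makes both boundary lines bounded, the line `Re w = 1` by `K / |t|`; the
  -- `6` lost there is built into `dispersiveConst`. At the real point `θ` its modulus is at least
  -- `1`, so it can be dropped again.
  set G : ℂ → ℂ := fun w => Complex.exp (w ^ 2) * F w with hG
  have hGd : Differentiable ℂ G := by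
    apply Differentiable.mul _ hd
    fun_prop
  have hsq : ∀ w : ℂ, |w.re| ≤ 1 → ‖Complex.exp (w ^ 2)‖ ≤ Real.exp 1 := by
    intro w hw
    rw [Complex.norm_exp, Real.exp_le_exp, sq, Complex.mul_re]
    nlinarith [sq_abs w.re, sq_nonneg w.im, abs_nonneg w.re]
  have hG0 : ∀ z ∈ Complex.re ⁻¹' {(0 : ℝ)}, ‖G z‖ ≤ (Sa * Sb) ^ (1 / 2 : ℝ) := by
    intro w hw
    have hw : w.re = 0 := hw
    have e1 : ‖Complex.exp (w ^ 2)‖ ≤ 1 := by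
      rw [Complex.norm_exp, Real.exp_le_one_iff, sq, Complex.mul_re, hw]
      nlinarith [sq_nonneg w.im]
    have e2 : ‖F w‖ ≤ (Sa * Sb) ^ (1 / 2 : ℝ) := by
      have := enorm_planeForm_le (norm_groupSymbol_le_one (α := α) (N := N) hε.le hw t) (ia w)
        (ha.steinFamily_memLp θ w 2) (ib w) (hb.steinFamily_memLp θ w 2)
      rw [eLpNorm_two_steinFamily h1θ ha hw, eLpNorm_two_steinFamily h1θ hb hw,
        ← ENNReal.ofReal_mul (by positivity), ← Real.mul_rpow hSa hSb, ← ofReal_norm,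
        ENNReal.ofReal_le_ofReal_iff (by positivity)] at this
      exact this
    calc ‖G w‖ = ‖Complex.exp (w ^ 2)‖ * ‖F w‖ := norm_mul _ _
      _ ≤ 1 * (Sa * Sb) ^ (1 / 2 : ℝ) := by gcongr
      _ = _ := one_mul _
  have hG1 : ∀ z ∈ Complex.re ⁻¹' {(1 : ℝ)}, ‖G z‖ ≤ K / |t| * (Sa * Sb) := by
    intro w hw
    have hw : w.re = 1 := hw
    have hw' : w = 1 + w.im * Complex.I := by
      apply Complex.ext <;> simp [hw]
    have e2 : ‖F w‖ ≤ K / 6 * (1 + |w.im|) / |t| * (Sa * Sb) := by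
      have := norm_planeForm_le_of_kernel (integrable_groupSymbol hN hε α w t) (ia w) (ib w)
        (K := K / 6 * (1 + |w.im|) / |t|) (fun z => by
          have := norm_integral_groupSymbol_le (α := α) (β := w.im) hN hε ht ht2 z
          rw [← hw'] at this
          refine this.trans (le_of_eq ?_)
          rw [hK, dispersiveConst]
          ring)
      rwa [integral_norm_steinFamily h1θ hw, integral_norm_steinFamily h1θ hw] at this
    have e1 := norm_exp_sq_mul_le hw
    calc ‖G w‖ = ‖Complex.exp (w ^ 2)‖ * ‖F w‖ := norm_mul _ _
      _ ≤ ‖Complex.exp (w ^ 2)‖ * (K / 6 * (1 + |w.im|) / |t| * (Sa * Sb)) := by gcongr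
      _ = ((1 + |w.im|) * ‖Complex.exp (w ^ 2)‖) * (K / 6 / |t| * (Sa * Sb)) := by ring
      _ ≤ 6 * (K / 6 / |t| * (Sa * Sb)) := by gcongr
      _ = _ := by ring
  have key := Complex.HadamardThreeLines.norm_le_interp_of_mem_verticalClosedStrip₀₁' G
    (z := θ) (a := (Sa * Sb) ^ (1 / 2 : ℝ)) (b := K / |t| * (Sa * Sb))
    (by simpa [Complex.HadamardThreeLines.verticalClosedStrip] using ⟨hθ0, hθ1⟩)
    hGd.diffContOnCl
    ⟨Real.exp 1 * B, by
      rintro _ ⟨w, hw, rfl⟩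
      have hw' : |w.re| ≤ 1 := by
        have h : 0 ≤ w.re ∧ w.re ≤ 1 := hw
        rw [abs_of_nonneg h.1]; exact h.2
      simp only [Function.comp, hG, norm_mul]
      exact mul_le_mul (hsq w hw') (hB w hw') (norm_nonneg _) (Real.exp_pos _).le⟩ hG0 hG1
  have hFθ : F θ = planeForm (groupSymbol α N ε θ t) a b := by
    simp only [F, steinFamily_self h1θ]
  have hGθ : ‖F θ‖ ≤ ‖G θ‖ := by
    simp only [hG, norm_mul]
    apply le_mul_of_one_le_left (norm_nonneg _)
    rw [Complex.norm_exp, Real.one_le_exp_iff]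
    rw [sq, ← Complex.ofReal_mul, Complex.ofReal_re]
    positivity
  rw [← hFθ]
  refine hGθ.trans (key.trans ?_)
  rw [Complex.ofReal_re]
  -- If `Sa * Sb = 0`, one of the interpolated factors vanishes: the first when `θ = 0`, the second
  -- when `θ > 0`. Otherwise the exponents `(1 - θ) / 2` and `θ` add up to `(1 + θ) / 2`.
  rcases eq_or_lt_of_le (mul_nonneg hSa hSb) with h0 | h0
  · have hr : (0 : ℝ) ≤ K * |t| ^ (-θ) * (Sa ^ ((1 + θ) / 2) * Sb ^ ((1 + θ) / 2)) := by positivity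
    refine le_trans (le_of_eq ?_) hr
    rw [← h0]
    rcases eq_or_lt_of_le hθ0 with h | h
    · rw [← h]; norm_num
    · rw [mul_zero, Real.zero_rpow h.ne', mul_zero]
  · rw [← Real.mul_rpow hSa hSb, ← Real.rpow_mul h0.le, Real.mul_rpow (by positivity) h0.le,
      Real.div_rpow (by positivity) ht0.le]
    have hKθ : K ^ θ ≤ K := by
      calc K ^ θ ≤ K ^ (1 : ℝ) := Real.rpow_le_rpow_of_exponent_le hK1 hθ1
        _ = K := Real.rpow_one K
    have hS : (Sa * Sb) ^ (1 / 2 * (1 - θ)) * (Sa * Sb) ^ θ = (Sa * Sb) ^ ((1 + θ) / 2) := by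
      rw [← Real.rpow_add h0]; congr 1; ring
    rw [Real.rpow_neg ht0.le]
    calc (Sa * Sb) ^ (1 / 2 * (1 - θ)) * (K ^ θ / |t| ^ θ * (Sa * Sb) ^ θ)
        = K ^ θ * (|t| ^ θ)⁻¹ * ((Sa * Sb) ^ (1 / 2 * (1 - θ)) * (Sa * Sb) ^ θ) := by ring
      _ ≤ K * (|t| ^ θ)⁻¹ * (Sa * Sb) ^ ((1 + θ) / 2) := by rw [hS]; gcongr

/-! ### The Hardy–Littlewood–Sobolev inequality on the line -/

theorem lintegral_comp_abs_eq (g : ℝ → ℝ≥0∞) :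
    ∫⁻ x, g |x| = 2 * ∫⁻ x in Set.Ioi 0, g x := by
  have h1 : ∫⁻ x in Set.Ioi 0, g |x| = ∫⁻ x in Set.Ioi 0, g x :=
    setLIntegral_congr_fun measurableSet_Ioi fun x hx => by rw [abs_of_pos hx]
  have h2 : ∫⁻ x in Set.Iio 0, g |x| = ∫⁻ x in Set.Ioi 0, g x := by
    rw [← h1]
    have mp := (Measure.measurePreserving_neg (volume : Measure ℝ))
    have := mp.setLIntegral_comp_preimage_emb (MeasurableEquiv.neg ℝ).measurableEmbedding
      (fun x => g |x|) (Set.Ioi 0)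
    simp only [abs_neg] at this
    rw [← this]
    congr 2
    ext x
    simp
  have h3 : ∫⁻ x in Set.Iic 0, g |x| = ∫⁻ x in Set.Iio 0, g |x| :=
    setLIntegral_congr Iio_ae_eq_Iic.symm
  rw [← lintegral_add_compl _ measurableSet_Ioi (μ := volume) (A := Set.Ioi (0 : ℝ)), Set.compl_Ioi,
    h3, h1, h2, two_mul]

theorem lintegral_rpow_near_le {δ ρ : ℝ} (hδ1 : δ < 1) (hρ : 0 < ρ) :
    ∫⁻ x : ℝ, (if |x| ≤ ρ then ENNReal.ofReal (|x| ^ (-δ)) else 0) ≤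
      ENNReal.ofReal (2 / (1 - δ) * ρ ^ (1 - δ)) := by
  rw [lintegral_comp_abs_eq (fun x => if x ≤ ρ then ENNReal.ofReal (x ^ (-δ)) else 0)]
  have h1 : ∫⁻ x in Set.Ioi 0, (if x ≤ ρ then ENNReal.ofReal (x ^ (-δ)) else 0) =
      ∫⁻ x in Set.Ioc 0 ρ, ENNReal.ofReal (x ^ (-δ)) := by
    have : (fun x : ℝ => if x ≤ ρ then ENNReal.ofReal (x ^ (-δ)) else 0) =
        (Set.Iic ρ).indicator fun x => ENNReal.ofReal (x ^ (-δ)) := by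
      ext x; simp [Set.indicator_apply]
    rw [this, setLIntegral_indicator measurableSet_Iic, Set.Iic_inter_Ioi]
  have hi : IntervalIntegrable (fun x : ℝ => x ^ (-δ)) volume 0 ρ :=
    intervalIntegral.intervalIntegrable_rpow' (by linarith)
  rw [intervalIntegrable_iff_integrableOn_Ioc_of_le hρ.le] at hi
  rw [h1, ← ofReal_integral_eq_lintegral_ofReal hi
    ((ae_restrict_iff' measurableSet_Ioc).2 (Filter.Eventually.of_forall fun x hx =>
      Real.rpow_nonneg hx.1.le _)), ← intervalIntegral.integral_of_le hρ.le,
    integral_rpow (Or.inl (by linarith)), show (2 : ℝ≥0∞) = ENNReal.ofReal 2 by simp,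
    ← ENNReal.ofReal_mul zero_le_two]
  apply ENNReal.ofReal_le_ofReal
  rw [Real.zero_rpow (by linarith), sub_zero, neg_add_eq_sub]
  apply le_of_eq
  ring

theorem lintegral_rpow_far_le {ρ : ℝ} (hρ : 0 < ρ) :
    ∫⁻ x : ℝ, (if ρ < |x| then ENNReal.ofReal (|x| ^ (-2 : ℝ)) else 0) ≤
      ENNReal.ofReal (2 / ρ) := by
  rw [lintegral_comp_abs_eq (fun x => if ρ < x then ENNReal.ofReal (x ^ (-2 : ℝ)) else 0)]
  have h1 : ∫⁻ x in Set.Ioi 0, (if ρ < x then ENNReal.ofReal (x ^ (-2 : ℝ)) else 0) =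
      ∫⁻ x in Set.Ioi ρ, ENNReal.ofReal (x ^ (-2 : ℝ)) := by
    have : (fun x : ℝ => if ρ < x then ENNReal.ofReal (x ^ (-2 : ℝ)) else 0) =
        (Set.Ioi ρ).indicator fun x => ENNReal.ofReal (x ^ (-2 : ℝ)) := by
      ext x; simp [Set.indicator_apply]
    rw [this, setLIntegral_indicator measurableSet_Ioi, Set.Ioi_inter_Ioi, max_eq_left hρ.le]
  rw [h1, ← ofReal_integral_eq_lintegral_ofReal (integrableOn_Ioi_rpow_of_lt (by norm_num) hρ)
    ((ae_restrict_iff' measurableSet_Ioi).2 (Filter.Eventually.of_forall fun x hx =>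
      Real.rpow_nonneg (hρ.trans hx).le _)),
    integral_Ioi_rpow_of_lt (by norm_num) hρ, show (2 : ℝ≥0∞) = ENNReal.ofReal 2 by simp,
    ← ENNReal.ofReal_mul zero_le_two]
  apply ENNReal.ofReal_le_ofReal
  have : ρ ^ ((-2 : ℝ) + 1) = ρ⁻¹ := by
    rw [← Real.rpow_neg_one]; norm_num
  rw [this]
  apply le_of_eq
  field_simp
  norm_num

/-- The part of the fractional integral of `f` at `t` coming from the points where `f` is at most
`f t`. -/
theorem lintegral_fractional_sublevel_le {δ : ℝ} (hδ0 : 0 < δ) (hδ1 : δ < 1) {f : ℝ → ℝ}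
    (hf : Measurable f) {S : ℝ} (hS : 0 < S)
    (hfS : ∫⁻ s, ENNReal.ofReal (f s) ^ (2 / (2 - δ)) = ENNReal.ofReal S) {t : ℝ} (hft : 0 < f t) :
    ∫⁻ s, (if f s ≤ f t then ENNReal.ofReal (f s) * ENNReal.ofReal (|s - t| ^ (-δ)) else 0) ≤
      ENNReal.ofReal ((2 / (1 - δ) + 2) * S ^ (1 - δ) * f t ^ (2 / (2 - δ) - 1)) := by
  set p := 2 / (2 - δ) with hp
  have h2δ : 0 < 2 - δ := by linarith
  have hp0 : 0 < p := by positivity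
  have hpd : p * (2 - δ) = 2 := by rw [hp]; field_simp
  -- The balancing radius. Up to constants, the near bound `f(t) ρ^(1-δ)` and the far bound `S^(1/p)
  -- ρ^(-δ/2)` are then both equal to `S^(1-δ) f(t)^(p-1)`, by `p (2 - δ) = 2`.
  set ρ := S * f t ^ (-p) with hρdef
  have hρ : 0 < ρ := by positivity
  have hmk : Measurable fun x : ℝ => ENNReal.ofReal (|x| ^ (-δ)) := by
    have : Measurable fun x : ℝ => |x| := measurable_norm
    fun_prop
  have hmabs : Measurable fun x : ℝ => |x| := measurable_norm
  have split : ∀ s, (if f s ≤ f t then ENNReal.ofReal (f s) * ENNReal.ofReal (|s - t| ^ (-δ))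
      else 0) ≤ ENNReal.ofReal (f t) * (if |s - t| ≤ ρ then ENNReal.ofReal (|s - t| ^ (-δ)) else 0) +
      ENNReal.ofReal (f s) * (if ρ < |s - t| then ENNReal.ofReal (|s - t| ^ (-δ)) else 0) := by
    intro s
    by_cases h1 : f s ≤ f t
    · rw [if_pos h1]
      by_cases h2 : |s - t| ≤ ρ
      · rw [if_pos h2, if_neg (not_lt.2 h2), mul_zero, add_zero]
        gcongr
      · rw [if_neg h2, if_pos (not_le.1 h2), mul_zero, zero_add]
    · rw [if_neg h1]; exact zero_le
  have near : ∫⁻ s, ENNReal.ofReal (f t) *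
      (if |s - t| ≤ ρ then ENNReal.ofReal (|s - t| ^ (-δ)) else 0) ≤
      ENNReal.ofReal (2 / (1 - δ) * S ^ (1 - δ) * f t ^ (p - 1)) := by
    rw [lintegral_const_mul']
    · rw [lintegral_sub_right_eq_self
        (fun x : ℝ => if |x| ≤ ρ then ENNReal.ofReal (|x| ^ (-δ)) else 0) t]
      refine (mul_le_mul_right (lintegral_rpow_near_le hδ1 hρ) _).trans ?_
      rw [← ENNReal.ofReal_mul hft.le]
      apply ENNReal.ofReal_le_ofReal
      rw [hρdef, Real.mul_rpow hS.le (by positivity), ← Real.rpow_mul hft.le]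
      have : f t * f t ^ (-p * (1 - δ)) = f t ^ (p - 1) := by
        rw [← Real.rpow_one_add' hft.le]
        · congr 1; linarith
        · intro h; nlinarith
      rw [← this]
      apply le_of_eq; ring
    · exact ENNReal.ofReal_ne_top
  have far : ∫⁻ s, ENNReal.ofReal (f s) *
      (if ρ < |s - t| then ENNReal.ofReal (|s - t| ^ (-δ)) else 0) ≤
      ENNReal.ofReal (2 * S ^ (1 - δ) * f t ^ (p - 1)) := by
    -- The conjugate exponent `2 / δ` turns the kernel `|s - t|^(-δ)` into `|s - t|^(-2)`, which is
    -- integrable away from the diagonal.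
    have hpq : p.HolderConjugate (2 / δ) := by
      rw [Real.holderConjugate_iff]
      constructor
      · rw [hp, lt_div_iff₀ h2δ]; linarith
      · rw [hp]; field_simp; ring
    have hmF : Measurable fun x : ℝ => if ρ < |x| then ENNReal.ofReal (|x| ^ (-δ)) else 0 :=
      Measurable.ite (measurableSet_lt measurable_const hmabs) hmk measurable_const
    have H := ENNReal.lintegral_mul_le_Lp_mul_Lq volume hpq
      (f := fun s => ENNReal.ofReal (f s))
      (g := fun s => if ρ < |s - t| then ENNReal.ofReal (|s - t| ^ (-δ)) else 0)
      (by fun_prop) ((hmF.comp (measurable_id.sub_const t)).aemeasurable)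
    refine H.trans ?_
    have e1 : ∀ s : ℝ, (if ρ < |s - t| then ENNReal.ofReal (|s - t| ^ (-δ)) else 0) ^ (2 / δ) =
        if ρ < |s - t| then ENNReal.ofReal (|s - t| ^ (-2 : ℝ)) else 0 := by
      intro s
      split_ifs with h
      · rw [ENNReal.ofReal_rpow_of_nonneg (by positivity) (by positivity),
          ← Real.rpow_mul (abs_nonneg _)]
        congr 2
        field_simp
      · exact ENNReal.zero_rpow_of_pos (by positivity)
    simp_rw [e1]
    rw [hfS, lintegral_sub_right_eq_self
        (fun x : ℝ => if ρ < |x| then ENNReal.ofReal (|x| ^ (-2 : ℝ)) else 0) t]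
    calc _ ≤ ENNReal.ofReal S ^ (1 / p) * ENNReal.ofReal (2 / ρ) ^ (1 / (2 / δ)) := by
          gcongr; exact lintegral_rpow_far_le hρ
      _ ≤ _ := by
        rw [ENNReal.ofReal_rpow_of_pos hS, ENNReal.ofReal_rpow_of_pos (by positivity),
          ← ENNReal.ofReal_mul (by positivity)]
        apply ENNReal.ofReal_le_ofReal
        have e2 : 2 / ρ = 2 * (S⁻¹ * f t ^ p) := by
          rw [hρdef, Real.rpow_neg hft.le]; field_simp
        have e3 : (2 : ℝ) ^ (1 / (2 / δ)) ≤ 2 := by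
          calc (2 : ℝ) ^ (1 / (2 / δ)) ≤ 2 ^ (1 : ℝ) := by
                apply Real.rpow_le_rpow_of_exponent_le one_le_two
                rw [one_div_div]; linarith
            _ = 2 := Real.rpow_one 2
        have e4 : S ^ (1 / p) * (S⁻¹) ^ (1 / (2 / δ)) = S ^ (1 - δ) := by
          rw [Real.inv_rpow hS.le, ← Real.rpow_neg hS.le, ← Real.rpow_add hS]
          congr 1
          rw [hp]; field_simp; ring
        have e5 : (f t ^ p) ^ (1 / (2 / δ)) = f t ^ (p - 1) := by
          rw [← Real.rpow_mul hft.le]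
          congr 1
          rw [one_div_div]; linarith
        rw [e2, Real.mul_rpow (by positivity) (by positivity),
          Real.mul_rpow (by positivity) (by positivity), e5]
        calc S ^ (1 / p) * (2 ^ (1 / (2 / δ)) * ((S⁻¹) ^ (1 / (2 / δ)) * f t ^ (p - 1)))
            = 2 ^ (1 / (2 / δ)) * (S ^ (1 / p) * (S⁻¹) ^ (1 / (2 / δ))) * f t ^ (p - 1) := by ring
          _ ≤ 2 * S ^ (1 - δ) * f t ^ (p - 1) := by rw [e4]; gcongr
  have hmF : Measurable fun x : ℝ => if |x| ≤ ρ then ENNReal.ofReal (|x| ^ (-δ)) else 0 :=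
      Measurable.ite (measurableSet_le hmabs measurable_const) hmk measurable_const
  refine (lintegral_mono split).trans ?_
  have hmn : Measurable fun s : ℝ => ENNReal.ofReal (f t) *
      (if |s - t| ≤ ρ then ENNReal.ofReal (|s - t| ^ (-δ)) else 0) :=
    (hmF.comp (measurable_id.sub_const t)).const_mul _
  rw [lintegral_add_left hmn]
  refine (add_le_add near far).trans ?_
  have : 0 < 1 - δ := by linarith
  rw [← ENNReal.ofReal_add (by positivity) (by positivity)]
  apply ENNReal.ofReal_le_ofReal
  apply le_of_eq; ring

/-- The diagonal case of the Hardy–Littlewood–Sobolev inequality on the line. -/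
theorem lintegral_fractional_le {δ : ℝ} (hδ0 : 0 < δ) (hδ1 : δ < 1) {f : ℝ → ℝ}
    (hf : Measurable f) (hfS : ∫⁻ s, ENNReal.ofReal (f s) ^ (2 / (2 - δ)) ≠ ∞) :
    ∫⁻ t, ∫⁻ s, ENNReal.ofReal (f t) * ENNReal.ofReal (f s) * ENNReal.ofReal (|s - t| ^ (-δ)) ≤
      ENNReal.ofReal (2 * (2 / (1 - δ) + 2)) *
        (∫⁻ s, ENNReal.ofReal (f s) ^ (2 / (2 - δ))) ^ (2 - δ) := by
  have h2δ : 0 < 2 - δ := by linarith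
  have h1δ : 0 < 1 - δ := by linarith
  set p := 2 / (2 - δ) with hp
  have hp1 : 1 < p := by rw [hp, lt_div_iff₀ h2δ]; linarith
  set I := ∫⁻ s, ENNReal.ofReal (f s) ^ p with hI
  rcases eq_or_ne I 0 with h0 | h0
  · have hz : ∀ᵐ s, ENNReal.ofReal (f s) = 0 := by
      have := (lintegral_eq_zero_iff (by fun_prop)).1 h0
      filter_upwards [this] with s hs
      exact (ENNReal.rpow_eq_zero_iff_of_pos (by linarith)).1 hs
    refine le_trans (le_of_eq ?_) zero_le
    rw [lintegral_eq_zero_iff' (by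
      apply Measurable.aemeasurable
      apply Measurable.lintegral_prod_right'
        (f := fun q : ℝ × ℝ => ENNReal.ofReal (f q.1) * ENNReal.ofReal (f q.2) *
          ENNReal.ofReal (|q.2 - q.1| ^ (-δ)))
      have : Measurable fun x : ℝ => |x| := measurable_norm
      fun_prop)]
    filter_upwards [hz] with t ht
    simp [ht]
  set S := I.toReal with hS
  have hS0 : 0 < S := ENNReal.toReal_pos h0 hfS
  have hIS : I = ENNReal.ofReal S := (ENNReal.ofReal_toReal hfS).symm
  -- For every pair, one of the two values of `f` is the larger, so by symmetry twice the part with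
  -- `f s ≤ f t` suffices. On it the inner integral is at most a constant times `S^(1-δ)
  -- f(t)^(p-1)`; multiplied by `f(t)` this becomes `f(t)^p`, which integrates to `S`. No maximal
  -- function is needed.
  set G : ℝ → ℝ → ℝ≥0∞ := fun t s =>
    if f s ≤ f t then ENNReal.ofReal (f s) * ENNReal.ofReal (|s - t| ^ (-δ)) else 0 with hG
  have hGm : Measurable (Function.uncurry fun t s => ENNReal.ofReal (f t) * G t s) := by
    have : Measurable fun x : ℝ => |x| := measurable_norm
    apply Measurable.mul (by fun_prop)
    exact Measurable.ite (measurableSet_le (by fun_prop) (by fun_prop)) (by fun_prop)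
      measurable_const
  have half : ∫⁻ t, ∫⁻ s, ENNReal.ofReal (f t) * G t s ≤
      ENNReal.ofReal (2 / (1 - δ) + 2) * I ^ (2 - δ) := by
    have pt : ∀ t, ∫⁻ s, ENNReal.ofReal (f t) * G t s ≤
        ENNReal.ofReal ((2 / (1 - δ) + 2) * S ^ (1 - δ)) * ENNReal.ofReal (f t) ^ p := by
      intro t
      rw [lintegral_const_mul' _ _ ENNReal.ofReal_ne_top]
      rcases le_or_gt (f t) 0 with h | h
      · rw [ENNReal.ofReal_of_nonpos h, zero_mul]; exact zero_le
      · refine (mul_le_mul_right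
          (lintegral_fractional_sublevel_le hδ0 hδ1 hf hS0 hIS h) _).trans ?_
        rw [ENNReal.ofReal_rpow_of_pos h, ← ENNReal.ofReal_mul h.le,
          ← ENNReal.ofReal_mul (by positivity)]
        apply ENNReal.ofReal_le_ofReal
        have : f t * f t ^ (p - 1) = f t ^ p := by
          rw [← Real.rpow_one_add' h.le (by linarith)]; congr 1; ring
        rw [← this, ← hp]
        apply le_of_eq; ring
    refine (lintegral_mono pt).trans ?_
    rw [lintegral_const_mul' _ _ ENNReal.ofReal_ne_top, ← hI, hIS,
      ENNReal.ofReal_rpow_of_pos hS0, ← ENNReal.ofReal_mul (by positivity),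
      ← ENNReal.ofReal_mul (by positivity)]
    apply ENNReal.ofReal_le_ofReal
    have : S ^ (1 - δ) * S = S ^ (2 - δ) := by
      rw [← Real.rpow_add_one hS0.ne']; congr 1; ring
    rw [← this]
    apply le_of_eq; ring
  have cover : ∀ t s, ENNReal.ofReal (f t) * ENNReal.ofReal (f s) *
      ENNReal.ofReal (|s - t| ^ (-δ)) ≤ ENNReal.ofReal (f t) * G t s +
        ENNReal.ofReal (f s) * G s t := by
    intro t s
    rcases le_total (f s) (f t) with h | h
    · refine le_trans (le_of_eq ?_) le_self_add
      simp only [hG, if_pos h, mul_assoc]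
    · refine le_trans (le_of_eq ?_) le_add_self
      simp only [hG, if_pos h, abs_sub_comm t s]
      ring
  calc _ ≤ ∫⁻ t, ∫⁻ s, (ENNReal.ofReal (f t) * G t s + ENNReal.ofReal (f s) * G s t) :=
        lintegral_mono fun t => lintegral_mono fun s => cover t s
    _ = (∫⁻ t, ∫⁻ s, ENNReal.ofReal (f t) * G t s) +
        ∫⁻ t, ∫⁻ s, ENNReal.ofReal (f s) * G s t := by
      have hGi : Measurable fun t => ∫⁻ s, ENNReal.ofReal (f t) * G t s := hGm.lintegral_prod_right'
      rw [← lintegral_add_left hGi]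
      congr 1
      ext t
      exact lintegral_add_left (hGm.comp measurable_prodMk_left) _
    _ = 2 * ∫⁻ t, ∫⁻ s, ENNReal.ofReal (f t) * G t s := by
      rw [two_mul]
      congr 1
      exact lintegral_lintegral_swap (f := fun t s => ENNReal.ofReal (f s) * G s t)
        (hGm.comp measurable_swap).aemeasurable
    _ ≤ 2 * (ENNReal.ofReal (2 / (1 - δ) + 2) * I ^ (2 - δ)) := by gcongr
    _ = _ := by
      rw [← mul_assoc, ENNReal.ofReal_mul zero_le_two]
      simp

/-! ### `TT*` and the dual Strichartz estimate on the characteristic surface -/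

/-- The Fourier transform of a function on space-time, restricted to the characteristic surface. -/
def surfaceTransform (α : ℝ) (Ψ : (ℝ × ℝ) × ℝ → ℂ) (p : ℝ × ℝ) : ℂ :=
  ∫ q : (ℝ × ℝ) × ℝ, Ψ q * planeWave q.1 p *
    Complex.exp (((q.2 * omega α (2 * Real.pi * p.1) (2 * Real.pi * p.2) : ℝ) : ℂ) * Complex.I)

/-- The weight `|ξ|^θ` times the frequency cut-off. -/
def surfaceWeight (N ε θ : ℝ) (p : ℝ × ℝ) : ℝ :=
  Real.exp (θ * Real.log |2 * Real.pi * p.1|) * freqCutoff N ε p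

/-- The `L^(2/(1+θ))` norm of the time slice at `t`. -/
def sliceNorm (θ : ℝ) (Ψ : (ℝ × ℝ) × ℝ → ℂ) (t : ℝ) : ℝ :=
  (∫ z, ‖Ψ (z, t)‖ ^ (2 / (1 + θ))) ^ ((1 + θ) / 2)

theorem sliceNorm_nonneg (θ : ℝ) (Ψ : (ℝ × ℝ) × ℝ → ℂ) (t : ℝ) : 0 ≤ sliceNorm θ Ψ t :=
  Real.rpow_nonneg (integral_nonneg fun _ => Real.rpow_nonneg (norm_nonneg _) _) _

theorem measurable_sliceNorm (θ : ℝ) {Ψ : (ℝ × ℝ) × ℝ → ℂ} (hΨ : Measurable Ψ) :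
    Measurable (sliceNorm θ Ψ) := by
  have h : StronglyMeasurable fun t => ∫ z, ‖Ψ (z, t)‖ ^ (2 / (1 + θ)) := by
    have hm : Measurable fun q : (ℝ × ℝ) × ℝ => ‖Ψ q‖ ^ (2 / (1 + θ)) := by fun_prop
    exact hm.stronglyMeasurable.integral_prod_left'
  unfold sliceNorm
  exact h.measurable.pow_const _

theorem norm_planeTransform_le (a : ℝ × ℝ → ℂ) (p : ℝ × ℝ) :
    ‖planeTransform a p‖ ≤ ∫ z, ‖a z‖ := by
  refine (norm_integral_le_integral_norm _).trans (le_of_eq ?_)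
  simp_rw [norm_mul, norm_planeWave, mul_one]

theorem conj_planeTransform (a : ℝ × ℝ → ℂ) (p : ℝ × ℝ) :
    (starRingEnd ℂ) (planeTransform a p) =
      planeTransform (fun z => (starRingEnd ℂ) (a z)) (-p) := by
  simp only [planeTransform, ← integral_conj, map_mul, planeWave_neg_right]

theorem IsTame.conj {a : ℝ × ℝ → ℂ} (ha : IsTame a) : IsTame fun z => (starRingEnd ℂ) (a z) where
  measurable := Complex.continuous_conj.measurable.comp ha.measurable
  bounded_support := by
    obtain ⟨R, hR⟩ := ha.bounded_support
    exact ⟨R, fun z hz => hR z (by simpa using hz)⟩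
  norm_mem := by
    obtain ⟨l, hl⟩ := ha.norm_mem
    exact ⟨l, fun z hz => by rw [RCLike.norm_conj]; exact hl z (by simpa using hz)⟩

theorem measurable_exp_omega (α : ℝ) : Measurable fun q : (ℝ × ℝ) × ℝ =>
    Complex.exp (((q.2 * omega α (2 * Real.pi * q.1.1) (2 * Real.pi * q.1.2) : ℝ) : ℂ) *
      Complex.I) := by
  have h2 : Measurable fun q : (ℝ × ℝ) × ℝ => omega α (2 * Real.pi * q.1.1) (2 * Real.pi * q.1.2) :=
    (measurable_omega α).comp
      (f := fun q : (ℝ × ℝ) × ℝ => (2 * Real.pi * q.1.1, 2 * Real.pi * q.1.2)) (by fun_prop)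
  fun_prop

theorem surfaceTransform_eq (α : ℝ) {Ψ : (ℝ × ℝ) × ℝ → ℂ} (hΨ : Integrable Ψ) (p : ℝ × ℝ) :
    surfaceTransform α Ψ p = ∫ t, planeTransform (fun z => Ψ (z, t)) p *
      Complex.exp (((t * omega α (2 * Real.pi * p.1) (2 * Real.pi * p.2) : ℝ) : ℂ) *
        Complex.I) := by
  have hI : Integrable fun q : (ℝ × ℝ) × ℝ => Ψ q * planeWave q.1 p *
    Complex.exp (((q.2 * omega α (2 * Real.pi * p.1) (2 * Real.pi * p.2) : ℝ) : ℂ) *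
      Complex.I) := by
    refine hΨ.norm.mono' ((hΨ.1.mul ?_).mul ?_) (Filter.Eventually.of_forall fun q => ?_)
    · exact (continuous_planeWave.comp (by fun_prop : Continuous fun q : (ℝ × ℝ) × ℝ =>
        (q.1, p))).aestronglyMeasurable
    · exact (by fun_prop : Continuous fun q : (ℝ × ℝ) × ℝ => Complex.exp (((q.2 *
        omega α (2 * Real.pi * p.1) (2 * Real.pi * p.2) : ℝ) : ℂ) *
        Complex.I)).aestronglyMeasurable
    · rw [norm_mul, norm_mul, norm_planeWave, Complex.norm_exp_ofReal_mul_I, mul_one, mul_one]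
  rw [Measure.volume_eq_prod] at hI
  rw [surfaceTransform, Measure.volume_eq_prod, integral_prod_symm _ hI]
  congr 1
  ext t
  rw [planeTransform, ← integral_mul_const]

theorem stronglyMeasurable_planeTransform {Ψ : (ℝ × ℝ) × ℝ → ℂ} (hΨ : Measurable Ψ) :
    StronglyMeasurable fun q : (ℝ × ℝ) × ℝ => planeTransform (fun z => Ψ (z, q.2)) q.1 := by
  have hm : Measurable fun r : ((ℝ × ℝ) × ℝ) × (ℝ × ℝ) => Ψ (r.2, r.1.2) * planeWave r.2 r.1.1 := by
    have h1 : Measurable fun r : ((ℝ × ℝ) × ℝ) × (ℝ × ℝ) => Ψ (r.2, r.1.2) :=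
      hΨ.comp (by fun_prop)
    have h2 : Measurable fun r : ((ℝ × ℝ) × ℝ) × (ℝ × ℝ) => planeWave r.2 r.1.1 :=
      continuous_planeWave.measurable.comp
        (by fun_prop : Measurable fun r : ((ℝ × ℝ) × ℝ) × (ℝ × ℝ) => (r.2, r.1.1))
    exact h1.mul h2
  exact hm.stronglyMeasurable.integral_prod_right'

theorem surfaceWeight_nonneg (N ε θ : ℝ) (p : ℝ × ℝ) : 0 ≤ surfaceWeight N ε θ p :=
  mul_nonneg (Real.exp_pos _).le (freqCutoff_nonneg N ε p)

theorem integrable_surfaceWeight {N ε : ℝ} (hN : 1 ≤ N) (hε : 0 < ε) (θ : ℝ) :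
    Integrable (surfaceWeight N ε θ) := by
  refine (integrable_groupSymbol hN hε 0 θ 0).norm.congr (Filter.Eventually.of_forall fun p => ?_)
  simp only [norm_groupSymbol, Complex.ofReal_re, surfaceWeight]

theorem groupSymbol_eq_surfaceWeight (α N ε θ t : ℝ) (p : ℝ × ℝ) :
    groupSymbol α N ε θ t p = surfaceWeight N ε θ p *
      Complex.exp (((t * omega α (2 * Real.pi * p.1) (2 * Real.pi * p.2) : ℝ) : ℂ) *
        Complex.I) := by
  simp only [groupSymbol, surfaceWeight]
  push_cast
  rfl

/-- The `TT*` identity. -/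
theorem integral_surfaceWeight_eq {α N ε θ : ℝ} (hN : 1 ≤ N) (hε : 0 < ε)
    {Ψ : (ℝ × ℝ) × ℝ → ℂ} (hΨm : Measurable Ψ) (hΨ : Integrable Ψ) :
    Integrable (fun p => surfaceWeight N ε θ p * ‖surfaceTransform α Ψ p‖ ^ 2) ∧
    ((∫ p, surfaceWeight N ε θ p * ‖surfaceTransform α Ψ p‖ ^ 2 : ℝ) : ℂ) =
      ∫ s : ℝ × ℝ, planeForm (groupSymbol α N ε θ (s.1 - s.2)) (fun z => Ψ (z, s.1))
        (fun z => (starRingEnd ℂ) (Ψ (z, s.2))) := by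
  set E : (ℝ × ℝ) → ℝ → ℂ := fun p t => planeTransform (fun z => Ψ (z, t)) p *
      Complex.exp (((t * omega α (2 * Real.pi * p.1) (2 * Real.pi * p.2) : ℝ) : ℂ) * Complex.I)
    with hE
  have hEm : StronglyMeasurable (Function.uncurry E) :=
    (stronglyMeasurable_planeTransform hΨm).mul (measurable_exp_omega α).stronglyMeasurable
  set A : ℝ → ℝ := fun t => ∫ z, ‖Ψ (z, t)‖
  have hA : Integrable A := by
    rw [Measure.volume_eq_prod] at hΨ
    exact hΨ.norm.integral_prod_right
  have hEA : ∀ p t, ‖E p t‖ ≤ A t := by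
    intro p t
    rw [hE]
    simp only [norm_mul, Complex.norm_exp_ofReal_mul_I, mul_one]
    exact norm_planeTransform_le _ _
  have hw := integrable_surfaceWeight hN hε θ
  -- The square `|∫ E p t dt|²` is expanded into a double integral over times. The two exponentials
  -- combine into the symbol of the group at time `s.1 - s.2`.
  set H : (ℝ × ℝ) → (ℝ × ℝ) → ℂ := fun p s =>
    (surfaceWeight N ε θ p : ℂ) * (E p s.1 * (starRingEnd ℂ) (E p s.2)) with hH
  have hHm : AEStronglyMeasurable (Function.uncurry H) (volume.prod volume) := by
    apply AEStronglyMeasurable.mul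
    · exact (Complex.continuous_ofReal.comp_aestronglyMeasurable hw.1).comp_fst
    · apply StronglyMeasurable.aestronglyMeasurable
      apply StronglyMeasurable.mul
      · exact hEm.comp_measurable
          (by fun_prop : Measurable fun x : (ℝ × ℝ) × (ℝ × ℝ) => (x.1, x.2.1))
      · exact Complex.continuous_conj.comp_stronglyMeasurable (hEm.comp_measurable
          (by fun_prop : Measurable fun x : (ℝ × ℝ) × (ℝ × ℝ) => (x.1, x.2.2)))
  have hHi : Integrable (Function.uncurry H) (volume.prod volume) := by
    refine (hw.mul_prod (hA.mul_prod hA)).mono' hHm (Filter.Eventually.of_forall fun x => ?_)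
    simp only [Function.uncurry, hH, norm_mul, RCLike.norm_conj, Complex.norm_real,
      Real.norm_of_nonneg (surfaceWeight_nonneg N ε θ x.1)]
    have := surfaceWeight_nonneg N ε θ x.1
    gcongr
    · exact hEA _ _
    · exact hEA _ _
  have hsq : ∀ p, ((surfaceWeight N ε θ p * ‖surfaceTransform α Ψ p‖ ^ 2 : ℝ) : ℂ) =
      ∫ s, H p s := by
    intro p
    simp only [hH]
    rw [integral_const_mul, Measure.volume_eq_prod, integral_prod_mul (E p)
      (fun s => (starRingEnd ℂ) (E p s)), integral_conj, ← surfaceTransform_eq α hΨ,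
      Complex.mul_conj, Complex.normSq_eq_norm_sq]
    push_cast
    rfl
  constructor
  · have := hHi.integral_prod_left
    have h2 := this.re
    refine h2.congr (Filter.Eventually.of_forall fun p => ?_)
    change RCLike.re (∫ s, H p s) = _
    rw [← hsq p]
    exact Complex.ofReal_re _
  · rw [← integral_complex_ofReal]
    simp_rw [hsq]
    rw [integral_integral_swap hHi]
    congr 1
    ext s
    rw [planeForm]
    congr 1
    ext p
    rw [groupSymbol_eq_surfaceWeight, ← conj_planeTransform]
    simp only [hH, hE, map_mul, ← Complex.exp_conj, Complex.conj_ofReal, Complex.conj_I]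
    have : Complex.exp ((((s.1 - s.2) * omega α (2 * Real.pi * p.1) (2 * Real.pi * p.2) : ℝ) : ℂ) *
        Complex.I) = Complex.exp (((s.1 * omega α (2 * Real.pi * p.1) (2 * Real.pi * p.2) : ℝ) : ℂ) *
        Complex.I) * Complex.exp (((s.2 * omega α (2 * Real.pi * p.1) (2 * Real.pi * p.2) : ℝ) : ℂ) *
        -Complex.I) := by
      rw [← Complex.exp_add]
      congr 1
      push_cast
      ring
    rw [this]
    ring

theorem planeForm_zero_left (m b : ℝ × ℝ → ℂ) : planeForm m (fun _ => 0) b = 0 := by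
  simp [planeForm, planeTransform]

theorem planeForm_zero_right (m a : ℝ × ℝ → ℂ) : planeForm m a (fun _ => 0) = 0 := by
  simp [planeForm, planeTransform]

/-- The dual Strichartz estimate. -/
theorem lintegral_surfaceTransform_le {α N ε θ : ℝ} (hN : 1 ≤ N) (hε : 0 < ε) (hθ0 : 0 < θ)
    (hθ1 : θ < 1) {Ψ : (ℝ × ℝ) × ℝ → ℂ} (hΨm : Measurable Ψ) (hΨ : Integrable Ψ)
    (hΨt : ∀ t, IsTame fun z => Ψ (z, t)) (hΨ1 : ∀ z t, 1 < |t| → Ψ (z, t) = 0) :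
    ∫⁻ p, ENNReal.ofReal (surfaceWeight N ε θ p * ‖surfaceTransform α Ψ p‖ ^ 2) ≤
      ENNReal.ofReal (dispersiveConst α * (2 * (2 / (1 - θ) + 2))) *
        (∫⁻ t, ENNReal.ofReal (sliceNorm θ Ψ t) ^ (2 / (2 - θ))) ^ (2 - θ) := by
  have h1 : 0 < 1 - θ := by linarith
  have h2 : 0 < 2 - θ := by linarith
  have hK := one_le_dispersiveConst α
  obtain ⟨hi, he⟩ := integral_surfaceWeight_eq (α := α) (θ := θ) hN hε hΨm hΨ
  by_cases hfin : ∫⁻ t, ENNReal.ofReal (sliceNorm θ Ψ t) ^ (2 / (2 - θ)) = ∞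
  · rw [hfin, ENNReal.top_rpow_of_pos h2, ENNReal.mul_top]
    · exact le_top
    · exact (ENNReal.ofReal_pos.2 (by positivity)).ne'
  have hnn : ∀ p, 0 ≤ surfaceWeight N ε θ p * ‖surfaceTransform α Ψ p‖ ^ 2 := fun p =>
    mul_nonneg (surfaceWeight_nonneg N ε θ p) (sq_nonneg _)
  rw [← ofReal_integral_eq_lintegral_ofReal hi (Filter.Eventually.of_forall hnn)]
  have hnorm : ENNReal.ofReal (∫ p, surfaceWeight N ε θ p * ‖surfaceTransform α Ψ p‖ ^ 2) =
      ‖∫ s : ℝ × ℝ, planeForm (groupSymbol α N ε θ (s.1 - s.2)) (fun z => Ψ (z, s.1))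
        (fun z => (starRingEnd ℂ) (Ψ (z, s.2)))‖ₑ := by
    rw [← he, ← ofReal_norm, Complex.norm_real, Real.norm_of_nonneg (integral_nonneg hnn)]
  rw [hnorm]
  set f := sliceNorm θ Ψ with hf
  have hfm : Measurable f := measurable_sliceNorm θ hΨm
  have hpt : ∀ t s : ℝ, s ≠ t → ‖planeForm (groupSymbol α N ε θ (t - s)) (fun z => Ψ (z, t))
        (fun z => (starRingEnd ℂ) (Ψ (z, s)))‖ₑ ≤ ENNReal.ofReal (dispersiveConst α) *
        (ENNReal.ofReal (f t) * ENNReal.ofReal (f s) * ENNReal.ofReal (|s - t| ^ (-θ))) := by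
    intro t s hst
    by_cases ht : 1 < |t|
    · have : (fun z => Ψ (z, t)) = fun _ => 0 := funext fun z => hΨ1 z t ht
      rw [this, planeForm_zero_left]
      simp
    by_cases hs : 1 < |s|
    · have : (fun z => (starRingEnd ℂ) (Ψ (z, s))) = fun _ => 0 :=
        funext fun z => by rw [hΨ1 z s hs, map_zero]
      rw [this, planeForm_zero_right]
      simp
    -- The support in `|t| ≤ 1` enters here, the dispersive estimate being confined to times at most
    -- `2`.
    have hts : |t - s| ≤ 2 := by
      have := abs_sub t s
      push Not at ht hs
      linarith
    have key := norm_planeForm_groupSymbol_le (α := α) hN hε hθ0.le hθ1.le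
      (sub_ne_zero.2 hst.symm) hts (hΨt t) (hΨt s).conj
    simp_rw [RCLike.norm_conj] at key
    rw [← ENNReal.ofReal_mul (sliceNorm_nonneg _ _ _), ← ENNReal.ofReal_mul
      (mul_nonneg (sliceNorm_nonneg _ _ _) (sliceNorm_nonneg _ _ _)),
      ← ENNReal.ofReal_mul (by linarith), ← ofReal_norm]
    apply ENNReal.ofReal_le_ofReal
    refine key.trans (le_of_eq ?_)
    rw [abs_sub_comm s t, sliceNorm, sliceNorm]
    ring
  have hFm : Measurable (Function.uncurry fun t s : ℝ => ENNReal.ofReal (dispersiveConst α) *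
      (ENNReal.ofReal (f t) * ENNReal.ofReal (f s) * ENNReal.ofReal (|s - t| ^ (-θ)))) := by
    have : Measurable fun x : ℝ => |x| := measurable_norm
    fun_prop
  refine (enorm_integral_le_lintegral_enorm _).trans ?_
  refine le_trans (lintegral_mono_ae (g := Function.uncurry fun t s : ℝ =>
      ENNReal.ofReal (dispersiveConst α) *
      (ENNReal.ofReal (f t) * ENNReal.ofReal (f s) * ENNReal.ofReal (|s - t| ^ (-θ)))) ?_) ?_
  · have hd : ∀ᵐ x : ℝ × ℝ, x.2 ≠ x.1 := by
      rw [Measure.volume_eq_prod, Measure.ae_prod_iff_ae_ae]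
      · exact Filter.Eventually.of_forall fun t => Measure.ae_ne volume t
      · exact (measurableSet_eq_fun measurable_snd measurable_fst).compl
    filter_upwards [hd] with x hx
    exact hpt x.1 x.2 hx
  · rw [Measure.volume_eq_prod, lintegral_prod _ hFm.aemeasurable]
    simp only [Function.uncurry]
    simp_rw [lintegral_const_mul' _ _ ENNReal.ofReal_ne_top]
    rw [ENNReal.ofReal_mul (by linarith), mul_assoc]
    gcongr
    exact lintegral_fractional_le hθ0 hθ1 hfm hfin

/-! ### Duality for the mixed norm -/

/-- The part of the support of `v` on which test functions live. -/
def testSet (v : (ℝ × ℝ) × ℝ → ℂ) (k : ℝ) : Set ((ℝ × ℝ) × ℝ) :=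
  {q | ‖q.1‖ ≤ k ∧ |q.2| ≤ 1 ∧ k⁻¹ ≤ ‖v q‖}

/-- `‖v‖ ^ r` restricted to `testSet`. -/
def testDensity (v : (ℝ × ℝ) × ℝ → ℂ) (k r : ℝ) : (ℝ × ℝ) × ℝ → ℝ :=
  (testSet v k).indicator fun q => ‖v q‖ ^ r

/-- The integral of `testDensity` over the time slice. -/
def testMass (v : (ℝ × ℝ) × ℝ → ℂ) (k r t : ℝ) : ℝ := ∫ z, testDensity v k r (z, t)

/-- The test function that norms `v` in the mixed norm. -/
def testFun (v : (ℝ × ℝ) × ℝ → ℂ) (k r ρ : ℝ) : (ℝ × ℝ) × ℝ → ℂ :=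
  (testSet v k).indicator fun q =>
    ((testMass v k r q.2 ^ (ρ - 1) * ‖v q‖ ^ (r - 2) : ℝ) : ℂ) * (starRingEnd ℂ) (v q)

section TestFunctions

variable {v : (ℝ × ℝ) × ℝ → ℂ} {k r V ρ : ℝ}

theorem measurableSet_testSet (hv : Measurable v) (k : ℝ) : MeasurableSet (testSet v k) := by
  have h1 : Measurable fun q : (ℝ × ℝ) × ℝ => ‖q.1‖ := by fun_prop
  have h2 : Measurable fun q : (ℝ × ℝ) × ℝ => |q.2| :=
    (measurable_norm : Measurable fun x : ℝ => |x|).comp measurable_snd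
  exact (measurableSet_le h1 measurable_const).inter
    ((measurableSet_le h2 measurable_const).inter (measurableSet_le measurable_const hv.norm))

theorem measurable_testDensity (hv : Measurable v) (k r : ℝ) :
    Measurable (testDensity v k r) :=
  Measurable.indicator (by fun_prop) (measurableSet_testSet hv k)

theorem testDensity_nonneg (q : (ℝ × ℝ) × ℝ) : 0 ≤ testDensity v k r q :=
  Set.indicator_nonneg (fun _ _ => Real.rpow_nonneg (norm_nonneg _) _) _

theorem testDensity_le (hr : 0 ≤ r) (hV : ∀ q, ‖v q‖ ≤ V) (q : (ℝ × ℝ) × ℝ) :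
    testDensity v k r q ≤ (Metric.closedBall (0 : ℝ × ℝ) k).indicator (fun _ => V ^ r) q.1 := by
  by_cases h : q ∈ testSet v k
  · have h1 : q.1 ∈ Metric.closedBall (0 : ℝ × ℝ) k := by simpa using h.1
    rw [testDensity, Set.indicator_of_mem h, Set.indicator_of_mem h1]
    exact Real.rpow_le_rpow (norm_nonneg _) (hV q) hr
  · rw [testDensity, Set.indicator_of_notMem h]
    have : 0 ≤ V := (norm_nonneg _).trans (hV q)
    exact Set.indicator_nonneg (fun _ _ => by positivity) _

theorem integrable_ball_const (k V : ℝ) :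
    Integrable ((Metric.closedBall (0 : ℝ × ℝ) k).indicator fun _ => V) :=
  (integrable_indicator_iff measurableSet_closedBall).2
    (integrableOn_const (isCompact_closedBall _ _).measure_lt_top.ne)

theorem integrable_testDensity (hv : Measurable v) (hr : 0 ≤ r) (hV : ∀ q, ‖v q‖ ≤ V) (t : ℝ) :
    Integrable fun z => testDensity v k r (z, t) := by
  refine (integrable_ball_const k (V ^ r)).mono'
    ((measurable_testDensity hv k r).comp (by fun_prop)).aestronglyMeasurable
    (Filter.Eventually.of_forall fun z => ?_)
  rw [Real.norm_of_nonneg (testDensity_nonneg _)]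
  exact testDensity_le hr hV (z, t)

theorem testMass_nonneg (t : ℝ) : 0 ≤ testMass v k r t :=
  integral_nonneg fun _ => testDensity_nonneg _

theorem testMass_eq_zero {t : ℝ} (ht : 1 < |t|) : testMass v k r t = 0 := by
  have : ∀ z, testDensity v k r (z, t) = 0 := fun z =>
    Set.indicator_of_notMem (fun h => absurd h.2.1 (not_le.2 ht)) _
  simp [testMass, this]

theorem measurable_testMass (hv : Measurable v) (k r : ℝ) : Measurable (testMass v k r) :=
  ((measurable_testDensity hv k r).stronglyMeasurable.integral_prod_left').measurable

theorem testMass_le (hv : Measurable v) (hr : 0 ≤ r) (hV : ∀ q, ‖v q‖ ≤ V) (t : ℝ) :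
    testMass v k r t ≤ ∫ z, (Metric.closedBall (0 : ℝ × ℝ) k).indicator (fun _ => V ^ r) z :=
  integral_mono (integrable_testDensity hv hr hV t) (integrable_ball_const k (V ^ r))
    fun z => testDensity_le hr hV (z, t)

theorem norm_pos_of_mem_testSet (hk : 0 < k) {q : (ℝ × ℝ) × ℝ} (h : q ∈ testSet v k) :
    0 < ‖v q‖ := (inv_pos.2 hk).trans_le h.2.2

theorem norm_testFun (hk : 0 < k) {q : (ℝ × ℝ) × ℝ} (h : q ∈ testSet v k) :
    ‖testFun v k r ρ q‖ = testMass v k r q.2 ^ (ρ - 1) * ‖v q‖ ^ (r - 1) := by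
  have hq := norm_pos_of_mem_testSet hk h
  rw [testFun, Set.indicator_of_mem h, norm_mul, RCLike.norm_conj, Complex.norm_real,
    Real.norm_of_nonneg (mul_nonneg (Real.rpow_nonneg (testMass_nonneg _) _)
      (Real.rpow_nonneg (norm_nonneg _) _)), mul_assoc, ← Real.rpow_add_one hq.ne']
  congr 2
  ring

theorem mul_testFun (hk : 0 < k) (q : (ℝ × ℝ) × ℝ) :
    v q * testFun v k r ρ q = ((testMass v k r q.2 ^ (ρ - 1) * testDensity v k r q : ℝ) : ℂ) := by
  by_cases h : q ∈ testSet v k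
  · have hq := norm_pos_of_mem_testSet hk h
    rw [testFun, testDensity, Set.indicator_of_mem h, Set.indicator_of_mem h, mul_left_comm,
      Complex.mul_conj, Complex.normSq_eq_norm_sq, ← Complex.ofReal_mul, mul_assoc,
      ← Real.rpow_natCast, ← Real.rpow_add hq]
    norm_num
  · rw [testFun, testDensity, Set.indicator_of_notMem h, Set.indicator_of_notMem h]
    simp

theorem norm_testFun_rpow (hk : 0 < k) {r' : ℝ} (hr' : 0 < r') (hrr : (r - 1) * r' = r)
    (q : (ℝ × ℝ) × ℝ) : ‖testFun v k r ρ q‖ ^ r' =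
      (testMass v k r q.2 ^ (ρ - 1)) ^ r' * testDensity v k r q := by
  by_cases h : q ∈ testSet v k
  · rw [norm_testFun hk h, Real.mul_rpow (Real.rpow_nonneg (testMass_nonneg _) _)
      (Real.rpow_nonneg (norm_nonneg _) _), ← Real.rpow_mul (norm_nonneg _), hrr, testDensity,
      Set.indicator_of_mem h]
  · rw [testFun, testDensity, Set.indicator_of_notMem h, Set.indicator_of_notMem h, norm_zero,
      Real.zero_rpow hr'.ne', mul_zero]

/-- On the test set `1 ≤ k ‖v‖`, so raising the exponent of `‖v‖` from `r - 1` to `r` costs a factor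
`k`. This serves only to prove integrability and leaves no trace in the final constant. -/
theorem norm_testFun_le (hk : 0 < k) (q : (ℝ × ℝ) × ℝ) :
    ‖testFun v k r ρ q‖ ≤ k * (testMass v k r q.2 ^ (ρ - 1) * testDensity v k r q) := by
  by_cases h : q ∈ testSet v k
  · have hq := norm_pos_of_mem_testSet hk h
    rw [norm_testFun hk h, testDensity, Set.indicator_of_mem h]
    have e : ‖v q‖ ^ r = ‖v q‖ ^ (r - 1) * ‖v q‖ := by
      rw [← Real.rpow_add_one hq.ne']; congr 1; ring
    have h1 : 1 ≤ k * ‖v q‖ := by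
      have := h.2.2
      rwa [inv_le_iff_one_le_mul₀' hk] at this
    have h2 : 0 ≤ testMass v k r q.2 ^ (ρ - 1) * ‖v q‖ ^ (r - 1) :=
      mul_nonneg (Real.rpow_nonneg (testMass_nonneg _) _) (Real.rpow_nonneg (norm_nonneg _) _)
    rw [e]
    calc _ ≤ (testMass v k r q.2 ^ (ρ - 1) * ‖v q‖ ^ (r - 1)) * (k * ‖v q‖) :=
          le_mul_of_one_le_right h2 h1
      _ = _ := by ring
  · rw [testFun, testDensity, Set.indicator_of_notMem h, Set.indicator_of_notMem h]
    simp

theorem measurable_testFun (hv : Measurable v) (k r ρ : ℝ) : Measurable (testFun v k r ρ) := by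
  apply Measurable.indicator _ (measurableSet_testSet hv k)
  have h1 : Measurable fun q : (ℝ × ℝ) × ℝ => testMass v k r q.2 :=
    (measurable_testMass hv k r).comp measurable_snd
  have h2 : Measurable fun q => (starRingEnd ℂ) (v q) := Complex.continuous_conj.measurable.comp hv
  fun_prop

theorem integral_testDensity_mul (hρ : 0 < ρ) (t : ℝ) :
    ∫ z, testMass v k r t ^ (ρ - 1) * testDensity v k r (z, t) = testMass v k r t ^ ρ := by
  rw [integral_const_mul, ← testMass]
  rcases eq_or_lt_of_le (testMass_nonneg (v := v) (k := k) (r := r) t) with h | h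
  · rw [← h, mul_zero, Real.zero_rpow hρ.ne']
  · rw [← Real.rpow_add_one h.ne']; congr 1; ring

theorem integrable_testMass_rpow (hv : Measurable v) (hr : 0 ≤ r) (hV : ∀ q, ‖v q‖ ≤ V)
    (hρ : 0 < ρ) : Integrable fun t => testMass v k r t ^ ρ := by
  set B := ∫ z, (Metric.closedBall (0 : ℝ × ℝ) k).indicator (fun _ => V ^ r) z
  have hc : Integrable ((Set.Icc (-1 : ℝ) 1).indicator fun _ => B ^ ρ) :=
    (integrable_indicator_iff measurableSet_Icc).2 (integrableOn_const (by simp))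
  refine hc.mono' ((measurable_testMass hv k r).pow_const ρ).aestronglyMeasurable
    (Filter.Eventually.of_forall fun t => ?_)
  rw [Real.norm_of_nonneg (Real.rpow_nonneg (testMass_nonneg _) _)]
  by_cases h : t ∈ Set.Icc (-1 : ℝ) 1
  · rw [Set.indicator_of_mem h]
    exact Real.rpow_le_rpow (testMass_nonneg _) (testMass_le hv hr hV t) hρ.le
  · rw [Set.indicator_of_notMem h, testMass_eq_zero, Real.zero_rpow hρ.ne']
    rw [Set.mem_Icc, ← abs_le] at h
    exact not_le.1 h

theorem integrable_testMass_mul_testDensity (hv : Measurable v) (hr : 0 ≤ r)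
    (hV : ∀ q, ‖v q‖ ≤ V) (hρ : 0 < ρ) :
    Integrable fun q : (ℝ × ℝ) × ℝ => testMass v k r q.2 ^ (ρ - 1) * testDensity v k r q := by
  have hm : Measurable fun q : (ℝ × ℝ) × ℝ =>
      testMass v k r q.2 ^ (ρ - 1) * testDensity v k r q :=
    (((measurable_testMass hv k r).comp measurable_snd).pow_const _).mul
      (measurable_testDensity hv k r)
  rw [Measure.volume_eq_prod, integrable_prod_iff' hm.aestronglyMeasurable]
  constructor
  · exact Filter.Eventually.of_forall fun t =>
      (integrable_testDensity hv hr hV t).const_mul (testMass v k r t ^ (ρ - 1))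
  · refine (integrable_testMass_rpow (k := k) hv hr hV hρ).congr
      (Filter.Eventually.of_forall fun t => ?_)
    simp only
    rw [← integral_testDensity_mul hρ]
    congr 1
    ext z
    rw [Real.norm_of_nonneg]
    exact mul_nonneg (Real.rpow_nonneg (testMass_nonneg _) _) (testDensity_nonneg _)

theorem integrable_testFun (hv : Measurable v) (hk : 0 < k) (hr : 0 ≤ r) (hV : ∀ q, ‖v q‖ ≤ V)
    (hρ : 0 < ρ) : Integrable (testFun v k r ρ) :=
  ((integrable_testMass_mul_testDensity hv hr hV hρ).const_mul k).mono'
    (measurable_testFun hv k r ρ).aestronglyMeasurable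
    (Filter.Eventually.of_forall fun q => norm_testFun_le hk q)

theorem integral_mul_testFun (hv : Measurable v) (hk : 0 < k) (hr : 0 ≤ r) (hV : ∀ q, ‖v q‖ ≤ V)
    (hρ : 0 < ρ) : ∫ q, v q * testFun v k r ρ q = ((∫ t, testMass v k r t ^ ρ : ℝ) : ℂ) := by
  simp_rw [mul_testFun hk]
  rw [integral_complex_ofReal]
  congr 1
  have := integrable_testMass_mul_testDensity (k := k) hv hr hV hρ
  rw [Measure.volume_eq_prod] at this
  rw [Measure.volume_eq_prod, integral_prod_symm _ this]
  simp_rw [integral_testDensity_mul hρ]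

/-- The bounds `k⁻¹ ≤ ‖v‖ ≤ V` on the test set keep `log ‖v‖` bounded, and at fixed `t` the factor
depending on the mass is a constant. -/
theorem isTame_testFun (hv : Measurable v) (hk : 0 < k) (hr : 1 ≤ r) (hV : ∀ q, ‖v q‖ ≤ V)
    (ρ t : ℝ) : IsTame fun z => testFun v k r ρ (z, t) where
  measurable := (measurable_testFun hv k r ρ).comp (by fun_prop)
  bounded_support := ⟨k, fun z hz => by
    have h : (z, t) ∈ testSet v k := Set.mem_of_indicator_ne_zero hz
    exact h.1⟩
  norm_mem := by
    refine ⟨|(Real.log (testMass v k r t ^ (ρ - 1)))| + (r - 1) * (|Real.log k| + |Real.log V|),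
      fun z hz => ?_⟩
    have h : (z, t) ∈ testSet v k := Set.mem_of_indicator_ne_zero hz
    have hq := norm_pos_of_mem_testSet hk h
    have hn : ‖testFun v k r ρ (z, t)‖ ≠ 0 := norm_ne_zero_iff.2 hz
    rw [norm_testFun hk h] at hn ⊢
    rw [Real.log_mul (left_ne_zero_of_mul hn) (right_ne_zero_of_mul hn), Real.log_rpow hq]
    refine (abs_add_le _ _).trans (add_le_add le_rfl ?_)
    rw [abs_mul, abs_of_nonneg (by linarith : 0 ≤ r - 1)]
    apply mul_le_mul_of_nonneg_left _ (by linarith : 0 ≤ r - 1)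
    have h1 : Real.log ‖v (z, t)‖ ≤ Real.log V := Real.log_le_log hq (hV _)
    have h2 : -Real.log k ≤ Real.log ‖v (z, t)‖ := by
      rw [← Real.log_inv]; exact Real.log_le_log (inv_pos.2 hk) h.2.2
    rw [abs_le]
    constructor
    · linarith [le_abs_self (Real.log k), abs_nonneg (Real.log V)]
    · linarith [le_abs_self (Real.log V), abs_nonneg (Real.log k)]

end TestFunctions

/-- The equality case of Hölder. With `r = 2 / (1 - θ)` and `q = 2 / θ`, the dual exponents are `2 /
(1 + θ)` and `2 / (2 - θ)`, and `(1 - θ) / θ = q / r`. The dual norm raised to `q'` and the pairing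
with `v` are thus the same integral of the mass. -/
theorem sliceNorm_testFun {v : (ℝ × ℝ) × ℝ → ℂ} {k θ : ℝ} (hk : 0 < k) (hθ0 : 0 < θ)
    (hθ1 : θ < 1) (t : ℝ) :
    sliceNorm θ (testFun v k (2 / (1 - θ)) ((1 - θ) / θ)) t ^ (2 / (2 - θ)) =
      testMass v k (2 / (1 - θ)) t ^ ((1 - θ) / θ) := by
  have h1 : 0 < 1 - θ := by linarith
  have h2 : 0 < 2 - θ := by linarith
  have h3 : 0 < 1 + θ := by linarith
  have hrr : (2 / (1 - θ) - 1) * (2 / (1 + θ)) = 2 / (1 - θ) := by field_simp; ring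
  rw [sliceNorm]
  simp_rw [norm_testFun_rpow hk (show 0 < 2 / (1 + θ) by positivity) hrr]
  rw [integral_const_mul, ← testMass]
  set n := testMass v k (2 / (1 - θ)) t
  have hn : 0 ≤ n := testMass_nonneg t
  rcases eq_or_lt_of_le hn with h | h
  · rw [← h, mul_zero, Real.zero_rpow (by positivity), Real.zero_rpow (by positivity),
      Real.zero_rpow (by positivity)]
  · rw [← Real.rpow_mul hn, ← Real.rpow_add_one h.ne', ← Real.rpow_mul hn, ← Real.rpow_mul hn]
    congr 1
    field_simp
    ring

theorem ofReal_testMass {v : (ℝ × ℝ) × ℝ → ℂ} (hv : Measurable v) {k r V : ℝ} (hr : 0 < r)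
    (hV : ∀ q, ‖v q‖ ≤ V) (t : ℝ) :
    ENNReal.ofReal (testMass v k r t) =
      ∫⁻ z, (testSet v k).indicator (fun q => ‖v q‖ₑ ^ r) (z, t) := by
  rw [testMass, ofReal_integral_eq_lintegral_ofReal (integrable_testDensity hv hr.le hV t)
    (Filter.Eventually.of_forall fun z => testDensity_nonneg _)]
  congr 1
  ext z
  by_cases h : (z, t) ∈ testSet v k
  · rw [testDensity, Set.indicator_of_mem h, Set.indicator_of_mem h, ← ofReal_norm,
      ENNReal.ofReal_rpow_of_nonneg (norm_nonneg _) hr.le]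
  · rw [testDensity, Set.indicator_of_notMem h, Set.indicator_of_notMem h, ENNReal.ofReal_zero]

theorem testSet_mono {v : (ℝ × ℝ) × ℝ → ℂ} {k k' : ℝ} (hk : 0 < k) (h : k ≤ k') :
    testSet v k ⊆ testSet v k' := fun _ hq =>
  ⟨hq.1.trans h, hq.2.1, (inv_anti₀ hk h).trans hq.2.2⟩

theorem exists_mem_testSet {v : (ℝ × ℝ) × ℝ → ℂ} {q : (ℝ × ℝ) × ℝ} (ht : |q.2| ≤ 1)
    (hq : v q ≠ 0) : ∃ n : ℕ, q ∈ testSet v (n + 1 : ℝ) := by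
  have hq' := norm_pos_iff.2 hq
  obtain ⟨n, hn⟩ := exists_nat_ge (max ‖q.1‖ ‖v q‖⁻¹)
  refine ⟨n, ?_, ht, ?_⟩
  · linarith [(le_max_left _ _).trans hn]
  · rw [inv_le_comm₀ (by positivity) hq']
    linarith [(le_max_right _ _).trans hn]

/-- Duality for the mixed norm: testing against tame functions is enough. -/
theorem lintegral_mixed_le_of_test {v : (ℝ × ℝ) × ℝ → ℂ} (hv : Measurable v) {V θ : ℝ}
    (hV : ∀ q, ‖v q‖ ≤ V) (hθ0 : 0 < θ) (hθ1 : θ < 1) {M : ℝ≥0∞}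
    (H : ∀ Ψ : (ℝ × ℝ) × ℝ → ℂ, Measurable Ψ → Integrable Ψ → (∀ t, IsTame fun z => Ψ (z, t)) →
      (∀ z t, 1 < |t| → Ψ (z, t) = 0) → ‖∫ q, v q * Ψ q‖ₑ ≤
        M * (∫⁻ t, ENNReal.ofReal (sliceNorm θ Ψ t) ^ (2 / (2 - θ))) ^ ((2 - θ) / 2)) :
    ∫⁻ t in Set.Icc (-1 : ℝ) 1, (∫⁻ z, ‖v (z, t)‖ₑ ^ (2 / (1 - θ))) ^ ((1 - θ) / θ) ≤
      M ^ (2 / θ) := by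
  have h1 : 0 < 1 - θ := by linarith
  have h2 : 0 < 2 - θ := by linarith
  set r := 2 / (1 - θ) with hr
  set ρ := (1 - θ) / θ with hρ
  have hr0 : 0 < r := by positivity
  have hr1 : 1 ≤ r := by rw [hr, le_div_iff₀ h1]; linarith
  have hρ0 : 0 < ρ := by positivity
  have step : ∀ n : ℕ, ∫⁻ t, ENNReal.ofReal (testMass v (n + 1) r t ^ ρ) ≤ M ^ (2 / θ) := by
    intro n
    have hk : (0 : ℝ) < n + 1 := by positivity
    have hi := integrable_testMass_rpow (k := n + 1) hv hr0.le hV hρ0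
    have key := H (testFun v (n + 1) r ρ) (measurable_testFun hv _ _ _)
      (integrable_testFun hv hk hr0.le hV hρ0) (isTame_testFun hv hk hr1 hV ρ)
      (fun z t ht => Set.indicator_of_notMem (fun h => absurd h.2.1 (not_le.2 ht)) _)
    have e1 : ∀ t, ENNReal.ofReal (sliceNorm θ (testFun v (n + 1) r ρ) t) ^ (2 / (2 - θ)) =
        ENNReal.ofReal (testMass v (n + 1) r t ^ ρ) := by
      intro t
      rw [ENNReal.ofReal_rpow_of_nonneg (sliceNorm_nonneg _ _ _) (by positivity),
        sliceNorm_testFun hk hθ0 hθ1]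
    simp_rw [e1] at key
    have hnn : 0 ≤ ∫ t, testMass v (n + 1) r t ^ ρ :=
      integral_nonneg fun t => Real.rpow_nonneg (testMass_nonneg t) _
    rw [integral_mul_testFun hv hk hr0.le hV hρ0, ← ofReal_norm, Complex.norm_real,
      Real.norm_of_nonneg hnn,
      ofReal_integral_eq_lintegral_ofReal hi (Filter.Eventually.of_forall fun t =>
        Real.rpow_nonneg (testMass_nonneg t) _)] at key
    set X := ∫⁻ t, ENNReal.ofReal (testMass v (n + 1) r t ^ ρ) with hX
    have hXtop : X ≠ ∞ := by
      rw [hX, ← ofReal_integral_eq_lintegral_ofReal hi (Filter.Eventually.of_forall fun t =>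
        Real.rpow_nonneg (testMass_nonneg t) _)]
      exact ENNReal.ofReal_ne_top
    rcases eq_or_ne X 0 with h0 | h0
    · rw [h0]; exact zero_le
    -- The hypothesis reads `X ≤ M X^(1 - θ/2)`. The truncation makes `X` finite, which permits the
    -- division.
    have hY : X ^ (θ / 2) ≤ M := by
      have e : X = X ^ (θ / 2) * X ^ ((2 - θ) / 2) := by
        rw [← ENNReal.rpow_add _ _ h0 hXtop]
        conv_lhs => rw [← ENNReal.rpow_one X]
        congr 1; ring
      rw [e] at key
      have hp0 : X ^ ((2 - θ) / 2) ≠ 0 := by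
        simp [ENNReal.rpow_eq_zero_iff, h0, hXtop]
      have hpt : X ^ ((2 - θ) / 2) ≠ ∞ := ENNReal.rpow_ne_top_of_nonneg (by positivity) hXtop
      rw [← e] at key
      nth_rewrite 1 [e] at key
      exact (ENNReal.mul_le_mul_iff_left hp0 hpt).1 key
    calc X = (X ^ (θ / 2)) ^ (2 / θ) := by
          rw [← ENNReal.rpow_mul]
          conv_lhs => rw [← ENNReal.rpow_one X]
          congr 1; field_simp
      _ ≤ M ^ (2 / θ) := by gcongr
  -- As `n` grows, the test sets exhaust the part of the slice where `v ≠ 0`: monotone convergence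
  -- in `z` at fixed `t`, to be followed by Fatou in `t`.
  have conv : ∀ t ∈ Set.Icc (-1 : ℝ) 1, Filter.Tendsto
      (fun n : ℕ => ENNReal.ofReal (testMass v (n + 1) r t ^ ρ)) Filter.atTop
      (nhds ((∫⁻ z, ‖v (z, t)‖ₑ ^ r) ^ ρ)) := by
    intro t ht
    have ht' : |t| ≤ 1 := abs_le.2 ht
    have e : ∀ n : ℕ, ENNReal.ofReal (testMass v (n + 1) r t ^ ρ) =
        (∫⁻ z, (testSet v (n + 1 : ℝ)).indicator (fun q => ‖v q‖ₑ ^ r) (z, t)) ^ ρ := by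
      intro n
      rw [← ofReal_testMass hv hr0 hV, ENNReal.ofReal_rpow_of_nonneg (testMass_nonneg t) hρ0.le]
    simp_rw [e]
    refine (ENNReal.continuous_rpow_const.tendsto _).comp ?_
    refine lintegral_tendsto_of_tendsto_of_monotone (fun n => ?_)
      (Filter.Eventually.of_forall fun z => ?_) (Filter.Eventually.of_forall fun z => ?_)
    · exact ((Measurable.indicator (by fun_prop) (measurableSet_testSet hv _)).comp
        (by fun_prop : Measurable fun z : ℝ × ℝ => (z, t))).aemeasurable
    · intro n m hnm
      have : testSet v (n + 1 : ℝ) ⊆ testSet v (m + 1 : ℝ) :=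
        testSet_mono (by positivity) (by gcongr)
      exact Set.indicator_le_indicator_of_subset this (fun _ => zero_le) _
    · by_cases hz : v (z, t) = 0
      · have : ∀ n : ℕ, (testSet v (n + 1 : ℝ)).indicator (fun q => ‖v q‖ₑ ^ r) (z, t) =
            ‖v (z, t)‖ₑ ^ r := by
          intro n
          by_cases h : (z, t) ∈ testSet v (n + 1 : ℝ)
          · rw [Set.indicator_of_mem h]
          · rw [Set.indicator_of_notMem h, hz, enorm_zero, ENNReal.zero_rpow_of_pos hr0]
        simp_rw [this]
        exact tendsto_const_nhds
      · obtain ⟨n, hn⟩ := exists_mem_testSet (q := (z, t)) ht' hz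
        apply tendsto_const_nhds.congr'
        filter_upwards [Filter.eventually_ge_atTop n] with m hm
        rw [Set.indicator_of_mem]
        exact testSet_mono (by positivity) (by gcongr) hn
  calc _ = ∫⁻ t in Set.Icc (-1 : ℝ) 1, Filter.liminf
        (fun n : ℕ => ENNReal.ofReal (testMass v (n + 1) r t ^ ρ)) Filter.atTop :=
        setLIntegral_congr_fun measurableSet_Icc fun t ht => (conv t ht).liminf_eq.symm
    _ ≤ Filter.liminf (fun n : ℕ => ∫⁻ t in Set.Icc (-1 : ℝ) 1,
        ENNReal.ofReal (testMass v (n + 1) r t ^ ρ)) Filter.atTop :=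
        lintegral_liminf_le fun n =>
          ((measurable_testMass hv _ _).pow_const ρ).ennreal_ofReal
    _ ≤ M ^ (2 / θ) := by
        apply Filter.liminf_le_of_frequently_le'
        exact Filter.Frequently.of_forall fun n => (setLIntegral_le_lintegral _ _).trans (step n)

/-! ### Amplitudes near the characteristic surface -/

/-- The character `exp (2 π i ⟨k, q⟩)` of space-time. -/
def spaceWave (k q : (ℝ × ℝ) × ℝ) : ℂ :=
  planeWave k.1 q.1 * Complex.exp (((2 * Real.pi * (k.2 * q.2) : ℝ) : ℂ) * Complex.I)

/-- The inverse Fourier transform on space-time, in product coordinates. -/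
def spaceTransform (A : (ℝ × ℝ) × ℝ → ℂ) (q : (ℝ × ℝ) × ℝ) : ℂ := ∫ k, A k * spaceWave k q

theorem norm_spaceWave (k q : (ℝ × ℝ) × ℝ) : ‖spaceWave k q‖ = 1 := by
  rw [spaceWave, norm_mul, norm_planeWave, Complex.norm_exp_ofReal_mul_I, mul_one]

theorem continuous_spaceWave :
    Continuous fun x : ((ℝ × ℝ) × ℝ) × ((ℝ × ℝ) × ℝ) => spaceWave x.1 x.2 := by
  unfold spaceWave planeWave
  fun_prop

theorem spaceWave_comm (k q : (ℝ × ℝ) × ℝ) : spaceWave k q = spaceWave q k := by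
  simp only [spaceWave, planeWave, mul_comm]

theorem norm_spaceTransform_le (A : (ℝ × ℝ) × ℝ → ℂ) (q : (ℝ × ℝ) × ℝ) :
    ‖spaceTransform A q‖ ≤ ∫ k, ‖A k‖ := by
  refine (norm_integral_le_integral_norm _).trans (le_of_eq ?_)
  simp_rw [norm_mul, norm_spaceWave, mul_one]

theorem integrable_mul_spaceWave {A : (ℝ × ℝ) × ℝ → ℂ} (hA : Integrable A) (q : (ℝ × ℝ) × ℝ) :
    Integrable fun k => A k * spaceWave k q := by
  refine hA.norm.mono' (hA.1.mul (continuous_spaceWave.comp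
    (by fun_prop : Continuous fun k : (ℝ × ℝ) × ℝ => (k, q))).aestronglyMeasurable)
    (Filter.Eventually.of_forall fun k => ?_)
  rw [norm_mul, norm_spaceWave, mul_one]

theorem continuous_spaceTransform {A : (ℝ × ℝ) × ℝ → ℂ} (hA : Integrable A) :
    Continuous (spaceTransform A) := by
  refine continuous_of_dominated (fun q => (integrable_mul_spaceWave hA q).1)
    (bound := fun k => ‖A k‖) (fun q => Filter.Eventually.of_forall fun k => ?_) hA.norm
    (Filter.Eventually.of_forall fun k => ?_)
  · rw [norm_mul, norm_spaceWave, mul_one]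
  · exact continuous_const.mul (continuous_spaceWave.comp
      (by fun_prop : Continuous fun q : (ℝ × ℝ) × ℝ => (k, q)))

theorem integral_spaceTransform_mul_eq {A Ψ : (ℝ × ℝ) × ℝ → ℂ} (hA : Integrable A)
    (hΨ : Integrable Ψ) : ∫ q, spaceTransform A q * Ψ q = ∫ k, A k * spaceTransform Ψ k := by
  simp only [spaceTransform, ← integral_mul_const, ← integral_const_mul]
  rw [integral_integral_swap]
  · congr 1; ext k; congr 1; ext q
    rw [spaceWave_comm]; ring
  · have h := (hΨ.mul_prod hA)
    refine h.norm.mono' ?_ (Filter.Eventually.of_forall fun x => ?_)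
    · exact (hA.1.comp_snd.mul ((continuous_spaceWave.comp continuous_swap).aestronglyMeasurable)).mul
        hΨ.1.comp_fst
    · simp only [Function.uncurry, norm_mul, norm_spaceWave, mul_one]
      rw [mul_comm]

/-- Amplitudes that are bounded and live on a bounded part of the `Λ`-neighbourhood of the
characteristic surface, away from the singularity `ξ = 0`. -/
structure IsBandLimited (α N Λ : ℝ) (G : (ℝ × ℝ) × ℝ → ℂ) : Prop where
  measurable : Measurable G
  bounded : ∃ B : ℝ, ∀ k, ‖G k‖ ≤ B
  support : ∀ k, G k ≠ 0 → N⁻¹ ≤ |2 * Real.pi * k.1.1| ∧ |2 * Real.pi * k.1.1| ≤ N ∧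
    |2 * Real.pi * k.1.2| ≤ N ∧ |2 * Real.pi * k.2| ≤ N ∧
    |2 * Real.pi * k.2 - omega α (2 * Real.pi * k.1.1) (2 * Real.pi * k.1.2)| ≤ Λ

/-- The amplitude of `|D_x|^s` applied to the function with amplitude `G`. -/
def absAmplitude (s : ℝ) (G : (ℝ × ℝ) × ℝ → ℂ) (k : (ℝ × ℝ) × ℝ) : ℂ :=
  ((|2 * Real.pi * k.1.1| ^ s : ℝ) : ℂ) * G k

theorem abs_le_abs_two_pi_mul (x : ℝ) : |x| ≤ |2 * Real.pi * x| := by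
  rw [abs_mul]
  have : 1 ≤ |2 * Real.pi| := by
    rw [abs_of_pos (by positivity)]
    linarith [Real.pi_gt_three]
  nlinarith [abs_nonneg x]

theorem measurable_abs_rpow (s : ℝ) :
    Measurable fun k : (ℝ × ℝ) × ℝ => |2 * Real.pi * k.1.1| ^ s := by
  have : Measurable fun x : ℝ => |x| := measurable_norm
  have h : Measurable fun k : (ℝ × ℝ) × ℝ => |2 * Real.pi * k.1.1| :=
    this.comp (by fun_prop : Measurable fun k : (ℝ × ℝ) × ℝ => 2 * Real.pi * k.1.1)
  exact h.pow_const s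

theorem measurable_absAmplitude {G : (ℝ × ℝ) × ℝ → ℂ} (hG : Measurable G) (s : ℝ) :
    Measurable (absAmplitude s G) :=
  (Complex.measurable_ofReal.comp (measurable_abs_rpow s)).mul hG

theorem memLp_of_bounded_of_support {A : (ℝ × ℝ) × ℝ → ℂ} (hA : Measurable A) {B N : ℝ}
    (hB : ∀ k, ‖A k‖ ≤ B) (hN : ∀ k, A k ≠ 0 → ‖k‖ ≤ N) (p : ℝ≥0∞) : MemLp A p := by
  have h : MemLp ((Metric.closedBall (0 : (ℝ × ℝ) × ℝ) N).indicator fun _ => B) p :=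
    memLp_indicator_const p measurableSet_closedBall B
      (Or.inr (isCompact_closedBall (0 : (ℝ × ℝ) × ℝ) N).measure_lt_top.ne)
  refine h.of_le hA.aestronglyMeasurable (Filter.Eventually.of_forall fun k => ?_)
  by_cases hk : A k = 0
  · rw [hk, norm_zero]; exact norm_nonneg _
  · rw [Set.indicator_of_mem (by simpa using hN k hk)]
    exact (hB k).trans (le_abs_self _)

namespace IsBandLimited

variable {α N Λ : ℝ} {G : (ℝ × ℝ) × ℝ → ℂ}

theorem norm_le (h : IsBandLimited α N Λ G) (k : (ℝ × ℝ) × ℝ) (hk : G k ≠ 0) : ‖k‖ ≤ N := by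
  obtain ⟨-, h1, h2, h3, -⟩ := h.support k hk
  simp only [Prod.norm_def, Real.norm_eq_abs, sup_le_iff]
  exact ⟨⟨(abs_le_abs_two_pi_mul _).trans h1, (abs_le_abs_two_pi_mul _).trans h2⟩,
    (abs_le_abs_two_pi_mul _).trans h3⟩

theorem memLp (h : IsBandLimited α N Λ G) (p : ℝ≥0∞) : MemLp G p := by
  obtain ⟨B, hB⟩ := h.bounded
  exact memLp_of_bounded_of_support h.measurable hB h.norm_le p

theorem memLp_absAmplitude (h : IsBandLimited α N Λ G) {s : ℝ} (hs : 0 ≤ s) (p : ℝ≥0∞) :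
    MemLp (absAmplitude s G) p := by
  obtain ⟨B, hB⟩ := h.bounded
  refine memLp_of_bounded_of_support (measurable_absAmplitude h.measurable s) (B := |N| ^ s * B)
    (fun k => ?_) (fun k hk => h.norm_le k fun h0 => hk ?_) p
  · by_cases hk : G k = 0
    · rw [absAmplitude, hk, mul_zero, norm_zero]
      have := (norm_nonneg _).trans (hB k)
      positivity
    · have h1 := (h.support k hk).2.1
      rw [absAmplitude, norm_mul, Complex.norm_real, Real.norm_of_nonneg (by positivity)]
      exact mul_le_mul (Real.rpow_le_rpow (abs_nonneg _) (h1.trans (le_abs_self _)) hs) (hB k)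
        (norm_nonneg _) (by positivity)
  · rw [absAmplitude, h0, mul_zero]

theorem integrable_absAmplitude (h : IsBandLimited α N Λ G) {s : ℝ} (hs : 0 ≤ s) :
    Integrable (absAmplitude s G) := memLp_one_iff_integrable.1 (h.memLp_absAmplitude hs 1)

/-- Translation in time. -/
theorem modulate (h : IsBandLimited α N Λ G) (c : ℝ) :
    IsBandLimited α N Λ fun k =>
      G k * Complex.exp (((2 * Real.pi * (c * k.2) : ℝ) : ℂ) * Complex.I) where
  measurable := h.measurable.mul (by fun_prop)
  bounded := by
    obtain ⟨B, hB⟩ := h.bounded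
    exact ⟨B, fun k => by rw [norm_mul, Complex.norm_exp_ofReal_mul_I, mul_one]; exact hB k⟩
  support k hk := h.support k (left_ne_zero_of_mul hk)

end IsBandLimited

/-- Modulation preserves `‖G‖` and the support, so a bound on `|t| ≤ 1` holds on every time interval
of length `2` with the same constant. -/
theorem spaceTransform_modulate (s c : ℝ) (G : (ℝ × ℝ) × ℝ → ℂ) (z : ℝ × ℝ) (t : ℝ) :
    spaceTransform (absAmplitude s fun k =>
      G k * Complex.exp (((2 * Real.pi * (c * k.2) : ℝ) : ℂ) * Complex.I)) (z, t) =
      spaceTransform (absAmplitude s G) (z, t + c) := by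
  simp only [spaceTransform, absAmplitude, spaceWave]
  congr 1; ext k
  have : Complex.exp (((2 * Real.pi * (k.2 * (t + c)) : ℝ) : ℂ) * Complex.I) =
      Complex.exp (((2 * Real.pi * (c * k.2) : ℝ) : ℂ) * Complex.I) *
      Complex.exp (((2 * Real.pi * (k.2 * t) : ℝ) : ℂ) * Complex.I) := by
    rw [← Complex.exp_add]; congr 1; push_cast; ring
  rw [this]
  ring

/-- Restricting to the surface translated by `l` amounts to modulating `Ψ` in time. This leaves
`‖Ψ‖` unchanged, so all leaves obey the same bound. -/
theorem spaceTransform_eq_surfaceTransform (α : ℝ) (Ψ : (ℝ × ℝ) × ℝ → ℂ) (p : ℝ × ℝ) (l : ℝ) :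
    spaceTransform Ψ (p, l + omega α (2 * Real.pi * p.1) (2 * Real.pi * p.2) / (2 * Real.pi)) =
      surfaceTransform α (fun q =>
        Ψ q * Complex.exp (((2 * Real.pi * (l * q.2) : ℝ) : ℂ) * Complex.I)) p := by
  simp only [spaceTransform, surfaceTransform, spaceWave]
  congr 1; ext q
  have : Complex.exp (((2 * Real.pi * (q.2 *
      (l + omega α (2 * Real.pi * p.1) (2 * Real.pi * p.2) / (2 * Real.pi))) : ℝ) : ℂ) *
      Complex.I) = Complex.exp (((2 * Real.pi * (l * q.2) : ℝ) : ℂ) * Complex.I) *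
      Complex.exp (((q.2 * omega α (2 * Real.pi * p.1) (2 * Real.pi * p.2) : ℝ) : ℂ) *
        Complex.I) := by
    rw [← Complex.exp_add]; congr 1
    have hpi : (Real.pi : ℂ) ≠ 0 := by exact_mod_cast Real.pi_ne_zero
    push_cast
    field_simp
  rw [this]
  ring

/-- `|ξ|^θ` is controlled by `surfaceWeight` on bounded sets. -/
theorem abs_rpow_le_surfaceWeight {N θ : ℝ} (hN : 1 ≤ N) {p : ℝ × ℝ}
    (h1 : N⁻¹ ≤ |2 * Real.pi * p.1|) (h2 : |2 * Real.pi * p.1| ≤ N) (h3 : |2 * Real.pi * p.2| ≤ N) :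
    |2 * Real.pi * p.1| ^ θ ≤ Real.exp 1 * surfaceWeight N (N⁻¹ ^ 3) θ p := by
  have hN0 : 0 < N := by linarith
  have h0 : 0 < |2 * Real.pi * p.1| := lt_of_lt_of_le (by positivity) h1
  rw [surfaceWeight, freqCutoff, if_pos ⟨h1, h2⟩, Real.rpow_def_of_pos h0, ← Real.exp_add,
    ← Real.exp_add]
  apply Real.exp_le_exp.2
  -- With `ε = N⁻³` the Gaussian exponent is at most `N⁻³ N² N = 1` on the box, so the cut-off costs
  -- only a factor `e`, whatever `N` is.
  have : N⁻¹ ^ 3 * (2 * Real.pi * p.2) ^ 2 / |2 * Real.pi * p.1| ≤ 1 := by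
    rw [div_le_one h0]
    refine le_trans ?_ h1
    have : (2 * Real.pi * p.2) ^ 2 ≤ N ^ 2 := sq_le_sq.2 (h3.trans (le_abs_self N))
    calc N⁻¹ ^ 3 * (2 * Real.pi * p.2) ^ 2 ≤ N⁻¹ ^ 3 * N ^ 2 := by gcongr
      _ = N⁻¹ := by field_simp
  linarith

/-- The part of frequency space on which band limited amplitudes live. -/
def bandSet (α N Λ : ℝ) : Set ((ℝ × ℝ) × ℝ) :=
  {k | N⁻¹ ≤ |2 * Real.pi * k.1.1| ∧ |2 * Real.pi * k.1.1| ≤ N ∧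
    |2 * Real.pi * k.1.2| ≤ N ∧ |2 * Real.pi * k.2| ≤ N ∧
    |2 * Real.pi * k.2 - omega α (2 * Real.pi * k.1.1) (2 * Real.pi * k.1.2)| ≤ Λ}

theorem measurable_omega_two_pi (α : ℝ) : Measurable fun k : (ℝ × ℝ) × ℝ =>
    omega α (2 * Real.pi * k.1.1) (2 * Real.pi * k.1.2) :=
  (measurable_omega α).comp
    (f := fun q : (ℝ × ℝ) × ℝ => (2 * Real.pi * q.1.1, 2 * Real.pi * q.1.2)) (by fun_prop)

theorem measurableSet_bandSet (α N Λ : ℝ) : MeasurableSet (bandSet α N Λ) := by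
  have ha : Measurable fun x : ℝ => |x| := measurable_norm
  have h1 : Measurable fun k : (ℝ × ℝ) × ℝ => |2 * Real.pi * k.1.1| :=
    ha.comp (g := fun x : ℝ => |x|) (f := fun k : (ℝ × ℝ) × ℝ => 2 * Real.pi * k.1.1) (by fun_prop)
  have h2 : Measurable fun k : (ℝ × ℝ) × ℝ => |2 * Real.pi * k.1.2| :=
    ha.comp (g := fun x : ℝ => |x|) (f := fun k : (ℝ × ℝ) × ℝ => 2 * Real.pi * k.1.2) (by fun_prop)
  have h3 : Measurable fun k : (ℝ × ℝ) × ℝ => |2 * Real.pi * k.2| :=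
    ha.comp (g := fun x : ℝ => |x|) (f := fun k : (ℝ × ℝ) × ℝ => 2 * Real.pi * k.2) (by fun_prop)
  have h4 : Measurable fun k : (ℝ × ℝ) × ℝ =>
      |2 * Real.pi * k.2 - omega α (2 * Real.pi * k.1.1) (2 * Real.pi * k.1.2)| :=
    ha.comp (((by fun_prop : Measurable fun k : (ℝ × ℝ) × ℝ => 2 * Real.pi * k.2)).sub
      (measurable_omega_two_pi α))
  exact (measurableSet_le measurable_const h1).inter ((measurableSet_le h1 measurable_const).inter
    ((measurableSet_le h2 measurable_const).inter ((measurableSet_le h3 measurable_const).inter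
      (measurableSet_le h4 measurable_const))))

/-- Foliation of the neighbourhood of the characteristic surface by translates of the surface. -/
theorem setLIntegral_spaceTransform_le {α N Λ θ : ℝ} (hN : 1 ≤ N) (hΛ : 0 ≤ Λ) (hθ0 : 0 < θ)
    (hθ1 : θ < 1) {Ψ : (ℝ × ℝ) × ℝ → ℂ} (hΨm : Measurable Ψ) (hΨ : Integrable Ψ)
    (hΨt : ∀ t, IsTame fun z => Ψ (z, t)) (hΨ1 : ∀ z t, 1 < |t| → Ψ (z, t) = 0) :
    ∫⁻ k in bandSet α N Λ, ENNReal.ofReal (|2 * Real.pi * k.1.1| ^ θ * ‖spaceTransform Ψ k‖ ^ 2) ≤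
      ENNReal.ofReal (Real.exp 1 * dispersiveConst α * (2 * (2 / (1 - θ) + 2)) * Λ) *
        (∫⁻ t, ENNReal.ofReal (sliceNorm θ Ψ t) ^ (2 / (2 - θ))) ^ (2 - θ) := by
  have hN0 : 0 < N := by linarith
  have hpi := Real.pi_gt_three
  have hK := one_le_dispersiveConst α
  have hT := continuous_spaceTransform hΨ
  have hsw : Measurable (surfaceWeight N (N⁻¹ ^ 3) θ) := by
    have h1 := measurable_freqCutoff N (N⁻¹ ^ 3)
    unfold surfaceWeight
    fun_prop
  set B : Set ((ℝ × ℝ) × ℝ) := {k | |2 * Real.pi * k.2 -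
    omega α (2 * Real.pi * k.1.1) (2 * Real.pi * k.1.2)| ≤ Λ} with hB
  have hBm : MeasurableSet B := by
    have ha : Measurable fun x : ℝ => |x| := measurable_norm
    exact measurableSet_le (ha.comp (((by fun_prop : Measurable fun k : (ℝ × ℝ) × ℝ =>
      2 * Real.pi * k.2)).sub (measurable_omega_two_pi α))) measurable_const
  set J : (ℝ × ℝ) × ℝ → ℝ≥0∞ := B.indicator fun k =>
    ENNReal.ofReal (Real.exp 1) *
      ENNReal.ofReal (surfaceWeight N (N⁻¹ ^ 3) θ k.1 * ‖spaceTransform Ψ k‖ ^ 2) with hJ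
  have hJm : Measurable J := by
    apply Measurable.indicator _ hBm
    have := hT.measurable
    fun_prop
  set m : ℝ × ℝ → ℝ := fun p => omega α (2 * Real.pi * p.1) (2 * Real.pi * p.2) / (2 * Real.pi)
    with hm
  have hmm : Measurable m := ((measurable_omega α).comp
    (f := fun q : ℝ × ℝ => (2 * Real.pi * q.1, 2 * Real.pi * q.2)) (by fun_prop)).div_const _
  -- On the leaf at height `l` one has `τ - ω = 2πl`, so the leaf meets the band only if `2π|l| ≤
  -- Λ`, in particular `|l| ≤ Λ / 2`. The bound on each leaf does not depend on `l`, and the heights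
  -- contribute the measure `Λ`.
  have hstep : ∀ l : ℝ, ∫⁻ p, J (p, l + m p) ≤ (Set.Icc (-(Λ / 2)) (Λ / 2)).indicator (fun _ =>
      ENNReal.ofReal (Real.exp 1) * (ENNReal.ofReal (dispersiveConst α * (2 * (2 / (1 - θ) + 2))) *
        (∫⁻ t, ENNReal.ofReal (sliceNorm θ Ψ t) ^ (2 / (2 - θ))) ^ (2 - θ))) l := by
    intro l
    by_cases hl : l ∈ Set.Icc (-(Λ / 2)) (Λ / 2)
    · rw [Set.indicator_of_mem hl]
      set Φ : (ℝ × ℝ) × ℝ → ℂ := fun q =>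
        Ψ q * Complex.exp (((2 * Real.pi * (l * q.2) : ℝ) : ℂ) * Complex.I) with hΦ
      have hn : ∀ q, ‖Φ q‖ = ‖Ψ q‖ := fun q => by
        rw [hΦ]; simp only [norm_mul, Complex.norm_exp_ofReal_mul_I, mul_one]
      have hΦm : Measurable Φ := hΨm.mul (by fun_prop)
      have hΦi : Integrable Φ := hΨ.norm.mono' hΦm.aestronglyMeasurable
        (Filter.Eventually.of_forall fun q => (hn q).le)
      have hz : ∀ q, Φ q ≠ 0 → Ψ q ≠ 0 := fun q h => left_ne_zero_of_mul h
      have hs : sliceNorm θ Φ = sliceNorm θ Ψ := by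
        ext t; simp only [sliceNorm, hn]
      have key := lintegral_surfaceTransform_le (α := α) hN (show 0 < N⁻¹ ^ 3 by positivity) hθ0 hθ1
        hΦm hΦi (fun t => ⟨hΦm.comp (by fun_prop), by
          obtain ⟨R, hR⟩ := (hΨt t).bounded_support
          exact ⟨R, fun z h => hR z (hz _ h)⟩, by
          obtain ⟨R, hR⟩ := (hΨt t).norm_mem
          exact ⟨R, fun z h => by rw [hn]; exact hR z (hz _ h)⟩⟩)
        (fun z t ht => by rw [hΦ]; simp only [hΨ1 z t ht, zero_mul])
      rw [hs] at key
      refine le_trans ?_ (mul_le_mul_right key _)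
      rw [← lintegral_const_mul' _ _ ENNReal.ofReal_ne_top]
      refine lintegral_mono fun p => ?_
      refine (Set.indicator_le_self _ _ _).trans (le_of_eq ?_)
      simp only [hm]
      rw [spaceTransform_eq_surfaceTransform]
    · rw [Set.indicator_of_notMem hl]
      refine le_of_eq ((lintegral_congr fun p => ?_).trans lintegral_zero)
      rw [hJ, Set.indicator_of_notMem]
      intro h
      apply hl
      simp only [hB, Set.mem_ofPred_eq, hm] at h
      have e : 2 * Real.pi * (l + omega α (2 * Real.pi * p.1) (2 * Real.pi * p.2) / (2 * Real.pi)) -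
        omega α (2 * Real.pi * p.1) (2 * Real.pi * p.2) = 2 * Real.pi * l := by
        field_simp; ring
      rw [e, abs_mul, abs_of_pos (by positivity)] at h
      rw [Set.mem_Icc, ← abs_le]
      nlinarith [abs_nonneg l]
  calc _ ≤ ∫⁻ k, J k := by
        rw [← lintegral_indicator (measurableSet_bandSet α N Λ)]
        refine lintegral_mono fun k => ?_
        by_cases hk : k ∈ bandSet α N Λ
        · have hkB : k ∈ B := hk.2.2.2.2
          rw [Set.indicator_of_mem hk, hJ, Set.indicator_of_mem hkB,
            ← ENNReal.ofReal_mul (Real.exp_pos 1).le, ← mul_assoc]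
          apply ENNReal.ofReal_le_ofReal
          gcongr
          exact abs_rpow_le_surfaceWeight hN hk.1 hk.2.1 hk.2.2.1
        · rw [Set.indicator_of_notMem hk]; exact zero_le
    _ = ∫⁻ p, ∫⁻ l, J (p, l + m p) := by
        rw [Measure.volume_eq_prod, lintegral_prod _ hJm.aemeasurable]
        refine lintegral_congr fun p => ?_
        exact (lintegral_add_right_eq_self (fun l => J (p, l)) (m p)).symm
    _ = ∫⁻ l, ∫⁻ p, J (p, l + m p) := by
        apply lintegral_lintegral_swap
        exact (hJm.comp (by fun_prop : Measurable fun x : (ℝ × ℝ) × ℝ =>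
          (x.1, x.2 + m x.1))).aemeasurable
    _ ≤ _ := by
        refine (lintegral_mono hstep).trans ?_
        rw [lintegral_indicator measurableSet_Icc, setLIntegral_const, Real.volume_Icc,
          show Λ / 2 - -(Λ / 2) = Λ by ring,
          show Real.exp 1 * dispersiveConst α * (2 * (2 / (1 - θ) + 2)) * Λ =
            Λ * (Real.exp 1 * (dispersiveConst α * (2 * (2 / (1 - θ) + 2)))) by ring,
          ENNReal.ofReal_mul hΛ, ENNReal.ofReal_mul (Real.exp_pos 1).le]
        apply le_of_eq; ring

/-- The constant of the Strichartz estimate. -/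
def strichartzConst (α θ : ℝ) : ℝ := Real.exp 1 * dispersiveConst α * (2 * (2 / (1 - θ) + 2))

theorem IsBandLimited.mem_bandSet {α N Λ : ℝ} {G : (ℝ × ℝ) × ℝ → ℂ} (h : IsBandLimited α N Λ G)
    {k : (ℝ × ℝ) × ℝ} (hk : G k ≠ 0) : k ∈ bandSet α N Λ := h.support k hk

/-- The transform is moved onto `Ψ`, and Cauchy–Schwarz on the band separates `G` from `|ξ|^(θ/2)`
times the transform of `Ψ`. Squaring the latter gives the weight `|ξ|^θ` of the foliated estimate.
-/
theorem enorm_integral_spaceTransform_mul_le {α N Λ θ : ℝ} (hN : 1 ≤ N) (hΛ : 0 ≤ Λ) (hθ0 : 0 < θ)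
    (hθ1 : θ < 1) {G : (ℝ × ℝ) × ℝ → ℂ} (hG : IsBandLimited α N Λ G)
    {Ψ : (ℝ × ℝ) × ℝ → ℂ} (hΨm : Measurable Ψ) (hΨ : Integrable Ψ)
    (hΨt : ∀ t, IsTame fun z => Ψ (z, t)) (hΨ1 : ∀ z t, 1 < |t| → Ψ (z, t) = 0) :
    ‖∫ q, spaceTransform (absAmplitude (θ / 2) G) q * Ψ q‖ₑ ≤
      (eLpNorm G 2 volume * ENNReal.ofReal (strichartzConst α θ * Λ) ^ (1 / 2 : ℝ)) *
        (∫⁻ t, ENNReal.ofReal (sliceNorm θ Ψ t) ^ (2 / (2 - θ))) ^ ((2 - θ) / 2) := by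
  rw [integral_spaceTransform_mul_eq (hG.integrable_absAmplitude (by positivity)) hΨ]
  set W : (ℝ × ℝ) × ℝ → ℝ≥0∞ := (bandSet α N Λ).indicator fun k =>
    ENNReal.ofReal (|2 * Real.pi * k.1.1| ^ (θ / 2) * ‖spaceTransform Ψ k‖) with hW
  have hWm : Measurable W := by
    apply Measurable.indicator _ (measurableSet_bandSet α N Λ)
    exact ((measurable_abs_rpow _).mul (continuous_spaceTransform hΨ).measurable.norm).ennreal_ofReal
  have h1 : ∀ k, ‖absAmplitude (θ / 2) G k * spaceTransform Ψ k‖ₑ ≤ ((fun k => ‖G k‖ₑ) * W) k := by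
    intro k
    by_cases hk : G k = 0
    · simp [absAmplitude, hk]
    · simp only [Pi.mul_apply]
      rw [hW, Set.indicator_of_mem (hG.mem_bandSet hk), ENNReal.ofReal_mul (by positivity),
        ofReal_norm, absAmplitude, enorm_mul, enorm_mul, ← ofReal_norm ((_ : ℝ) : ℂ),
        Complex.norm_real, Real.norm_of_nonneg (by positivity)]
      apply le_of_eq; ring
  calc _ ≤ ∫⁻ k, ‖absAmplitude (θ / 2) G k * spaceTransform Ψ k‖ₑ :=
        enorm_integral_le_lintegral_enorm _
    _ ≤ ∫⁻ k, ((fun k => ‖G k‖ₑ) * W) k := lintegral_mono h1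
    _ ≤ (∫⁻ k, ‖G k‖ₑ ^ (2 : ℝ)) ^ (1 / 2 : ℝ) * (∫⁻ k, W k ^ (2 : ℝ)) ^ (1 / 2 : ℝ) :=
        ENNReal.lintegral_mul_le_Lp_mul_Lq volume (by constructor <;> norm_num)
          hG.measurable.enorm.aemeasurable hWm.aemeasurable
    _ ≤ _ := by
        rw [eLpNorm_eq_lintegral_rpow_enorm_toReal (by norm_num) (by norm_num),
          ENNReal.toReal_ofNat, mul_assoc]
        gcongr
        have h2 : ∀ k, W k ^ (2 : ℝ) = (bandSet α N Λ).indicator (fun k =>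
            ENNReal.ofReal (|2 * Real.pi * k.1.1| ^ θ * ‖spaceTransform Ψ k‖ ^ 2)) k := by
          intro k
          by_cases hk : k ∈ bandSet α N Λ
          · rw [hW, Set.indicator_of_mem hk, Set.indicator_of_mem hk,
              ENNReal.ofReal_rpow_of_nonneg (by positivity) (by norm_num), Real.rpow_ofNat, mul_pow,
              ← Real.rpow_natCast (_ ^ _), ← Real.rpow_mul (abs_nonneg _)]
            congr 3
            push_cast; ring
          · rw [hW, Set.indicator_of_notMem hk, Set.indicator_of_notMem hk,
              ENNReal.zero_rpow_of_pos (by norm_num)]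
        simp_rw [h2]
        rw [lintegral_indicator (measurableSet_bandSet α N Λ)]
        refine (ENNReal.rpow_le_rpow (setLIntegral_spaceTransform_le hN hΛ hθ0 hθ1 hΨm hΨ hΨt hΨ1)
          (by norm_num)).trans (le_of_eq ?_)
        rw [ENNReal.mul_rpow_of_nonneg _ _ (by norm_num), ← ENNReal.rpow_mul, strichartzConst]
        congr 2; ring

/-- The Strichartz estimate on time intervals of length `2`, for band limited amplitudes. -/
theorem lintegral_mixed_spaceTransform_le {α N Λ θ : ℝ} (hN : 1 ≤ N) (hΛ : 0 ≤ Λ) (hθ0 : 0 < θ)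
    (hθ1 : θ < 1) {G : (ℝ × ℝ) × ℝ → ℂ} (hG : IsBandLimited α N Λ G) (c : ℝ) :
    ∫⁻ t in Set.Icc (-1 : ℝ) 1, (∫⁻ z, ‖spaceTransform (absAmplitude (θ / 2) G) (z, t + c)‖ₑ ^
      (2 / (1 - θ))) ^ ((1 - θ) / θ) ≤
      (eLpNorm G 2 volume * ENNReal.ofReal (strichartzConst α θ * Λ) ^ (1 / 2 : ℝ)) ^ (2 / θ) := by
  have hGc := hG.modulate c
  have hi := hGc.integrable_absAmplitude (s := θ / 2) (by positivity)
  have hn : eLpNorm (fun k => G k * Complex.exp (((2 * Real.pi * (c * k.2) : ℝ) : ℂ) * Complex.I)) 2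
      volume = eLpNorm G 2 volume := by
    apply eLpNorm_congr_norm_ae
    exact Filter.Eventually.of_forall fun k => by
      rw [norm_mul, Complex.norm_exp_ofReal_mul_I, mul_one]
  have := lintegral_mixed_le_of_test (continuous_spaceTransform hi).measurable
    (fun q => norm_spaceTransform_le _ q) hθ0 hθ1
    (fun Ψ h1 h2 h3 h4 => enorm_integral_spaceTransform_mul_le hN hΛ hθ0 hθ1 hGc h1 h2 h3 h4)
  simp_rw [spaceTransform_modulate, hn] at this
  exact this

/-! ### The energy estimate, and Strichartz for band limited amplitudes -/

/-- The Fourier transform in time. -/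
def timeTransform (G : (ℝ × ℝ) × ℝ → ℂ) (t : ℝ) (p : ℝ × ℝ) : ℂ :=
  ∫ l, G (p, l) * Complex.exp (((2 * Real.pi * (l * t) : ℝ) : ℂ) * Complex.I)

theorem integrable_mul_timeWave {G : (ℝ × ℝ) × ℝ → ℂ} (hG : Integrable G) (t : ℝ) :
    Integrable fun k : (ℝ × ℝ) × ℝ =>
      G k * Complex.exp (((2 * Real.pi * (k.2 * t) : ℝ) : ℂ) * Complex.I) := by
  refine hG.norm.mono' (hG.1.mul (by fun_prop)) (Filter.Eventually.of_forall fun k => ?_)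
  rw [norm_mul, Complex.norm_exp_ofReal_mul_I, mul_one]

theorem integrable_timeTransform {G : (ℝ × ℝ) × ℝ → ℂ} (hG : Integrable G) (t : ℝ) :
    Integrable (timeTransform G t) := by
  have := integrable_mul_timeWave hG t
  rw [Measure.volume_eq_prod] at this
  exact this.integral_prod_left

theorem spaceTransform_eq_planeTransform {G : (ℝ × ℝ) × ℝ → ℂ} (hG : Integrable G) (z : ℝ × ℝ)
    (t : ℝ) : spaceTransform G (z, t) = planeTransform (timeTransform G t) z := by
  have := integrable_mul_spaceWave hG (z, t)
  rw [Measure.volume_eq_prod] at this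
  rw [spaceTransform, Measure.volume_eq_prod, integral_prod _ this, planeTransform]
  congr 1; ext p
  rw [timeTransform, ← integral_mul_const]
  congr 1; ext l
  simp only [spaceWave]
  ring

/-- For fixed `(ξ, μ)` the amplitude lives on an interval of length at most `Λ`, so Cauchy–Schwarz
in the time frequency costs `Λ^(1/2)`, uniformly in `t`. -/
theorem eLpNorm_timeTransform_le {α N Λ : ℝ} {G : (ℝ × ℝ) × ℝ → ℂ} (hG : IsBandLimited α N Λ G)
    (hΛ : 0 ≤ Λ) (t : ℝ) :
    eLpNorm (timeTransform G t) 2 volume ≤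
      ENNReal.ofReal Λ ^ (1 / 2 : ℝ) * eLpNorm G 2 volume := by
  have hpt : ∀ p, ‖timeTransform G t p‖ₑ ^ (2 : ℝ) ≤
      ENNReal.ofReal Λ * ∫⁻ l, ‖G (p, l)‖ₑ ^ (2 : ℝ) := by
    intro p
    set m := omega α (2 * Real.pi * p.1) (2 * Real.pi * p.2) / (2 * Real.pi)
    set χ : ℝ → ℝ≥0∞ := (Metric.closedBall m (Λ / 2)).indicator 1 with hχ
    have hχm : Measurable χ := measurable_one.indicator measurableSet_closedBall
    have hGp : Measurable fun l => G (p, l) := hG.measurable.comp (by fun_prop)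
    have h1 : ∀ l, ‖G (p, l) * Complex.exp (((2 * Real.pi * (l * t) : ℝ) : ℂ) * Complex.I)‖ₑ ≤
        (χ * fun l => ‖G (p, l)‖ₑ) l := by
      intro l
      have hn : ‖Complex.exp (((2 * Real.pi * (l * t) : ℝ) : ℂ) * Complex.I)‖ₑ = 1 := by
        rw [← ofReal_norm, Complex.norm_exp_ofReal_mul_I, ENNReal.ofReal_one]
      rw [enorm_mul, hn, mul_one, Pi.mul_apply]
      by_cases hk : G (p, l) = 0
      · simp [hk]
      · have h5 := (hG.support _ hk).2.2.2.2
        have hl : l ∈ Metric.closedBall m (Λ / 2) := by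
          rw [Metric.mem_closedBall, Real.dist_eq]
          have e : 2 * Real.pi * l - omega α (2 * Real.pi * p.1) (2 * Real.pi * p.2) =
              2 * Real.pi * (l - m) := by
            simp only [m]; field_simp
          simp only at h5
          rw [e, abs_mul, abs_of_pos (by positivity)] at h5
          nlinarith [abs_nonneg (l - m), Real.pi_gt_three]
        rw [hχ, Set.indicator_of_mem hl, Pi.one_apply, one_mul]
    have h2 : ‖timeTransform G t p‖ₑ ≤
        (∫⁻ l, χ l ^ (2 : ℝ)) ^ (1 / 2 : ℝ) * (∫⁻ l, ‖G (p, l)‖ₑ ^ (2 : ℝ)) ^ (1 / 2 : ℝ) :=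
      (enorm_integral_le_lintegral_enorm _).trans ((lintegral_mono h1).trans
        (ENNReal.lintegral_mul_le_Lp_mul_Lq volume (by constructor <;> norm_num)
          hχm.aemeasurable hGp.enorm.aemeasurable))
    have h3 : ∫⁻ l, χ l ^ (2 : ℝ) = ENNReal.ofReal Λ := by
      have : ∀ l, χ l ^ (2 : ℝ) = (Metric.closedBall m (Λ / 2)).indicator 1 l := by
        intro l
        by_cases hl : l ∈ Metric.closedBall m (Λ / 2)
        · rw [hχ, Set.indicator_of_mem hl, Pi.one_apply, ENNReal.one_rpow]
        · rw [hχ, Set.indicator_of_notMem hl, ENNReal.zero_rpow_of_pos (by norm_num)]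
      simp_rw [this]
      rw [lintegral_indicator_one measurableSet_closedBall, Real.volume_closedBall]
      congr 1; ring
    rw [h3] at h2
    refine (ENNReal.rpow_le_rpow h2 (by norm_num : (0 : ℝ) ≤ 2)).trans (le_of_eq ?_)
    rw [ENNReal.mul_rpow_of_nonneg _ _ (by norm_num), ← ENNReal.rpow_mul, ← ENNReal.rpow_mul]
    norm_num
  rw [eLpNorm_eq_lintegral_rpow_enorm_toReal (by norm_num) (by norm_num),
    eLpNorm_eq_lintegral_rpow_enorm_toReal (by norm_num) (by norm_num), ENNReal.toReal_ofNat,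
    ← ENNReal.mul_rpow_of_nonneg _ _ (by norm_num)]
  apply ENNReal.rpow_le_rpow _ (by norm_num)
  have hm : Measurable fun k => ‖G k‖ₑ ^ (2 : ℝ) := hG.measurable.enorm.pow_const _
  rw [Measure.volume_eq_prod (ℝ × ℝ) ℝ, lintegral_prod _ hm.aemeasurable,
    ← lintegral_const_mul' _ _ ENNReal.ofReal_ne_top]
  exact lintegral_mono hpt

/-- The energy estimate on time slices. -/
theorem eLpNorm_spaceTransform_slice_le {α N Λ : ℝ} {G : (ℝ × ℝ) × ℝ → ℂ}
    (hG : IsBandLimited α N Λ G) (hΛ : 0 ≤ Λ) (t : ℝ) :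
    eLpNorm (fun z => spaceTransform G (z, t)) 2 volume ≤
      ENNReal.ofReal Λ ^ (1 / 2 : ℝ) * eLpNorm G 2 volume := by
  have h1 := integrable_timeTransform (memLp_one_iff_integrable.1 (hG.memLp 1)) t
  have h3 := eLpNorm_timeTransform_le hG hΛ t
  have h2 : MemLp (timeTransform G t) 2 := ⟨h1.1, h3.trans_lt (ENNReal.mul_lt_top
    (ENNReal.rpow_lt_top_of_nonneg (by norm_num) ENNReal.ofReal_ne_top) (hG.memLp 2).2)⟩
  simp_rw [spaceTransform_eq_planeTransform (memLp_one_iff_integrable.1 (hG.memLp 1))]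
  exact (eLpNorm_planeTransform h1 h2).trans_le h3

theorem absAmplitude_zero (G : (ℝ × ℝ) × ℝ → ℂ) : absAmplitude 0 G = G := by
  ext k; simp [absAmplitude]

theorem one_le_strichartzConst (α : ℝ) : 1 ≤ strichartzConst α 0 := by
  have := one_le_dispersiveConst α
  have h2 : 1 ≤ Real.exp 1 := Real.one_le_exp zero_le_one
  have : 1 ≤ Real.exp 1 * dispersiveConst α := one_le_mul_of_one_le_of_one_le h2 this
  rw [strichartzConst]
  linarith

theorem strichartzConst_pos (α : ℝ) {θ : ℝ} (hθ : θ < 1) : 0 < strichartzConst α θ := by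
  have := one_le_dispersiveConst α
  have : 0 < 1 - θ := by linarith
  unfold strichartzConst
  positivity

/-- The mixed norm in product coordinates, on the time interval of length `2` about `c`. -/
def localMixedNorm (c : ℝ) (q r : ℝ≥0∞) (v : (ℝ × ℝ) × ℝ → ℂ) : ℝ≥0∞ :=
  eLpNorm (fun t => eLpNorm (fun z => v (z, t + c)) r volume) q (volume.restrict (Set.Icc (-1) 1))

/-- The Strichartz estimate for band limited amplitudes, including the energy estimate. -/
theorem localMixedNorm_spaceTransform_le {α N Λ θ : ℝ} (hN : 1 ≤ N) (hΛ : 0 ≤ Λ) (hθ0 : 0 ≤ θ)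
    (hθ1 : θ < 1) {G : (ℝ × ℝ) × ℝ → ℂ} (hG : IsBandLimited α N Λ G) (c : ℝ) :
    localMixedNorm c (2 / ENNReal.ofReal θ) (ENNReal.ofReal (2 / (1 - θ)))
      (spaceTransform (absAmplitude (θ / 2) G)) ≤
      ENNReal.ofReal (strichartzConst α θ * Λ) ^ (1 / 2 : ℝ) * eLpNorm G 2 volume := by
  have h1 : 0 < 1 - θ := by linarith
  -- At `θ = 0` the exponent `2 / 0` is `∞` and the fractional integration argument is not
  -- available; the energy estimate replaces it.
  rcases eq_or_lt_of_le hθ0 with rfl | hθ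
  · rw [localMixedNorm, ENNReal.ofReal_zero, ENNReal.div_zero two_ne_zero, eLpNorm_exponent_top]
    apply eLpNormEssSup_le_of_ae_enorm_bound
    refine Filter.Eventually.of_forall fun t => ?_
    rw [enorm_eq_self, zero_div, absAmplitude_zero]
    norm_num only [sub_zero, div_one, ENNReal.ofReal_ofNat]
    refine (eLpNorm_spaceTransform_slice_le hG hΛ _).trans ?_
    gcongr
    exact le_mul_of_one_le_left hΛ (one_le_strichartzConst α)
  · have hq : (2 : ℝ≥0∞) / ENNReal.ofReal θ = ENNReal.ofReal (2 / θ) := by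
      rw [ENNReal.ofReal_div_of_pos hθ, ENNReal.ofReal_ofNat]
    have hq0 : 0 < 2 / θ := by positivity
    have hr0 : 0 < 2 / (1 - θ) := by positivity
    rw [localMixedNorm, hq, eLpNorm_eq_lintegral_rpow_enorm_toReal
      (ENNReal.ofReal_pos.2 hq0).ne' ENNReal.ofReal_ne_top, ENNReal.toReal_ofReal hq0.le]
    have e : ∀ t, ‖eLpNorm (fun z => spaceTransform (absAmplitude (θ / 2) G) (z, t + c))
        (ENNReal.ofReal (2 / (1 - θ))) volume‖ₑ ^ (2 / θ) =
        (∫⁻ z, ‖spaceTransform (absAmplitude (θ / 2) G) (z, t + c)‖ₑ ^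
      (2 / (1 - θ))) ^ ((1 - θ) / θ) := by
      intro t
      rw [enorm_eq_self, eLpNorm_eq_lintegral_rpow_enorm_toReal
        (ENNReal.ofReal_pos.2 hr0).ne' ENNReal.ofReal_ne_top, ENNReal.toReal_ofReal hr0.le,
        ← ENNReal.rpow_mul]
      congr 1
      field_simp
    simp_rw [e]
    rw [one_div, ENNReal.rpow_inv_le_iff hq0, mul_comm]
    exact lintegral_mixed_spaceTransform_le hN hΛ hθ hθ1 hG c

/-! ### From uniformly local bounds in time to a weighted `L¹` bound -/

/-- Polynomial decay in the plane. -/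
def planeWeight (z : ℝ × ℝ) : ℝ := (1 + ‖z‖) ^ (-3 : ℝ)

/-- Polynomial decay in time. -/
def timeWeight (t : ℝ) : ℝ := (1 + ‖t‖) ^ (-2 : ℝ)

/-- Polynomial decay in space-time. -/
def spaceWeight (q : (ℝ × ℝ) × ℝ) : ℝ := planeWeight q.1 * timeWeight q.2

theorem planeWeight_pos (z : ℝ × ℝ) : 0 < planeWeight z := by unfold planeWeight; positivity

theorem timeWeight_pos (t : ℝ) : 0 < timeWeight t := by unfold timeWeight; positivity

theorem spaceWeight_pos (q : (ℝ × ℝ) × ℝ) : 0 < spaceWeight q :=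
  mul_pos (planeWeight_pos _) (timeWeight_pos _)

theorem planeWeight_le_one (z : ℝ × ℝ) : planeWeight z ≤ 1 :=
  Real.rpow_le_one_of_one_le_of_nonpos (by linarith [norm_nonneg z]) (by norm_num)

theorem measurable_planeWeight : Measurable planeWeight := by unfold planeWeight; fun_prop

theorem measurable_timeWeight : Measurable timeWeight := by unfold timeWeight; fun_prop

theorem measurable_spaceWeight : Measurable spaceWeight :=
  (measurable_planeWeight.comp measurable_fst).mul (measurable_timeWeight.comp measurable_snd)

theorem integrable_planeWeight : Integrable planeWeight :=
  integrable_one_add_norm (by rw [Module.finrank_prod, Module.finrank_self]; norm_num)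

theorem integrable_timeWeight : Integrable timeWeight :=
  integrable_one_add_norm (by rw [Module.finrank_self]; norm_num)

theorem timeWeight_add_le {t : ℝ} (ht : |t| ≤ 1) (c : ℝ) :
    timeWeight (t + c) ≤ 4 * timeWeight c := by
  have h1 : 1 + ‖c‖ ≤ 2 * (1 + ‖t + c‖) := by
    have := norm_sub_le (t + c) t
    rw [add_sub_cancel_left, Real.norm_eq_abs t] at this
    linarith [norm_nonneg (t + c)]
  have h2 : 0 < 1 + ‖c‖ := by positivity
  have h3 : 0 < 1 + ‖t + c‖ := by positivity
  simp only [timeWeight, Real.rpow_neg h2.le, Real.rpow_neg h3.le, Real.rpow_ofNat]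
  rw [← div_eq_mul_inv, inv_eq_one_div, div_le_div_iff₀ (by positivity) (by positivity), one_mul]
  nlinarith

theorem measurable_eLpNorm_slice {v : (ℝ × ℝ) × ℝ → ℂ} (hv : Measurable v) {r : ℝ} (hr : 0 < r) :
    Measurable fun t => eLpNorm (fun z => v (z, t)) (ENNReal.ofReal r) volume := by
  simp_rw [eLpNorm_eq_lintegral_rpow_enorm_toReal (ENNReal.ofReal_pos.2 hr).ne'
    ENNReal.ofReal_ne_top]
  apply Measurable.pow_const
  have : Measurable fun q : (ℝ × ℝ) × ℝ => ‖v q‖ₑ ^ (ENNReal.ofReal r).toReal :=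
    hv.enorm.pow_const _
  exact this.lintegral_prod_left'

/-- Hölder with the conjugate exponent `2 / (1 + θ) ≥ 1`. The weight is at most `1`, so its power is
dominated by the weight itself. -/
theorem lintegral_planeWeight_mul_le {a : ℝ × ℝ → ℂ} (ha : Measurable a) {θ : ℝ} (hθ0 : 0 ≤ θ)
    (hθ1 : θ < 1) : ∫⁻ z, ENNReal.ofReal (planeWeight z) * ‖a z‖ₑ ≤
      (∫⁻ z, ENNReal.ofReal (planeWeight z)) ^ ((1 + θ) / 2) *
        eLpNorm a (ENNReal.ofReal (2 / (1 - θ))) volume := by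
  have h1 : 0 < 1 - θ := by linarith
  have h2 : 0 < 1 + θ := by linarith
  have hr : 0 < 2 / (1 - θ) := by positivity
  have hc : (2 / (1 + θ)).HolderConjugate (2 / (1 - θ)) := by
    constructor
    · rw [inv_one, inv_div, inv_div]; ring
    · positivity
    · positivity
  have hm := measurable_planeWeight
  refine (ENNReal.lintegral_mul_le_Lp_mul_Lq volume hc (f := fun z => ENNReal.ofReal (planeWeight z))
    (g := fun z => ‖a z‖ₑ) (by fun_prop) (by fun_prop)).trans ?_
  rw [eLpNorm_eq_lintegral_rpow_enorm_toReal (ENNReal.ofReal_pos.2 hr).ne'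
    ENNReal.ofReal_ne_top, ENNReal.toReal_ofReal hr.le, one_div_div (2 : ℝ) (1 + θ)]
  gcongr with z
  have hz : ENNReal.ofReal (planeWeight z) ≤ 1 := by
    rw [← ENNReal.ofReal_one]; exact ENNReal.ofReal_le_ofReal (planeWeight_le_one z)
  conv_rhs => rw [← ENNReal.rpow_one (ENNReal.ofReal (planeWeight z))]
  apply ENNReal.rpow_le_rpow_of_exponent_ge hz
  rw [le_div_iff₀ h2]; linarith

/-- The constant of the embedding into weighted `L¹`. -/
def weightConst (θ : ℝ) : ℝ≥0∞ :=
  8 * (∫⁻ z, ENNReal.ofReal (planeWeight z)) ^ ((1 + θ) / 2) * ∫⁻ t, ENNReal.ofReal (timeWeight t)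

theorem lintegral_ofReal_ne_top {X : Type*} [MeasurableSpace X] {μ : Measure X} {w : X → ℝ}
    (hw : Integrable w μ) (h0 : ∀ x, 0 ≤ w x) : ∫⁻ x, ENNReal.ofReal (w x) ∂μ ≠ ∞ := by
  rw [← ofReal_integral_eq_lintegral_ofReal hw (Filter.Eventually.of_forall h0)]
  exact ENNReal.ofReal_ne_top

theorem weightConst_ne_top {θ : ℝ} (hθ : 0 ≤ θ) : weightConst θ ≠ ∞ := by
  refine ENNReal.mul_ne_top (ENNReal.mul_ne_top (by norm_num)
    (ENNReal.rpow_ne_top_of_nonneg (by positivity) ?_)) ?_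
  · exact lintegral_ofReal_ne_top integrable_planeWeight fun z => (planeWeight_pos z).le
  · exact lintegral_ofReal_ne_top integrable_timeWeight fun z => (timeWeight_pos z).le

/-- The uniformly local mixed norm controls a weighted `L¹` norm. -/
theorem lintegral_spaceWeight_mul_le {v : (ℝ × ℝ) × ℝ → ℂ} (hv : Measurable v) {θ : ℝ}
    (hθ0 : 0 ≤ θ) (hθ1 : θ < 1) {M : ℝ≥0∞} (hM : ∀ c, localMixedNorm c (2 / ENNReal.ofReal θ)
      (ENNReal.ofReal (2 / (1 - θ))) v ≤ M) :
    ∫⁻ q, ENNReal.ofReal (spaceWeight q) * ‖v q‖ₑ ≤ weightConst θ * M := by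
  have h1 : 0 < 1 - θ := by linarith
  have hr : 0 < 2 / (1 - θ) := by positivity
  have hpm := measurable_planeWeight
  have htm := measurable_timeWeight
  have hsm := measurable_spaceWeight
  set n : ℝ → ℝ≥0∞ := fun t => eLpNorm (fun z => v (z, t)) (ENNReal.ofReal (2 / (1 - θ))) volume
    with hn
  have hnm : Measurable n := measurable_eLpNorm_slice hv hr
  set P := (∫⁻ z, ENNReal.ofReal (planeWeight z)) ^ ((1 + θ) / 2) with hP
  -- Hölder on an interval of length `2`, where `q ≥ 1` and `2^(1 - 1/q) ≤ 2`.
  have hloc : ∀ c, ∫⁻ t in Set.Icc (-1 : ℝ) 1, n (t + c) ≤ 2 * M := by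
    intro c
    have hq : (1 : ℝ≥0∞) ≤ 2 / ENNReal.ofReal θ := by
      rw [ENNReal.le_div_iff_mul_le (Or.inr (by norm_num)) (Or.inr (by norm_num)), one_mul]
      exact (ENNReal.ofReal_le_ofReal hθ1.le).trans (by norm_num)
    have h := eLpNorm_le_eLpNorm_mul_rpow_measure_univ (μ := volume.restrict (Set.Icc (-1 : ℝ) 1))
      (f := fun t => n (t + c)) hq (hnm.comp (measurable_add_const c)).aestronglyMeasurable
    rw [eLpNorm_one_eq_lintegral_enorm] at h
    simp only [enorm_eq_self] at h
    refine h.trans ?_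
    rw [mul_comm]
    refine mul_le_mul' ?_ (hM c)
    rw [Measure.restrict_apply_univ, Real.volume_Icc, show (1 : ℝ) - -1 = 2 by norm_num,
      ENNReal.ofReal_ofNat]
    conv_rhs => rw [← ENNReal.rpow_one 2]
    apply ENNReal.rpow_le_rpow_of_exponent_le (by norm_num)
    rw [ENNReal.toReal_one, div_one]
    have : 0 ≤ 1 / (2 / ENNReal.ofReal θ).toReal := by positivity
    linarith
  have hshift : ∀ s : ℝ, 2 * (ENNReal.ofReal (timeWeight s) * n s) =
      ∫⁻ t in Set.Icc (-1 : ℝ) 1, ENNReal.ofReal (timeWeight s) * n s := by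
    intro s
    rw [setLIntegral_const, Real.volume_Icc, show (1 : ℝ) - -1 = 2 by norm_num,
      ENNReal.ofReal_ofNat, mul_comm]
  -- Averaging over the shifts `s = t + c` with `|t| ≤ 1` replaces the integral over the line by a
  -- weighted integral over windows of length `2` about `c`. Within a window the weight is at most
  -- `4` times its value at `c`, and each window contributes at most `2M`; hence `8 = 4 * 2`.
  have htime : 2 * ∫⁻ s, ENNReal.ofReal (timeWeight s) * n s ≤
      8 * (∫⁻ t, ENNReal.ofReal (timeWeight t)) * M := by
    rw [← lintegral_const_mul' _ _ (by norm_num)]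
    simp_rw [hshift]
    calc _ = ∫⁻ t in Set.Icc (-1 : ℝ) 1, ∫⁻ s, ENNReal.ofReal (timeWeight s) * n s :=
          lintegral_lintegral_swap (by fun_prop)
      _ = ∫⁻ t in Set.Icc (-1 : ℝ) 1, ∫⁻ c, ENNReal.ofReal (timeWeight (t + c)) * n (t + c) := by
          refine lintegral_congr fun t => ?_
          exact (lintegral_add_left_eq_self (fun s => ENNReal.ofReal (timeWeight s) * n s) t).symm
      _ ≤ ∫⁻ t in Set.Icc (-1 : ℝ) 1, ∫⁻ c, 4 * ENNReal.ofReal (timeWeight c) * n (t + c) := by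
          refine setLIntegral_mono' measurableSet_Icc fun t ht => lintegral_mono fun c => ?_
          gcongr
          rw [← ENNReal.ofReal_ofNat, ← ENNReal.ofReal_mul (by norm_num)]
          exact ENNReal.ofReal_le_ofReal (timeWeight_add_le (abs_le.2 ht) c)
      _ = ∫⁻ c, ∫⁻ t in Set.Icc (-1 : ℝ) 1, 4 * ENNReal.ofReal (timeWeight c) * n (t + c) :=
          lintegral_lintegral_swap (by fun_prop)
      _ ≤ ∫⁻ c, 8 * ENNReal.ofReal (timeWeight c) * M := by
          refine lintegral_mono fun c => ?_
          rw [lintegral_const_mul _ (by fun_prop)]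
          refine (mul_le_mul_right (hloc c) _).trans (le_of_eq ?_)
          rw [show (8 : ℝ≥0∞) = 4 * 2 by norm_num]
          ring
      _ = _ := by
          rw [lintegral_mul_const _ (by fun_prop), lintegral_const_mul _ (by fun_prop)]
  have hmain : ∫⁻ q, ENNReal.ofReal (spaceWeight q) * ‖v q‖ₑ ≤
      P * ∫⁻ s, ENNReal.ofReal (timeWeight s) * n s := by
    have hmeas : Measurable fun q => ENNReal.ofReal (spaceWeight q) * ‖v q‖ₑ := by fun_prop
    rw [Measure.volume_eq_prod, lintegral_prod_symm' _ hmeas, ← lintegral_const_mul _ (by fun_prop)]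
    refine lintegral_mono fun s => ?_
    simp only [spaceWeight]
    simp_rw [ENNReal.ofReal_mul (planeWeight_pos _).le, mul_comm (ENNReal.ofReal (planeWeight _)),
      mul_assoc]
    rw [lintegral_const_mul _ (by fun_prop)]
    refine (mul_le_mul_right (lintegral_planeWeight_mul_le
      (hv.comp (by fun_prop : Measurable fun z : ℝ × ℝ => (z, s))) hθ0 hθ1) _).trans
      (le_of_eq ?_)
    simp only [hn, hP, Function.comp_def]
    ring
  calc _ ≤ P * (2 * ∫⁻ s, ENNReal.ofReal (timeWeight s) * n s) := by
        refine hmain.trans (mul_le_mul_right ?_ _)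
        exact le_mul_of_one_le_left zero_le (by norm_num)
    _ ≤ P * (8 * (∫⁻ t, ENNReal.ofReal (timeWeight t)) * M) := mul_le_mul_right htime _
    _ = _ := by rw [weightConst]; ring

/-! ### Removing the cut-offs -/

/-- Fatou's lemma for `L^q` norms of nonnegative functions, `q = ∞` included. -/
theorem eLpNorm_liminf_le_of_le {X : Type*} [MeasurableSpace X] {μ : Measure X}
    {n : ℕ → X → ℝ≥0∞} (hn : ∀ k, AEMeasurable (n k) μ) {q M : ℝ≥0∞} (hq : q ≠ 0)
    (h : ∀ k, eLpNorm (n k) q μ ≤ M) :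
    eLpNorm (fun x => Filter.liminf (fun k => n k x) Filter.atTop) q μ ≤ M := by
  by_cases hqt : q = ∞
  · subst hqt
    simp_rw [eLpNorm_exponent_top] at h ⊢
    apply eLpNormEssSup_le_of_ae_enorm_bound
    have : ∀ᵐ x ∂μ, ∀ k, n k x ≤ M := by
      rw [ae_all_iff]
      intro k
      filter_upwards [enorm_ae_le_eLpNormEssSup (n k) μ] with x hx
      exact hx.trans (h k)
    filter_upwards [this] with x hx
    exact Filter.liminf_le_of_frequently_le' (Filter.Frequently.of_forall hx)
  · have hq0 : 0 < q.toReal := ENNReal.toReal_pos hq hqt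
    simp_rw [eLpNorm_eq_lintegral_rpow_enorm_toReal hq hqt, one_div, ENNReal.rpow_inv_le_iff hq0,
      enorm_eq_self] at h ⊢
    have e : ∀ x, Filter.liminf (fun k => n k x) Filter.atTop ^ q.toReal =
        Filter.liminf (fun k => n k x ^ q.toReal) Filter.atTop := fun x =>
      (ENNReal.orderIsoRpow q.toReal hq0).liminf_apply
    simp_rw [e]
    refine (lintegral_liminf_le' fun k => (hn k).pow_const _).trans ?_
    exact Filter.liminf_le_of_frequently_le' (Filter.Frequently.of_forall h)

/-- Fatou twice: in `(x, y)` on almost every time slice, then in time. -/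
theorem localMixedNorm_le_of_tendsto {v : ℕ → (ℝ × ℝ) × ℝ → ℂ} (hv : ∀ n, Measurable (v n))
    {u : (ℝ × ℝ) × ℝ → ℂ} (hu : ∀ᵐ x, Filter.Tendsto (fun n => v n x) Filter.atTop (nhds (u x)))
    {q M : ℝ≥0∞} {r : ℝ} (hq : q ≠ 0) (hr : 0 < r)
    (h : ∀ n, localMixedNorm 0 q (ENNReal.ofReal r) (v n) ≤ M) :
    localMixedNorm 0 q (ENNReal.ofReal r) u ≤ M := by
  simp only [localMixedNorm, add_zero] at h ⊢
  refine le_trans (eLpNorm_mono_enorm_ae ?_) (eLpNorm_liminf_le_of_le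
    (fun n => (measurable_eLpNorm_slice (hv n) hr).aemeasurable) hq h)
  rw [Measure.volume_eq_prod] at hu
  have h2 := Measure.ae_ae_of_ae_prod
    ((Measure.measurePreserving_swap (μ := (volume : Measure ℝ))
      (ν := (volume : Measure (ℝ × ℝ)))).quasiMeasurePreserving.ae hu)
  filter_upwards [ae_restrict_of_ae h2] with t ht
  rw [enorm_eq_self, enorm_eq_self]
  exact Lp.eLpNorm_lim_le_liminf_eLpNorm
    (fun n => ((hv n).comp (by fun_prop : Measurable fun z : ℝ × ℝ => (z, t))).aestronglyMeasurable)
    _ ht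

theorem absAmplitude_sub (s : ℝ) (G H : (ℝ × ℝ) × ℝ → ℂ) :
    absAmplitude s (G - H) = absAmplitude s G - absAmplitude s H := by
  ext k; simp only [absAmplitude, Pi.sub_apply]; ring

theorem spaceTransform_sub {A B : (ℝ × ℝ) × ℝ → ℂ} (hA : Integrable A) (hB : Integrable B)
    (q : (ℝ × ℝ) × ℝ) : spaceTransform (A - B) q = spaceTransform A q - spaceTransform B q := by
  simp only [spaceTransform, Pi.sub_apply, sub_mul]
  exact integral_sub (integrable_mul_spaceWave hA q) (integrable_mul_spaceWave hB q)

namespace IsBandLimited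

variable {α N N' Λ : ℝ} {G H : (ℝ × ℝ) × ℝ → ℂ}

theorem mono (h : IsBandLimited α N Λ G) (hN : 0 < N) (hNN : N ≤ N') : IsBandLimited α N' Λ G where
  measurable := h.measurable
  bounded := h.bounded
  support k hk := by
    obtain ⟨h1, h2, h3, h4, h5⟩ := h.support k hk
    exact ⟨(inv_anti₀ hN hNN).trans h1, h2.trans hNN, h3.trans hNN, h4.trans hNN, h5⟩

theorem sub (hG : IsBandLimited α N Λ G) (hH : IsBandLimited α N Λ H) :
    IsBandLimited α N Λ (G - H) where
  measurable := hG.measurable.sub hH.measurable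
  bounded := by
    obtain ⟨B, hB⟩ := hG.bounded
    obtain ⟨C, hC⟩ := hH.bounded
    exact ⟨B + C, fun k => (norm_sub_le _ _).trans (add_le_add (hB k) (hC k))⟩
  support k hk := by
    by_cases h : G k = 0
    · exact hH.support k fun h' => hk (by rw [Pi.sub_apply, h, h', sub_zero])
    · exact hG.support k h

end IsBandLimited

/-- The truncation of an amplitude to a bounded one with bounded support away from `ξ = 0`. -/
def bandTrunc (G : (ℝ × ℝ) × ℝ → ℂ) (n : ℕ) : (ℝ × ℝ) × ℝ → ℂ :=
  {k : (ℝ × ℝ) × ℝ | ((n : ℝ) + 1)⁻¹ ≤ |2 * Real.pi * k.1.1| ∧ |2 * Real.pi * k.1.1| ≤ n + 1 ∧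
    |2 * Real.pi * k.1.2| ≤ n + 1 ∧ |2 * Real.pi * k.2| ≤ n + 1 ∧ ‖G k‖ ≤ n + 1}.indicator G

theorem norm_bandTrunc_le (G : (ℝ × ℝ) × ℝ → ℂ) (n : ℕ) (k : (ℝ × ℝ) × ℝ) :
    ‖bandTrunc G n k‖ ≤ ‖G k‖ := norm_indicator_le_norm_self _ _

theorem isBandLimited_bandTrunc {α Λ : ℝ} {G : (ℝ × ℝ) × ℝ → ℂ} (hG : Measurable G)
    (hΛ : ∀ k, G k ≠ 0 →
      |2 * Real.pi * k.2 - omega α (2 * Real.pi * k.1.1) (2 * Real.pi * k.1.2)| ≤ Λ) (n : ℕ) :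
    IsBandLimited α (n + 1) Λ (bandTrunc G n) where
  measurable := by
    apply hG.indicator
    have ha : Measurable fun x : ℝ => |x| := measurable_norm
    have h1 : Measurable fun k : (ℝ × ℝ) × ℝ => |2 * Real.pi * k.1.1| :=
      ha.comp (g := fun x : ℝ => |x|) (f := fun k : (ℝ × ℝ) × ℝ => 2 * Real.pi * k.1.1) (by fun_prop)
    have h2 : Measurable fun k : (ℝ × ℝ) × ℝ => |2 * Real.pi * k.1.2| :=
      ha.comp (g := fun x : ℝ => |x|) (f := fun k : (ℝ × ℝ) × ℝ => 2 * Real.pi * k.1.2) (by fun_prop)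
    have h3 : Measurable fun k : (ℝ × ℝ) × ℝ => |2 * Real.pi * k.2| :=
      ha.comp (g := fun x : ℝ => |x|) (f := fun k : (ℝ × ℝ) × ℝ => 2 * Real.pi * k.2) (by fun_prop)
    exact (measurableSet_le measurable_const h1).inter ((measurableSet_le h1 measurable_const).inter
      ((measurableSet_le h2 measurable_const).inter ((measurableSet_le h3 measurable_const).inter
        (measurableSet_le hG.norm measurable_const))))
  bounded := by
    refine ⟨n + 1, fun k => ?_⟩
    by_cases h : bandTrunc G n k = 0
    · rw [h, norm_zero]; positivity
    · exact (norm_bandTrunc_le G n k).trans (Set.mem_of_indicator_ne_zero h).2.2.2.2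
  support k hk := by
    obtain ⟨h1, h2, h3, h4, -⟩ := Set.mem_of_indicator_ne_zero hk
    refine ⟨h1, h2, h3, h4, hΛ k fun h => hk ?_⟩
    have := norm_bandTrunc_le G n k
    rwa [h, norm_zero, norm_le_zero_iff] at this

theorem eventually_bandTrunc_eq (G : (ℝ × ℝ) × ℝ → ℂ) {k : (ℝ × ℝ) × ℝ} (hk : k.1.1 ≠ 0) :
    ∀ᶠ n in Filter.atTop, bandTrunc G n k = G k := by
  have hk' : 0 < |2 * Real.pi * k.1.1| := abs_pos.2 (by positivity)
  have key : ∀ x : ℝ, ∀ᶠ n : ℕ in Filter.atTop, x ≤ n + 1 := fun x => by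
    obtain ⟨m, hm⟩ := exists_nat_ge x
    filter_upwards [Filter.eventually_ge_atTop m] with n hn
    have : (m : ℝ) ≤ n := by exact_mod_cast hn
    linarith
  filter_upwards [key |2 * Real.pi * k.1.1|⁻¹, key |2 * Real.pi * k.1.1|, key |2 * Real.pi * k.1.2|,
    key |2 * Real.pi * k.2|, key ‖G k‖] with n h1 h2 h3 h4 h5
  refine Set.indicator_of_mem ?_ _
  exact ⟨(inv_le_comm₀ hk' (by positivity)).1 h1, h2, h3, h4, h5⟩

theorem ae_fst_fst_ne_zero : ∀ᵐ k : (ℝ × ℝ) × ℝ, k.1.1 ≠ 0 := by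
  have h1 : ∀ᵐ p : ℝ × ℝ, p.1 ≠ 0 := Measure.quasiMeasurePreserving_fst.ae (Measure.ae_ne volume 0)
  exact Measure.quasiMeasurePreserving_fst.ae h1

theorem tendsto_eLpNorm_bandTrunc_sub {G : (ℝ × ℝ) × ℝ → ℂ} (hG : Measurable G) (h2 : MemLp G 2)
    (hm : ∀ n, Measurable (bandTrunc G n)) :
    Filter.Tendsto (fun n => eLpNorm (bandTrunc G n - G) 2 volume) Filter.atTop (nhds 0) := by
  have h : Filter.Tendsto (fun n => ∫⁻ k, ‖bandTrunc G n k - G k‖ₑ ^ (2 : ℝ)) Filter.atTop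
      (nhds (∫⁻ _ : (ℝ × ℝ) × ℝ, 0)) := by
    refine tendsto_lintegral_of_dominated_convergence (fun k => ‖G k‖ₑ ^ (2 : ℝ))
      (fun n => ((hm n).sub hG).enorm.pow_const _) (fun n => Filter.Eventually.of_forall fun k => ?_)
      ?_ ?_
    · refine ENNReal.rpow_le_rpow ?_ (by norm_num)
      by_cases h : bandTrunc G n k = 0
      · rw [h, zero_sub, enorm_neg]
      · rw [bandTrunc, Set.indicator_of_mem (Set.mem_of_indicator_ne_zero h), sub_self, enorm_zero]
        exact zero_le
    · have := lintegral_rpow_enorm_lt_top_of_eLpNorm_lt_top two_ne_zero ENNReal.ofNat_ne_top h2.2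
      rw [ENNReal.toReal_ofNat] at this
      exact this.ne
    · filter_upwards [ae_fst_fst_ne_zero] with k hk
      apply tendsto_const_nhds.congr'
      filter_upwards [eventually_bandTrunc_eq G hk] with n hn
      rw [hn, sub_self, enorm_zero, ENNReal.zero_rpow_of_pos (by norm_num)]
  rw [lintegral_zero] at h
  have h' := (ENNReal.continuous_rpow_const (y := 1 / 2)).tendsto 0 |>.comp h
  rw [ENNReal.zero_rpow_of_pos (by norm_num)] at h'
  refine h'.congr fun n => ?_
  rw [eLpNorm_eq_lintegral_rpow_enorm_toReal (by norm_num) (by norm_num), ENNReal.toReal_ofNat]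
  rfl

theorem memLp_weighted_spaceTransform {A : (ℝ × ℝ) × ℝ → ℂ} (hA : Integrable A) :
    MemLp (fun q => (spaceWeight q : ℂ) * spaceTransform A q) 1 := by
  have hw : Integrable spaceWeight := integrable_planeWeight.mul_prod integrable_timeWeight
  rw [memLp_one_iff_integrable]
  refine (hw.mul_const (∫ k, ‖A k‖)).mono' ?_ (Filter.Eventually.of_forall fun q => ?_)
  · exact ((Complex.measurable_ofReal.comp measurable_spaceWeight).mul
      (continuous_spaceTransform hA).measurable).aestronglyMeasurable
  · rw [norm_mul, Complex.norm_real, Real.norm_of_nonneg (spaceWeight_pos q).le]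
    exact mul_le_mul_of_nonneg_left (norm_spaceTransform_le A q) (spaceWeight_pos q).le

/-- By linearity the Strichartz estimate applies to `G - H`, on all unit windows at once. The
constant does not involve `N`, which makes the truncations a Cauchy sequence. -/
theorem eLpNorm_weighted_sub_le {α N Λ θ : ℝ} (hN : 1 ≤ N) (hΛ : 0 ≤ Λ) (hθ0 : 0 ≤ θ)
    (hθ1 : θ < 1) {G H : (ℝ × ℝ) × ℝ → ℂ} (hG : IsBandLimited α N Λ G)
    (hH : IsBandLimited α N Λ H) :
    eLpNorm ((fun q => (spaceWeight q : ℂ) * spaceTransform (absAmplitude (θ / 2) G) q) -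
      fun q => (spaceWeight q : ℂ) * spaceTransform (absAmplitude (θ / 2) H) q) 1 volume ≤
      weightConst θ * ENNReal.ofReal (strichartzConst α θ * Λ) ^ (1 / 2 : ℝ) *
        eLpNorm (G - H) 2 volume := by
  have hs : 0 ≤ θ / 2 := by positivity
  have hGH := hG.sub hH
  have h := lintegral_spaceWeight_mul_le
    (continuous_spaceTransform (hGH.integrable_absAmplitude hs)).measurable hθ0 hθ1
    (localMixedNorm_spaceTransform_le hN hΛ hθ0 hθ1 hGH)
  rw [mul_assoc]
  refine le_trans (le_of_eq ?_) h
  rw [eLpNorm_one_eq_lintegral_enorm]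
  refine lintegral_congr fun q => ?_
  rw [Pi.sub_apply, ← mul_sub, absAmplitude_sub, spaceTransform_sub (hG.integrable_absAmplitude hs)
    (hH.integrable_absAmplitude hs), enorm_mul, ← ofReal_norm ((spaceWeight q : ℝ) : ℂ),
    Complex.norm_real, Real.norm_of_nonneg (spaceWeight_pos q).le]

/-- The weighted truncated solutions form a Cauchy sequence in `L¹`. -/
theorem exists_weighted_limit {α Λ θ : ℝ} (hΛ : 0 ≤ Λ) (hθ0 : 0 ≤ θ) (hθ1 : θ < 1)
    {G : (ℝ × ℝ) × ℝ → ℂ} (hG : Measurable G) (hG2 : MemLp G 2) (hS : ∀ k, G k ≠ 0 →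
      |2 * Real.pi * k.2 - omega α (2 * Real.pi * k.1.1) (2 * Real.pi * k.1.2)| ≤ Λ)
    (hf : ∀ n, MemLp (fun q => (spaceWeight q : ℂ) *
      spaceTransform (absAmplitude (θ / 2) (bandTrunc G n)) q) 1) :
    ∃ F : Lp ℂ 1 (volume : Measure ((ℝ × ℝ) × ℝ)),
      Filter.Tendsto (fun n => (hf n).toLp _) Filter.atTop (nhds F) := by
  have hB := isBandLimited_bandTrunc hG hS
  set K := weightConst θ * ENNReal.ofReal (strichartzConst α θ * Λ) ^ (1 / 2 : ℝ) with hK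
  have hKt : K ≠ ∞ := ENNReal.mul_ne_top (weightConst_ne_top hθ0)
    (ENNReal.rpow_ne_top_of_nonneg (by norm_num) ENNReal.ofReal_ne_top)
  apply cauchySeq_tendsto_of_complete
  have hlim := tendsto_eLpNorm_bandTrunc_sub hG hG2 fun n => (hB n).measurable
  rw [EMetric.cauchySeq_iff]
  intro ε hε
  have hlim3 := (ENNReal.tendsto_atTop_zero.1 (ENNReal.Tendsto.const_mul (a := K) hlim
    (Or.inr hKt) |>.trans (by rw [mul_zero])) (ε / 3) (ENNReal.div_pos hε.ne' (by norm_num)))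
  obtain ⟨N, hN⟩ := hlim3
  by_cases hεt : ε = ∞
  · exact ⟨0, fun m _ n _ => hεt ▸ (edist_ne_top _ _).lt_top⟩
  refine ⟨N, fun m hm n hn => ?_⟩
  -- Both truncations are viewed as band limited with a common cut-off.
  have hmn : ∀ l ≤ max m n, IsBandLimited α ((max m n : ℕ) + 1) Λ (bandTrunc G l) := fun l hl =>
    (hB l).mono (by positivity) (by gcongr)
  rw [Lp.edist_toLp_toLp]
  refine (eLpNorm_weighted_sub_le (by simp) hΛ hθ0 hθ1 (hmn m (le_max_left _ _))
    (hmn n (le_max_right _ _))).trans_lt ?_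
  have tri : eLpNorm (bandTrunc G m - bandTrunc G n) 2 volume ≤
      eLpNorm (bandTrunc G m - G) 2 volume + eLpNorm (bandTrunc G n - G) 2 volume := by
    rw [← sub_sub_sub_cancel_right (bandTrunc G m) (bandTrunc G n) G]
    exact eLpNorm_sub_le ((hB m).measurable.sub hG).aestronglyMeasurable
      ((hB n).measurable.sub hG).aestronglyMeasurable one_le_two
  calc _ ≤ K * (eLpNorm (bandTrunc G m - G) 2 volume + eLpNorm (bandTrunc G n - G) 2 volume) := by
        gcongr
    _ ≤ ε / 3 + ε / 3 := by rw [mul_add]; exact add_le_add (hN m hm) (hN n hn)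
    _ < ε := by
        conv_rhs => rw [← ENNReal.add_thirds ε]
        refine ENNReal.lt_add_right ?_ (ENNReal.div_pos hε.ne' (by norm_num)).ne'
        exact ENNReal.add_ne_top.2 ⟨ENNReal.div_ne_top hεt (by norm_num),
          ENNReal.div_ne_top hεt (by norm_num)⟩

/-- The Strichartz estimate for amplitudes in `L²` near the characteristic surface. The function `u`
is the inverse Fourier transform of `absAmplitude (θ / 2) G`, in the weak sense. -/
theorem exists_strichartz {α Λ θ : ℝ} (hΛ : 0 ≤ Λ) (hθ0 : 0 ≤ θ) (hθ1 : θ < 1)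
    {G : (ℝ × ℝ) × ℝ → ℂ} (hG : Measurable G) (hG2 : MemLp G 2) (hS : ∀ k, G k ≠ 0 →
      |2 * Real.pi * k.2 - omega α (2 * Real.pi * k.1.1) (2 * Real.pi * k.1.2)| ≤ Λ) :
    ∃ u : (ℝ × ℝ) × ℝ → ℂ, Measurable u ∧
      localMixedNorm 0 (2 / ENNReal.ofReal θ) (ENNReal.ofReal (2 / (1 - θ))) u ≤
        ENNReal.ofReal (strichartzConst α θ * Λ) ^ (1 / 2 : ℝ) * eLpNorm G 2 volume ∧
      ∀ ψ : (ℝ × ℝ) × ℝ → ℂ, AEStronglyMeasurable ψ volume → (∃ K, ∀ q, ‖ψ q‖ ≤ K * spaceWeight q) →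
        Integrable (fun q => u q * ψ q) ∧
        (MemLp (absAmplitude (θ / 2) (spaceTransform ψ)) 2 →
          ∫ q, u q * ψ q = ∫ k, absAmplitude (θ / 2) G k * spaceTransform ψ k) := by
  have hs : 0 ≤ θ / 2 := by positivity
  have h1θ : 0 < 1 - θ := by linarith
  have hB := isBandLimited_bandTrunc hG hS
  have hA : ∀ n, Integrable (absAmplitude (θ / 2) (bandTrunc G n)) := fun n =>
    (hB n).integrable_absAmplitude hs
  set v : ℕ → (ℝ × ℝ) × ℝ → ℂ := fun n => spaceTransform (absAmplitude (θ / 2) (bandTrunc G n))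
    with hv
  have hvc : ∀ n, Continuous (v n) := fun n => continuous_spaceTransform (hA n)
  have hf := fun n => memLp_weighted_spaceTransform (hA n)
  obtain ⟨F, hF⟩ := exists_weighted_limit hΛ hθ0 hθ1 hG hG2 hS hf
  have hw0 : ∀ q, (spaceWeight q : ℂ) ≠ 0 := fun q => by exact_mod_cast (spaceWeight_pos q).ne'
  have hwn : ∀ q, ‖(spaceWeight q : ℂ)‖ = spaceWeight q := fun q => by
    rw [Complex.norm_real, Real.norm_of_nonneg (spaceWeight_pos q).le]
  set u : (ℝ × ℝ) × ℝ → ℂ := fun q => (spaceWeight q : ℂ)⁻¹ * F q with hu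
  have hum : Measurable u := (Complex.measurable_ofReal.comp measurable_spaceWeight).inv.mul
    (Lp.stronglyMeasurable F).measurable
  have hwu : ∀ q, (spaceWeight q : ℂ) * u q = F q := fun q => by
    rw [hu]; simp only; rw [← mul_assoc, mul_inv_cancel₀ (hw0 q), one_mul]
  refine ⟨u, hum, ?_, ?_⟩
  · obtain ⟨ns, hns, hae⟩ := (tendstoInMeasure_of_tendsto_Lp hF).exists_seq_tendsto_ae
    refine localMixedNorm_le_of_tendsto (v := fun i => v (ns i)) (fun i => (hvc _).measurable) ?_ ?_
      (by positivity) fun i => ?_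
    · have hall : ∀ᵐ q, ∀ n, (hf n).toLp _ q = (spaceWeight q : ℂ) * v n q := by
        rw [ae_all_iff]; exact fun n => (hf n).coeFn_toLp
      filter_upwards [hae, hall] with q h1 h2
      simp_rw [h2] at h1
      have h3 := h1.const_mul ((spaceWeight q : ℂ)⁻¹)
      simp_rw [← mul_assoc, inv_mul_cancel₀ (hw0 q), one_mul] at h3
      exact h3
    · exact ENNReal.div_ne_zero.2 ⟨two_ne_zero, ENNReal.ofReal_ne_top⟩
    · refine (localMixedNorm_spaceTransform_le (by simp) hΛ hθ0 hθ1 (hB (ns i)) 0).trans ?_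
      gcongr 1
      exact eLpNorm_mono fun k => norm_bandTrunc_le G _ k
  · rintro ψ hψm ⟨K, hK⟩
    have hψ : Integrable ψ :=
      ((integrable_planeWeight.mul_prod integrable_timeWeight).const_mul K).mono' hψm
        (Filter.Eventually.of_forall hK)
    have hFi : Integrable F := memLp_one_iff_integrable.1 (Lp.memLp F)
    refine ⟨?_, fun hφ => ?_⟩
    · refine (hFi.norm.const_mul K).mono' (hum.aestronglyMeasurable.mul hψm)
        (Filter.Eventually.of_forall fun q => ?_)
      have hFq : ‖F q‖ = spaceWeight q * ‖u q‖ := by rw [← hwu q, norm_mul, hwn]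
      change ‖u q * ψ q‖ ≤ K * ‖F q‖
      rw [hFq, norm_mul]
      calc _ ≤ ‖u q‖ * (K * spaceWeight q) := by gcongr; exact hK q
        _ = _ := by ring
    · have hvi : ∀ n, Integrable fun q => v n q * ψ q := fun n =>
        (hψ.norm.const_mul (∫ k, ‖absAmplitude (θ / 2) (bandTrunc G n) k‖)).mono'
          ((hvc n).aestronglyMeasurable.mul hψm) (Filter.Eventually.of_forall fun q => by
            rw [norm_mul]; gcongr; exact norm_spaceTransform_le _ _)
      -- Since `‖ψ‖ ≤ K * spaceWeight`, convergence in weighted `L¹` is enough.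
      have l1 : Filter.Tendsto (fun n => ∫ q, v n q * ψ q) Filter.atTop (nhds (∫ q, u q * ψ q)) := by
        refine tendsto_integral_of_L1 _ (hum.aestronglyMeasurable.mul hψm)
          (Filter.Eventually.of_forall hvi) ?_
        have hF' := (Lp.tendsto_Lp_iff_tendsto_eLpNorm' _ _).1 hF
        have hF2 := ENNReal.Tendsto.const_mul (a := ENNReal.ofReal K) hF'
          (Or.inr ENNReal.ofReal_ne_top)
        rw [mul_zero] at hF2
        refine tendsto_of_tendsto_of_tendsto_of_le_of_le tendsto_const_nhds hF2
          (fun _ => zero_le) fun n => ?_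
        simp only
        rw [eLpNorm_one_eq_lintegral_enorm, ← lintegral_const_mul' _ _ ENNReal.ofReal_ne_top]
        apply lintegral_mono_ae
        filter_upwards [(hf n).coeFn_toLp] with q hq
        have hK0 : 0 ≤ K := by
          have := (norm_nonneg _).trans (hK q)
          exact nonneg_of_mul_nonneg_left this (spaceWeight_pos q)
        rw [Pi.sub_apply, hq, ← hwu q, ← mul_sub]
        change ‖v n q * ψ q - u q * ψ q‖ₑ ≤ ENNReal.ofReal K * ‖_ * (v n q - u q)‖ₑ
        rw [← sub_mul, ← ofReal_norm, ← ofReal_norm,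
          ← ENNReal.ofReal_mul hK0]
        apply ENNReal.ofReal_le_ofReal
        rw [norm_mul, norm_mul, hwn]
        calc _ ≤ ‖v n q - u q‖ * (K * spaceWeight q) := by gcongr; exact hK q
          _ = _ := by ring
      -- The factor `|ξ|^(θ/2)` is moved onto the transform of `ψ`, where it stays in `L²` by
      -- hypothesis. The product with `G ∈ L²` is integrable and dominates all the truncations.
      have l2 : Filter.Tendsto (fun n => ∫ q, v n q * ψ q) Filter.atTop
          (nhds (∫ k, absAmplitude (θ / 2) G k * spaceTransform ψ k)) := by
        have e : ∀ n, ∫ q, v n q * ψ q =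
            ∫ k, bandTrunc G n k * absAmplitude (θ / 2) (spaceTransform ψ) k := fun n => by
          rw [hv, integral_spaceTransform_mul_eq (hA n) hψ]
          congr 1; ext k
          simp only [absAmplitude]; ring
        have e2 : ∫ k, absAmplitude (θ / 2) G k * spaceTransform ψ k =
            ∫ k, G k * absAmplitude (θ / 2) (spaceTransform ψ) k := by
          congr 1; ext k
          simp only [absAmplitude]; ring
        simp_rw [e, e2]
        refine tendsto_integral_of_dominated_convergence
          (fun k => ‖G k‖ * ‖absAmplitude (θ / 2) (spaceTransform ψ) k‖)
          (fun n => (hB n).measurable.aestronglyMeasurable.mul hφ.1)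
          (hG2.norm.integrable_mul hφ.norm) (fun n => Filter.Eventually.of_forall fun k => ?_) ?_
        · rw [norm_mul]
          gcongr
          exact norm_bandTrunc_le G n k
        · filter_upwards [ae_fst_fst_ne_zero] with k hk
          apply tendsto_const_nhds.congr'
          filter_upwards [eventually_bandTrunc_eq G hk] with n hn
          rw [hn]
      exact tendsto_nhds_unique l1 l2

/-! ### Coordinates on space-time and Schwartz functions -/

/-- Product coordinates on space-time. -/
def spaceEquiv : SpaceTime ≃ᵐ (ℝ × ℝ) × ℝ where
  toFun η := ((η 0, η 1), η 2)
  invFun q := !₂[q.1.1, q.1.2, q.2]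
  left_inv η := by ext i; fin_cases i <;> rfl
  right_inv q := rfl
  measurable_toFun := by
    change Measurable fun η : SpaceTime => ((η 0, η 1), η 2)
    fun_prop
  measurable_invFun := by
    change Measurable fun q : (ℝ × ℝ) × ℝ => (!₂[q.1.1, q.1.2, q.2] : SpaceTime)
    apply (MeasurableEquiv.toLp 2 (Fin 3 → ℝ)).measurable.comp
    rw [measurable_pi_iff]
    intro i
    fin_cases i
    · exact measurable_fst.comp measurable_fst
    · exact measurable_snd.comp measurable_fst
    · exact measurable_snd

theorem spaceEquiv_apply (η : SpaceTime) : spaceEquiv η = ((η 0, η 1), η 2) := rfl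

theorem spaceEquiv_symm_apply_zero (q : (ℝ × ℝ) × ℝ) : spaceEquiv.symm q 0 = q.1.1 := rfl

theorem measurePreserving_spaceEquiv : MeasurePreserving spaceEquiv := by
  have h1 := PiLp.volume_preserving_ofLp (Fin 3)
  have h2 := volume_preserving_piFinSuccAbove (fun _ : Fin 3 => ℝ) (Fin.last 2)
  have h3 := (MeasurePreserving.id (volume : Measure ℝ)).prod (volume_preserving_finTwoArrow ℝ)
  have h4 := Measure.measurePreserving_swap (μ := (volume : Measure ℝ))
    (ν := (volume : Measure (ℝ × ℝ)))
  exact h4.comp (h3.comp (h2.comp h1))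

theorem norm_spaceEquiv_fst_le (η : SpaceTime) : ‖(spaceEquiv η).1‖ ≤ ‖η‖ := by
  rw [spaceEquiv_apply, Prod.norm_def]
  exact sup_le (PiLp.norm_apply_le η 0) (PiLp.norm_apply_le η 1)

/-- Rapid decay of Schwartz functions. -/
theorem SchwartzMap.exists_norm_le (φ : 𝓢(SpaceTime, ℂ)) (k : ℕ) :
    ∃ K, 0 ≤ K ∧ ∀ η, ‖φ η‖ * (1 + ‖η‖) ^ k ≤ K := by
  refine ⟨2 ^ k * ((Finset.Iic (k, 0)).sup fun m => SchwartzMap.seminorm ℂ m.1 m.2) φ,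
    by positivity, fun η => ?_⟩
  have := SchwartzMap.one_add_le_sup_seminorm_apply (𝕜 := ℂ) (m := (k, 0)) le_rfl le_rfl φ η
  rwa [norm_iteratedFDeriv_zero, mul_comm] at this

/-- Decay of order `5 = 3 + 2` in `‖η‖` splits into the orders `3` and `2` of the two weights, since
`‖η‖` dominates the norms of both components. -/
theorem SchwartzMap.exists_norm_le_spaceWeight (φ : 𝓢(SpaceTime, ℂ)) :
    ∃ K, ∀ η, ‖φ η‖ ≤ K * spaceWeight (spaceEquiv η) := by
  obtain ⟨K, hK0, hK⟩ := φ.exists_norm_le 5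
  refine ⟨K, fun η => ?_⟩
  have h1 := norm_spaceEquiv_fst_le η
  have h2 : ‖(spaceEquiv η).2‖ ≤ ‖η‖ := PiLp.norm_apply_le η 2
  have p1 : 0 < 1 + ‖(spaceEquiv η).1‖ := by positivity
  have p2 : 0 < 1 + ‖(spaceEquiv η).2‖ := by positivity
  rw [spaceWeight, planeWeight, timeWeight, Real.rpow_neg p1.le, Real.rpow_neg p2.le,
    Real.rpow_ofNat, Real.rpow_ofNat, ← mul_inv, ← div_eq_mul_inv, le_div_iff₀ (by positivity)]
  refine le_trans ?_ (hK η)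
  rw [show 5 = 3 + 2 from rfl, pow_add]
  gcongr

/-- The factor `|ξ|^s` costs at most one power of `1 + ‖η‖`, so decay of order `3` leaves order `2`.
Its square has order `4`, which exceeds the dimension `3`. -/
theorem memLp_abs_rpow_mul (φ : 𝓢(SpaceTime, ℂ)) {s : ℝ} (hs0 : 0 ≤ s) (hs1 : s ≤ 1) :
    MemLp (fun η : SpaceTime => ((|2 * Real.pi * η 0| ^ s : ℝ) : ℂ) * φ η) 2 := by
  obtain ⟨K, hK0, hK⟩ := φ.exists_norm_le 3
  have hw : MemLp (fun η : SpaceTime => (1 + ‖η‖) ^ (-2 : ℝ)) 2 := by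
    rw [memLp_two_iff_integrable_sq (by measurability)]
    have : Integrable fun η : SpaceTime => (1 + ‖η‖) ^ (-4 : ℝ) :=
      integrable_one_add_norm (by rw [finrank_euclideanSpace_fin]; norm_num)
    refine this.congr (Filter.Eventually.of_forall fun η => ?_)
    simp only
    rw [← Real.rpow_natCast, ← Real.rpow_mul (by positivity)]
    norm_num
  refine (hw.const_mul (2 * Real.pi * K)).of_le ?_ (Filter.Eventually.of_forall fun η => ?_)
  · refine AEStronglyMeasurable.mul ?_ φ.continuous.aestronglyMeasurable
    have hc : Continuous fun η : SpaceTime => |2 * Real.pi * η 0| ^ s :=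
      (by fun_prop : Continuous fun η : SpaceTime => |2 * Real.pi * η 0|).rpow_const
        fun _ => Or.inr hs0
    exact (Complex.continuous_ofReal.comp hc).aestronglyMeasurable
  · have hp : 0 < 1 + ‖η‖ := by positivity
    have hpi := Real.pi_gt_three
    have h1 : |2 * Real.pi * η 0| ^ s ≤ 2 * Real.pi * (1 + ‖η‖) := by
      have h2 : |2 * Real.pi * η 0| ≤ 2 * Real.pi * (1 + ‖η‖) := by
        rw [abs_mul, abs_of_pos (by positivity)]
        have := PiLp.norm_apply_le η 0
        rw [Real.norm_eq_abs] at this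
        gcongr; linarith
      have h3 : 1 ≤ 2 * Real.pi * (1 + ‖η‖) := by nlinarith [norm_nonneg η]
      calc _ ≤ (2 * Real.pi * (1 + ‖η‖)) ^ s := Real.rpow_le_rpow (abs_nonneg _) h2 hs0
        _ ≤ (2 * Real.pi * (1 + ‖η‖)) ^ (1 : ℝ) := Real.rpow_le_rpow_of_exponent_le h3 hs1
        _ = _ := Real.rpow_one _
    rw [norm_mul, Complex.norm_real, Real.norm_of_nonneg (by positivity),
      Real.norm_of_nonneg (by positivity), Real.rpow_neg hp.le, Real.rpow_ofNat, ← div_eq_mul_inv,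
      le_div_iff₀ (by positivity)]
    calc _ ≤ 2 * Real.pi * (1 + ‖η‖) * ‖φ η‖ * (1 + ‖η‖) ^ 2 := by gcongr
      _ = 2 * Real.pi * (‖φ η‖ * (1 + ‖η‖) ^ 3) := by ring
      _ ≤ _ := by gcongr; exact hK η

theorem spaceWave_spaceEquiv (ζ η : SpaceTime) :
    spaceWave (spaceEquiv ζ) (spaceEquiv η) = (Real.fourierChar (inner ℝ ζ η) : ℂ) := by
  rw [spaceWave, planeWave, ← Complex.exp_add, Real.fourierChar_apply]
  congr 1
  simp only [spaceEquiv_apply, PiLp.inner_apply, Fin.sum_univ_three, RCLike.inner_apply, conj_trivial]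
  push_cast
  ring

theorem spaceTransform_fourier (φ : 𝓢(SpaceTime, ℂ)) (k : (ℝ × ℝ) × ℝ) :
    spaceTransform (fun q => 𝓕 φ (spaceEquiv.symm q)) k = φ (spaceEquiv.symm k) := by
  obtain ⟨η, rfl⟩ := spaceEquiv.surjective k
  rw [spaceTransform, ← measurePreserving_spaceEquiv.integral_comp', spaceEquiv.symm_apply_apply]
  simp_rw [spaceEquiv.symm_apply_apply, spaceWave_spaceEquiv]
  have h : 𝓕⁻ (𝓕 φ) η = φ η := by rw [fourierInv_fourier_eq]
  rw [← h, SchwartzMap.fourierInv_coe, Real.fourierInv_eq]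
  congr 1; ext ζ
  rw [Circle.smul_def, smul_eq_mul, mul_comm]

/-! ### The dyadic pieces -/

theorem measurable_pieceFourier (α : ℝ) (j : ℕ) (f : Lp ℂ 2 (volume : Measure SpaceTime)) :
    Measurable (pieceFourier α j f) := by
  have h1 : Measurable fun η : SpaceTime => chiSymbol α j ((2 * Real.pi) • η) :=
    (measurable_chiSymbol α j).comp (measurable_const_smul _)
  exact Complex.measurable_ofReal.comp (h1.mul (Lp.stronglyMeasurable (𝓕 f)).measurable.norm)

theorem abs_le_of_chi_ne_zero {j : ℕ} {σ : ℝ} (h : chi j σ ≠ 0) : |σ| ≤ 2 ^ j := by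
  cases j with
  | zero => rw [pow_zero]; exact (Set.mem_of_indicator_ne_zero h).2
  | succ j => exact (Set.mem_of_indicator_ne_zero h).2

theorem fourier_dyadicPiece (α : ℝ) (j : ℕ) (f : Lp ℂ 2 (volume : Measure SpaceTime)) :
    (𝓕 (dyadicPiece α j f) : Lp ℂ 2 (volume : Measure SpaceTime)) =ᵐ[volume]
      pieceFourier α j f := by
  rw [dyadicPiece, fourier_fourierInv_eq]
  exact (memLp_pieceFourier α j f).coeFn_toLp

theorem eLpNorm_pieceFourier (α : ℝ) (j : ℕ) (f : Lp ℂ 2 (volume : Measure SpaceTime)) :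
    eLpNorm (pieceFourier α j f) 2 volume = ENNReal.ofReal ‖dyadicPiece α j f‖ := by
  rw [← Lp.norm_fourier_eq, ofReal_norm, Lp.enorm_def, eLpNorm_congr_ae (fourier_dyadicPiece α j f)]

/-- The weight is continuous and positive, so multiplying by its inverse preserves local
integrability. -/
theorem locallyIntegrable_of_integrable_mul_spaceWeight {u : (ℝ × ℝ) × ℝ → ℂ}
    (h1 : Integrable fun q => u q * (spaceWeight q : ℂ)) :
    LocallyIntegrable fun η => u (spaceEquiv η) := by
  have h2 := (measurePreserving_spaceEquiv.integrable_comp_of_integrable h1).locallyIntegrable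
  have hc : Continuous fun η => ((spaceWeight (spaceEquiv η))⁻¹ : ℂ) := by
    refine (Complex.continuous_ofReal.comp ?_).inv₀ fun η =>
      Complex.ofReal_ne_zero.2 (spaceWeight_pos _).ne'
    have he : Continuous fun η : SpaceTime => spaceEquiv η := by
      change Continuous fun η : SpaceTime => ((η 0, η 1), η 2)
      fun_prop
    have hw : Continuous spaceWeight := by
      have h1 : Continuous planeWeight := (continuous_const.add continuous_norm).rpow_const
        fun z => Or.inl (add_pos_of_pos_of_nonneg one_pos (norm_nonneg z)).ne'
      have h2 : Continuous timeWeight := (continuous_const.add continuous_norm).rpow_const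
        fun z => Or.inl (add_pos_of_pos_of_nonneg one_pos (norm_nonneg z)).ne'
      exact (h1.comp continuous_fst).mul (h2.comp continuous_snd)
    exact hw.comp he
  have h3 := (locallyIntegrableOn_univ.2 h2).mul_continuousOn hc.continuousOn
    isOpen_univ.isLocallyClosed
  rw [locallyIntegrableOn_univ] at h3
  refine h3.congr (Filter.Eventually.of_forall fun η => ?_)
  have : (spaceWeight (spaceEquiv η) : ℂ) ≠ 0 := by exact_mod_cast (spaceWeight_pos _).ne'
  simp only [Function.comp_apply]
  rw [mul_assoc, mul_inv_cancel₀ this, mul_one]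

/-- The estimate for one pair of exponents, for a locally integrable representative. -/
theorem exists_isAbsDx_dyadicPiece {α θ : ℝ} (hθ0 : 0 ≤ θ) (hθ1 : θ < 1)
    (f : Lp ℂ 2 (volume : Measure SpaceTime)) (j : ℕ) :
    ∃ u : SpaceTime → ℂ, LocallyIntegrable u ∧ IsAbsDx (θ / 2) (dyadicPiece α j f) u ∧
      ∀ T : ℝ, 0 < T → T < 1 →
        mixedNorm T (2 / ENNReal.ofReal θ) (ENNReal.ofReal (2 / (1 - θ))) u ≤
          ENNReal.ofReal (strichartzConst α θ ^ (1 / 2 : ℝ) * (2 : ℝ) ^ ((j : ℝ) / 2) *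
            ‖dyadicPiece α j f‖) := by
  have mp := measurePreserving_spaceEquiv
  have mps := mp.symm
  have hC := strichartzConst_pos α hθ1
  have hGm : Measurable fun k => pieceFourier α j f (spaceEquiv.symm k) :=
    (measurable_pieceFourier α j f).comp spaceEquiv.symm.measurable
  -- The support of `χ_j` gives the band width `Λ = 2^j`. Its square root is the factor `2^(j/2)` of
  -- the estimate.
  obtain ⟨u, hum, hub, hut⟩ := exists_strichartz (α := α) (Λ := 2 ^ j) (by positivity) hθ0 hθ1 hGm
    ((memLp_pieceFourier α j f).comp_measurePreserving mps) (by
      intro k hk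
      have h1 : chiSymbol α j ((2 * Real.pi) • spaceEquiv.symm k) ≠ 0 := fun h0 => hk (by
        rw [pieceFourier, h0, zero_mul, Complex.ofReal_zero])
      exact abs_le_of_chi_ne_zero h1)
  have hui : ∀ φ : 𝓢(SpaceTime, ℂ), Integrable (fun q => u q * φ (spaceEquiv.symm q)) := fun φ => by
    refine (hut _ (φ.continuous.measurable.comp
      spaceEquiv.symm.measurable).aestronglyMeasurable ?_).1
    obtain ⟨K, hK⟩ := φ.exists_norm_le_spaceWeight
    refine ⟨K, fun q => ?_⟩
    have := hK (spaceEquiv.symm q)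
    rwa [spaceEquiv.apply_symm_apply] at this
  refine ⟨fun η => u (spaceEquiv η), ?_, ⟨?_, ?_, fun φ => ⟨?_, ?_, ?_⟩⟩, fun T hT0 hT1 => ?_⟩
  · exact locallyIntegrable_of_integrable_mul_spaceWeight (hut (fun q => (spaceWeight q : ℂ))
      (Complex.measurable_ofReal.comp measurable_spaceWeight).aestronglyMeasurable
      ⟨1, fun q => by rw [one_mul, Complex.norm_real, Real.norm_of_nonneg (spaceWeight_pos q).le]⟩).1
  · exact (hum.comp spaceEquiv.measurable).aestronglyMeasurable
  · refine AEStronglyMeasurable.mul ?_ (Lp.aestronglyMeasurable _)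
    have hc : Continuous fun η : SpaceTime => |2 * Real.pi * η 0| ^ (θ / 2) :=
      (by fun_prop : Continuous fun η : SpaceTime => |2 * Real.pi * η 0|).rpow_const
        fun _ => Or.inr (by positivity)
    exact (Complex.continuous_ofReal.comp hc).aestronglyMeasurable
  · have := mp.integrable_comp_of_integrable (hui φ)
    simpa only [Function.comp_def, spaceEquiv.symm_apply_apply] using this
  · have h1 := (Lp.memLp (𝓕 (dyadicPiece α j f))).integrable_mul
      (memLp_abs_rpow_mul φ (s := θ / 2) (by positivity) (by linarith))
    refine h1.congr (Filter.Eventually.of_forall fun η => ?_)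
    simp only [Pi.mul_apply]
    ring
  · have hψ := (hut (fun q => 𝓕 φ (spaceEquiv.symm q)) ((𝓕 φ).continuous.measurable.comp
      spaceEquiv.symm.measurable).aestronglyMeasurable (by
        obtain ⟨K, hK⟩ := (𝓕 φ).exists_norm_le_spaceWeight
        refine ⟨K, fun q => ?_⟩
        have := hK (spaceEquiv.symm q)
        rwa [spaceEquiv.apply_symm_apply] at this)).2
    have e : absAmplitude (θ / 2) (spaceTransform fun q => 𝓕 φ (spaceEquiv.symm q)) =
        fun k => ((|2 * Real.pi * k.1.1| ^ (θ / 2) : ℝ) : ℂ) * φ (spaceEquiv.symm k) := by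
      ext k
      rw [absAmplitude, spaceTransform_fourier]
    simp_rw [e, absAmplitude, spaceTransform_fourier] at hψ
    have hm := (memLp_abs_rpow_mul φ (s := θ / 2) (by positivity)
      (by linarith)).comp_measurePreserving mps
    simp only [Function.comp_def, spaceEquiv_symm_apply_zero] at hm
    have h1 := hψ hm
    rw [← mp.integral_comp', ← mp.integral_comp'] at h1
    simp only [spaceEquiv.symm_apply_apply] at h1
    rw [h1]
    apply integral_congr_ae
    filter_upwards [fourier_dyadicPiece α j f] with η hη
    rw [hη]
    rfl
  · have hsub : volume.restrict (Set.Icc (-T) T) ≤ volume.restrict (Set.Icc (-1 : ℝ) 1) :=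
      Measure.restrict_mono (Set.Icc_subset_Icc (by linarith) hT1.le) le_rfl
    refine (eLpNorm_mono_measure _ hsub).trans ?_
    simp only [localMixedNorm, add_zero] at hub
    refine hub.trans (le_of_eq ?_)
    have e := eLpNorm_comp_measurePreserving (p := 2)
      (measurable_pieceFourier α j f).aestronglyMeasurable mps
    rw [Function.comp_def] at e
    rw [e, eLpNorm_pieceFourier, ENNReal.ofReal_rpow_of_nonneg (by positivity) (by norm_num),
      ← ENNReal.ofReal_mul (by positivity), Real.mul_rpow hC.le (by positivity),
      ← Real.rpow_natCast, ← Real.rpow_mul (by norm_num)]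
    congr 4
    ring

theorem dyadicEstimate {θ : ℝ} (α : ℝ) (hθ0 : 0 ≤ θ) (hθ1 : θ < 1) :
    DyadicEstimate α (θ / 2) (2 / ENNReal.ofReal θ) (ENNReal.ofReal (2 / (1 - θ))) := by
  refine ⟨strichartzConst α θ ^ (1 / 2 : ℝ), Real.rpow_pos_of_pos (strichartzConst_pos α hθ1) _,
    fun f j => ?_⟩
  obtain ⟨u, -, h1, h2⟩ := exists_isAbsDx_dyadicPiece (α := α) hθ0 hθ1 f j
  exact ⟨u, h1, h2⟩

theorem dyadicEstimate_of_pos {θ : ℝ} (α : ℝ) (hθ0 : 0 < θ) (hθ1 : θ < 1) :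
    DyadicEstimate α (θ / 2) (ENNReal.ofReal (2 / θ)) (ENNReal.ofReal (2 / (1 - θ))) := by
  have := dyadicEstimate α hθ0.le hθ1
  rwa [← ENNReal.ofReal_ofNat 2, ← ENNReal.ofReal_div_of_pos hθ0] at this

/-- Here `θ = δ(r)`, for which `1 - θ = 2 / r`. Inverting `2 / q = θ` among extended nonnegative
reals also covers `r = 2`, `q = ∞`. -/
theorem dyadicEstimate_delta (α : ℝ) {r : ℝ} {q : ℝ≥0∞} (hr : 2 ≤ r)
    (hq : 2 / q = ENNReal.ofReal (delta r)) :
    DyadicEstimate α (delta r / 2) q (ENNReal.ofReal r) := by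
  have hr0 : 0 < r := by linarith
  have h1 : delta r = 1 - 2 / r := by rw [delta]; ring
  have h2 : 2 / r ≤ 1 := by rw [div_le_one hr0]; exact hr
  have h3 : 0 < 2 / r := by positivity
  have := dyadicEstimate (θ := delta r) α (by linarith) (by linarith)
  have hq' : 2 / ENNReal.ofReal (delta r) = q := by
    rw [← hq, ENNReal.div_eq_inv_mul, ENNReal.inv_div (Or.inr (by norm_num)) (Or.inr two_ne_zero),
      ENNReal.div_mul_cancel two_ne_zero (by norm_num)]
  rwa [hq', h1, show 2 / (1 - (1 - 2 / r)) = r by field_simp; ring, ← h1] at this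

theorem mixedNorm_congr_ae {u v : SpaceTime → ℂ} (h : u =ᵐ[volume] v) (T : ℝ) (q r : ℝ≥0∞) :
    mixedNorm T q r u = mixedNorm T q r v := by
  have h1 : ∀ᵐ x : ℝ × (ℝ × ℝ), u (spaceEquiv.symm x.swap) = v (spaceEquiv.symm x.swap) :=
    Measure.measurePreserving_swap.quasiMeasurePreserving.ae
      (measurePreserving_spaceEquiv.symm.quasiMeasurePreserving.ae h)
  apply eLpNorm_congr_ae
  filter_upwards [ae_restrict_of_ae (Measure.ae_ae_of_ae_prod h1)] with t ht
  exact eLpNorm_congr_ae ht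

/-- For `s = 0` the representative has the same Fourier transform as `f_j`. Testing against `φ = 𝓕
(𝓕⁻ φ)` identifies the two, so the energy estimate holds for `f_j` itself. -/
theorem ae_eq_dyadicPiece {α : ℝ} {j : ℕ} {f : Lp ℂ 2 (volume : Measure SpaceTime)}
    {u : SpaceTime → ℂ} (hu : LocallyIntegrable u) (h : IsAbsDx 0 (dyadicPiece α j f) u) :
    dyadicPiece α j f =ᵐ[volume] u := by
  refine ae_eq_of_integral_mul_schwartz_eq ((Lp.memLp _).locallyIntegrable one_le_two) hu
    fun φ => ?_
  have h1 := (h.2.2 (𝓕⁻ φ)).2.2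
  rw [fourier_fourierInv_eq] at h1
  have h2 := congrArg (fun S => S (𝓕⁻ φ)) (Lp.fourier_toTemperedDistribution_eq (dyadicPiece α j f))
  simp only [TemperedDistribution.fourier_apply, Lp.toTemperedDistribution_apply,
    smul_eq_mul, fourier_fourierInv_eq] at h2
  rw [h1]
  simp only [Real.rpow_zero, Complex.ofReal_one, one_mul]
  simp_rw [mul_comm _ (φ _), h2, mul_comm]

theorem mixedNorm_dyadicPiece_le {α : ℝ} (f : Lp ℂ 2 (volume : Measure SpaceTime)) (j : ℕ) {T : ℝ}
    (hT0 : 0 < T) (hT1 : T < 1) : mixedNorm T ∞ 2 (dyadicPiece α j f) ≤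
      ENNReal.ofReal (strichartzConst α 0 ^ (1 / 2 : ℝ) * (2 : ℝ) ^ ((j : ℝ) / 2) *
        ‖dyadicPiece α j f‖) := by
  obtain ⟨u, h0, h1, h2⟩ := exists_isAbsDx_dyadicPiece (α := α) le_rfl zero_lt_one f j
  rw [zero_div] at h1
  have h3 := h2 T hT0 hT1
  rw [ENNReal.ofReal_zero, ENNReal.div_zero two_ne_zero, sub_zero, div_one,
    ENNReal.ofReal_ofNat] at h3
  rwa [mixedNorm_congr_ae (ae_eq_dyadicPiece h0 h1)]

end

theorem proposition3 (α : ℝ) :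
    (∀ (r : ℝ) (q : ℝ≥0∞), 2 ≤ r → 2 / q = ENNReal.ofReal (delta r) →
      DyadicEstimate α (delta r / 2) q (ENNReal.ofReal r)) ∧
    (∃ C : ℝ, 0 < C ∧ ∀ (f : Lp ℂ 2 (volume : Measure SpaceTime)) (j : ℕ) (T : ℝ),
      0 < T → T < 1 →
        mixedNorm T ∞ 2 (dyadicPiece α j f) ≤
          ENNReal.ofReal (C * (2 : ℝ) ^ ((j : ℝ) / 2) * ‖dyadicPiece α j f‖)) ∧
    DyadicEstimate α (1 / 4) 4 4 ∧
    (∀ δ : ℝ, 0 < δ → δ < 1 / 2 →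
      DyadicEstimate α δ (ENNReal.ofReal (1 / δ)) (ENNReal.ofReal (2 / (1 - 2 * δ)))) ∧
    (∀ δ : ℝ, 0 < δ → δ < 1 / 2 →
      DyadicEstimate α (1 / 2 - δ) (ENNReal.ofReal (2 / (1 - 2 * δ)))
        (ENNReal.ofReal (1 / δ))) := by
  refine ⟨fun r q hr hq => dyadicEstimate_delta α hr hq,
    ⟨strichartzConst α 0 ^ (1 / 2 : ℝ), Real.rpow_pos_of_pos (strichartzConst_pos α zero_lt_one) _,
      fun f j T hT0 hT1 => mixedNorm_dyadicPiece_le f j hT0 hT1⟩, ?_, fun δ h0 h1 => ?_,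
    fun δ h0 h1 => ?_⟩
  -- The three remaining estimates are the cases `θ = 1/2`, `θ = 2δ` and `θ = 1 - 2δ`.
  · have := dyadicEstimate_of_pos (θ := 1 / 2) α (by norm_num) (by norm_num)
    norm_num at this ⊢
    exact this
  · have := dyadicEstimate_of_pos (θ := 2 * δ) α (by linarith) (by linarith)
    rwa [mul_div_cancel_left₀ δ two_ne_zero, div_mul_cancel_left₀ two_ne_zero, ← one_div] at this
  · have h2 : 0 < 1 - 2 * δ := by linarith
    have := dyadicEstimate_of_pos (θ := 1 - 2 * δ) α h2 (by linarith)
    rwa [show (1 - 2 * δ) / 2 = 1 / 2 - δ by ring, sub_sub_cancel,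
      div_mul_cancel_left₀ two_ne_zero, ← one_div] at this
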